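/- **Setting.** Let $X=\mathbb{Z}\varpi_1\oplus\mathbb{Z}\varpi_2$ be the weight lattice of $Sp_4(\mathbb{C})$ (type $C_2$), $X_+=\mathbb{Z}_{\ge 0}\varpi_1\oplus\mathbb{Z}_{\ge 0}\varpi_2$, with simple roots $\alpha_1=2\varpi_1-\varpi_2$, $\alpha_2=-2\varpi_1+2\varpi_2$, positive roots $\alpha_1,\ \alpha_2,\ \alpha_1+\alpha_2=\varpi_2,\ 2\alpha_1+\alpha_2=2\varpi_1$, Weyl group $W$, $\rho=\varpi_1+\varpi_2$ and dot action $w\cdot\lambda=w(\lambda+\rho)-\rho$. Write $\lambda=(\lambda_1,\lambda_2)$ for $\lambda=\lambda_1\varpi_1+\lambda_2\varpi_2$. **Hecke algebra side.** Let $\widetilde W=X\rtimes W$ be the extended affine Weyl group with length function $\ell$, and let $H$ be its Hecke algebra over $\mathbb{Z}[v,v^{-1}]$ with standard basis $(H_x)_{x\in\widetilde W}$, $(H_s+v)(H_s-v^{-1})=0$ for simple reflections $s$, and bar involution $v\mapsto v^{-1}$, $H_x\mapsto (H_{x^{-1}})^{-1}$. The spherical Hecke algebra $\mathcal{H}\subset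 H$ has the $\mathbb{Z}[v,v^{-1}]$-basis $$\mathbf{H}_\lambda=\sum_{x\in Wt_\lambda W} v^{\ell(\theta(\lambda))-\ell(x)}H_x\qquad(\lambda\in X_+),$$ where $\theta(\lambda)$ is the longest element of $Wt_\lambda W$. Its Kazhdan–Lusztig basis $(\underline{\mathbf{H}}_\lambda)_{\lambda\in X_+}$ consists of the unique bar-invariant elements with $\underline{\mathbf{H}}_\lambda\in\mathbf{H}_\lambda+\sum_{\mu\ne\lambda}v\mathbb{Z}[v]\,\mathbf{H}_\mu$. For arbitrary $\lambda\in X$ put $\underline{\mathbf{H}}_\lambda=(-1)^{\ell(w)}\underline{\mathbf{H}}_{w\cdot\lambda}$ if $w\in W$ satisfies $w\cdot\lambda\in X_+$, and $\underline{\mathbf{H}}_\lambda=0$ if there is no such $w$. Let $$\mathbf{N}^i_\lambda=\sum_{I\subseteq\Phi^{\ge i}}(-v^2)^{|I|}\,\underline{\mathbf{H}}_{\lambda-\sum_{\alpha\in I}\alpha},$$ where $\Phi^{\ge i}$ is the set of positive roots of height at least $i$ (so $\Phi^{\ge 3}=\{2\varpi_1\}$), and for $\lambda\in X_+$ let $\tilde{\mathbf{N}}^3_\lambda=\mathbf{N}^3_\lambda$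 if $\lambda_1\neq 0$ and $\tilde{\mathbf{N}}^3_\lambda=\underline{\mathbf{H}}_\lambda$ if $\lambda_1=0$. Let $(-)_{v=1}:\mathcal{H}\to\mathbb{Z}[X_+]$ be the additive map that sets $v=1$ and sends $\mathbf{H}_\lambda$ to $e^\lambda$. **Crystal side.** For $\lambda\in X_+$ let $\mathcal{B}(\lambda)$ be the crystal of highest weight $\lambda$, realized on the Kashiwara–Nakashima tableaux of shape $[\lambda_1+\lambda_2,\lambda_2]$ in the alphabet $1<2<\bar2<\bar1$: the semistandard tableaux with no column consisting of $1,\bar 1$, whose splitting (replace each column $2,\bar 2$ by the two columns $1,\bar2$ and $2,\bar1$, and double every other column) is semistandard. With $t_i(T)$ the number of letters $i$ minus the number of letters $\bar i$ in $T$, the weight is $\mathrm{wt}(T)=(t_1(T)-t_2(T))\varpi_1+t_2(T)\varpi_2$. Let $\Phi:\mathcal{B}(\mu)\to\mathcal{B}(\mu+2\varpi_1)$ be the embedding that adds a $1$ at the left end and a $\bar1$ at the right end of the first row and then replaces a column $1,\bar1$, if one occurs, by the column $2,\bar2$. The principal preatom is $\mathcal{P}(\lambda)=\mathcal{B}(\lambda)\setminus\Phi(\mathcal{B}(\lambda-2\varpi_1))$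 if $\lambda_1\ge2$, and $\mathcal{P}(\lambda)=\mathcal{B}(\lambda)$ if $\lambda_1\le1$. For $C\subseteq\mathcal{B}(\lambda)$ stable under $W$, its ungraded (dominant) character is $$[C]_{v=1}=\sum_{T\in C,\ \mathrm{wt}(T)\in X_+}e^{\mathrm{wt}(T)}\in\mathbb{Z}[X_+].$$ **Proposition.** For every $\lambda\in X_+$, $$[\mathcal{B}(\lambda)]_{v=1}=(\underline{\mathbf{H}}_\lambda)_{v=1}\qquad\text{and}\qquad[\mathcal{P}(\lambda)]_{v=1}=(\tilde{\mathbf{N}}^3_\lambda)_{v=1}.$$ -/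

import Mathlib

namespace TypeC2

open LaurentPolynomial

/-! ### Weights, roots and the Weyl group of type `C₂` -/

/-- The weight lattice `X` of `Sp₄`; the pair `(a, b)` is `a ϖ₁ + b ϖ₂`. -/
abbrev Weight := ℤ × ℤ

/-- The dominant weights `X₊`. -/
abbrev DomWeight := ℕ × ℕ

/-- The inclusion of `X₊` in `X`. -/
def DomWeight.toWeight (lam : DomWeight) : Weight := (lam.1, lam.2)

/-- `α₁ = 2ϖ₁ - ϖ₂`. -/
def alpha1 : Weight := (2, -1)

/-- `α₂ = -2ϖ₁ + 2ϖ₂`. -/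
def alpha2 : Weight := (-2, 2)

/-- The positive roots `α₁, α₂, α₂₁ = α₁ + α₂, α₁₂ = 2α₁ + α₂`, given by their coefficients in the
simple roots. -/
def posRoots : Finset (ℕ × ℕ) := {(1, 0), (0, 1), (1, 1), (2, 1)}

/-- The weight `m₁ α₁ + m₂ α₂`. -/
def rootWeight (m : ℕ × ℕ) : Weight := m.1 • alpha1 + m.2 • alpha2

/-- The height of `m₁ α₁ + m₂ α₂`. -/
def rootHeight (m : ℕ × ℕ) : ℕ := m.1 + m.2

/-- The positive coroots `α₁^∨, α₂^∨, α₂₁^∨ = α₁^∨ + 2α₂^∨, α₁₂^∨ = α₁^∨ + α₂^∨`, given by their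
coefficients in the simple coroots. -/
def posCoroots : Finset (ℤ × ℤ) := {(1, 0), (0, 1), (1, 2), (1, 1)}

/-- The pairing `⟨μ, c₁ α₁^∨ + c₂ α₂^∨⟩`. The simple coroots are dual to the fundamental weights. -/
def pairing (mu : Weight) (c : ℤ × ℤ) : ℤ := c.1 * mu.1 + c.2 * mu.2

/-- `ρ = ϖ₁ + ϖ₂`, the half-sum of the positive roots. -/
def rho : Weight := (1, 1)

/-- The simple reflection `s₁ μ = μ - ⟨μ, α₁^∨⟩ α₁`. -/
def refl1 : Weight ≃+ Weight where
  toFun mu := mu - pairing mu (1, 0) • alpha1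
  invFun mu := mu - pairing mu (1, 0) • alpha1
  left_inv mu := by ext <;> simp [pairing, alpha1] <;> ring
  right_inv mu := by ext <;> simp [pairing, alpha1] <;> ring
  map_add' mu nu := by ext <;> simp [pairing, alpha1] <;> ring

/-- The simple reflection `s₂ μ = μ - ⟨μ, α₂^∨⟩ α₂`. -/
def refl2 : Weight ≃+ Weight where
  toFun mu := mu - pairing mu (0, 1) • alpha2
  invFun mu := mu - pairing mu (0, 1) • alpha2
  left_inv mu := by ext <;> simp [pairing, alpha2] <;> ring
  right_inv mu := by ext <;> simp [pairing, alpha2] <;> ring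
  map_add' mu nu := by ext <;> simp [pairing, alpha2] <;> ring

/-- The finite Weyl group `W`, generated by `s₁` and `s₂` as a group of automorphisms of the weight
lattice (written multiplicatively, so that the semidirect product below can be formed). -/
def weylGroup : Subgroup (MulAut (Multiplicative Weight)) :=
  Subgroup.closure {AddEquiv.toMultiplicative refl1, AddEquiv.toMultiplicative refl2}

/-- The action of `W` on the weight lattice. -/
def weylAct (w : weylGroup) (mu : Weight) : Weight :=
  Multiplicative.toAdd (w.1 (Multiplicative.ofAdd mu))

/-- The simple reflection `s₁` as an element of `W`. -/
def weylS1 : weylGroup :=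
  ⟨AddEquiv.toMultiplicative refl1, Subgroup.subset_closure (Set.mem_insert _ _)⟩

/-- The simple reflection `s₂` as an element of `W`. -/
def weylS2 : weylGroup :=
  ⟨AddEquiv.toMultiplicative refl2, Subgroup.subset_closure (Set.mem_insert_of_mem _ rfl)⟩

/-! ### The extended affine Weyl group and its length function -/

/-- The extended affine Weyl group `X ⋊ W`; the pair `(λ, w)` is `t_λ w`, acting on
`X ⊗ ℝ` by `x ↦ w x + λ`. -/
abbrev ExtAffWeyl := Multiplicative Weight ⋊[weylGroup.subtype] weylGroup

/-- The translation `t_λ`. -/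
def transl (lam : Weight) : ExtAffWeyl := SemidirectProduct.inl (Multiplicative.ofAdd lam)

/-- The inclusion of `W` in the extended affine Weyl group. -/
def ofWeyl (w : weylGroup) : ExtAffWeyl := SemidirectProduct.inr w

/-- The length of `x = t_λ w`: the number of affine hyperplanes `⟨·, α^∨⟩ = m` that separate the
fundamental alcove from its image under `x`. For a given positive root `α` there are
`|⟨λ, α^∨⟩|` of them if `w⁻¹ α > 0`, that is, if `⟨w ρ, α^∨⟩ > 0`, and `|⟨λ, α^∨⟩ - 1|`
otherwise. -/
def len (x : ExtAffWeyl) : ℕ :=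
  ∑ c ∈ posCoroots,
    Int.natAbs (pairing (Multiplicative.toAdd x.left) c -
      if pairing (weylAct x.right rho) c < 0 then 1 else 0)

/-- The simple reflections `s₀, s₁, s₂` of the affine Weyl group. Here `s₀` is the reflection in the
hyperplane `⟨·, α₂₁^∨⟩ = 1`, that is, translation by `α₂₁ = ϖ₂` after the reflection
`s₂ s₁ s₂` attached to `α₂₁`. -/
def affS : Fin 3 → ExtAffWeyl
  | 0 => transl (rootWeight (1, 1)) * ofWeyl (weylS2 * weylS1 * weylS2)
  | 1 => ofWeyl weylS1
  | 2 => ofWeyl weylS2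

/-! ### The affine Hecke algebra and its bar involution -/

/-- The extended affine Hecke algebra, as the free `ℤ[v, v⁻¹]`-module on its standard basis
`H_x = single x 1`; the Laurent variable `T 1` is `v`. -/
abbrev Hecke := ExtAffWeyl →₀ ℤ[T;T⁻¹]

/-- Left multiplication by `H_s` on `H_x`, for `s = s_i`: it is `H_{sx}` if `sx > x` and
`H_{sx} + (v⁻¹ - v) H_x` if `sx < x`. -/
noncomputable def simpleMulStd (i : Fin 3) (x : ExtAffWeyl) : Hecke :=
  if len x < len (affS i * x) then Finsupp.single (affS i * x) 1
  else Finsupp.single (affS i * x) 1 + Finsupp.single x (T (-1) - T 1)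

/-- Left multiplication by `H_s`, for `s = s_i`. -/
noncomputable def simpleMul (i : Fin 3) (h : Hecke) : Hecke :=
  h.sum fun x f => f • simpleMulStd i x

/-- Left multiplication by `H_s⁻¹ = H_s + v - v⁻¹`, for `s = s_i`. -/
noncomputable def simpleInvMul (i : Fin 3) (h : Hecke) : Hecke :=
  simpleMul i h + (T 1 - T (-1) : ℤ[T;T⁻¹]) • h

open Classical in
/-- The bar involution on the standard basis, `bar H_x = (H_{x⁻¹})⁻¹`, computed along a reduced
expression of `x`: if `s = s_i` satisfies `sx < x` then `bar H_x = H_s⁻¹ · bar H_{sx}`, and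
`bar H_x = H_x` if `x` has length `0`. -/
noncomputable def barStd (x : ExtAffWeyl) : Hecke :=
  if h : ∃ i, len (affS i * x) < len x then
    simpleInvMul h.choose (barStd (affS h.choose * x))
  else Finsupp.single x 1
termination_by len x
decreasing_by exact h.choose_spec

/-- The bar involution of the Hecke algebra: the additive map with `v ↦ v⁻¹` and
`H_x ↦ (H_{x⁻¹})⁻¹`. -/
noncomputable def bar (h : Hecke) : Hecke :=
  h.sum fun x f => LaurentPolynomial.invert f • barStd x

/-! ### The spherical Hecke algebra, its Kazhdan–Lusztig basis and its pre-canonical bases -/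

/-- The spherical Hecke algebra, as the free `ℤ[v, v⁻¹]`-module on its standard basis
`H_λ = single λ 1`, `λ ∈ X₊`. -/
abbrev Sph := DomWeight →₀ ℤ[T;T⁻¹]

/-- The double coset `W t_λ W`. -/
def dblCoset (lam : DomWeight) : Set ExtAffWeyl :=
  {x | ∃ w u : weylGroup, x = ofWeyl w * transl lam.toWeight * ofWeyl u}

/-- The length of the longest element of `W t_λ W`. -/
noncomputable def maxLen (lam : DomWeight) : ℕ := sSup (len '' dblCoset lam)

/-- The standard basis element `H_λ` as an element of the affine Hecke algebra:
`∑_{x ∈ W t_λ W} v^{ℓ(θ(λ)) - ℓ(x)} H_x`, with `θ(λ)` the longest element of `W t_λ W`. -/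
noncomputable def sphStd (lam : DomWeight) : Hecke :=
  ∑ᶠ x ∈ dblCoset lam, Finsupp.single x (T ((maxLen lam : ℤ) - (len x : ℤ)))

/-- The inclusion of the spherical Hecke algebra in the affine Hecke algebra. -/
noncomputable def sphToHecke (h : Sph) : Hecke := h.sum fun lam f => f • sphStd lam

/-- The defining property of the Kazhdan–Lusztig basis element: it is invariant under the bar
involution and lies in `H_λ + ∑_{μ ≠ λ} v ℤ[v] H_μ`. -/
def IsKL (lam : DomWeight) (b : Sph) : Prop :=
  bar (sphToHecke b) = sphToHecke b ∧ b lam = 1 ∧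
    ∀ mu, mu ≠ lam → ∃ p : Polynomial ℤ, b mu = Polynomial.toLaurent (Polynomial.X * p)

open Classical in
/-- The Kazhdan–Lusztig basis element indexed by a dominant weight `λ`: the element with the
defining property. (The value `0` would be taken only if there were no such element.) -/
noncomputable def klDom (lam : DomWeight) : Sph :=
  if h : ∃ b, IsKL lam b then h.choose else 0

/-- The dot action `w · λ = w (λ + ρ) - ρ`. -/
def dotAct (w : weylGroup) (lam : Weight) : Weight := weylAct w (lam + rho) - rho

open Classical in
/-- The extension of the Kazhdan–Lusztig basis to all weights: `(-1)^{ℓ(w)}` times the element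
indexed by `w · λ` if `w · λ` is dominant for some `w ∈ W`, and `0` if there is no such `w`
(that is, if `λ + ρ` is singular). -/
noncomputable def kl (lam : Weight) : Sph :=
  if h : ∃ p : weylGroup × DomWeight, dotAct p.1 lam = p.2.toWeight then
    (-1 : ℤ[T;T⁻¹]) ^ len (ofWeyl h.choose.1) • klDom h.choose.2
  else 0

/-- The pre-canonical basis element
`N^i_λ = ∑_{I ⊆ Φ^{≥ i}} (-v²)^{|I|} H̲_{λ - ∑_{α ∈ I} α}`, where `Φ^{≥ i}` is the set of
positive roots of height at least `i`. -/
noncomputable def precan (i : ℕ) (lam : Weight) : Sph :=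
  ∑ I ∈ (posRoots.filter fun m => i ≤ rootHeight m).powerset,
    (-(T 2) : ℤ[T;T⁻¹]) ^ I.card • kl (lam - ∑ m ∈ I, rootWeight m)

/-- The modified pre-canonical basis element `Ñ³_λ`: it is `N³_λ` if `λ₁ ≠ 0` and `H̲_λ` if
`λ₁ = 0`. -/
noncomputable def modPrecan3 (lam : DomWeight) : Sph :=
  if lam.1 ≠ 0 then precan 3 lam.toWeight else kl lam.toWeight

/-- The specialization at `v = 1`, sending `H_λ` to `e^λ`. -/
noncomputable def specialize (h : Sph) : AddMonoidAlgebra ℤ DomWeight :=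
  h.sum fun lam f =>
    AddMonoidAlgebra.single lam (LaurentPolynomial.eval₂ (RingHom.id ℤ) (1 : ℤˣ) f)

/-! ### Kashiwara–Nakashima tableaux of type `C₂` -/

/-- The alphabet `1 < 2 < 2̄ < 1̄`; the four letters are `0, 1, 2, 3` in this order. -/
abbrev Letter := Fin 4

/-- The letter `1`. -/
abbrev l1 : Letter := 0

/-- The letter `2`. -/
abbrev l2 : Letter := 1

/-- The letter `2̄`. -/
abbrev l2b : Letter := 2

/-- The letter `1̄`. -/
abbrev l1b : Letter := 3

/-- A filling of a (left-justified) two-row shape, given by its rows. -/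
@[ext]
structure Tableau where
  row1 : List Letter
  row2 : List Letter

/-- Semistandard: rows weakly increase from left to right, columns strictly increase from top to
bottom. -/
def Tableau.IsSemistandard (t : Tableau) : Prop :=
  t.row2.length ≤ t.row1.length ∧ t.row1.Pairwise (· ≤ ·) ∧ t.row2.Pairwise (· ≤ ·) ∧
    ∀ (j : ℕ) (a b : Letter), t.row1[j]? = some a → t.row2[j]? = some b → a < b

/-- Every column is admissible. With two letters this says that no column contains both `1` and
`1̄`: a column containing `z` and `z̄` needs an unbarred letter `t < z` such that neither `t` nor
`t̄` is in the column. -/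
def Tableau.IsAdmissible (t : Tableau) : Prop :=
  ∀ j : ℕ, ¬ (t.row1[j]? = some l1 ∧ t.row2[j]? = some l1b)

/-- The splitting: every column `C` is replaced by the two columns `lC`, `rC`. The column with
entries `2`, `2̄` is split into the column `1`, `2̄` and the column `2`, `1̄` (here `z = 2`,
`t = 1`); every other admissible column is doubled. -/
def Tableau.split (t : Tableau) : Tableau where
  row1 := (t.row1.mapIdx fun j a =>
    if a = l2 ∧ t.row2[j]? = some l2b then [l1, l2] else [a, a]).flatten
  row2 := (t.row2.mapIdx fun j b =>
    if t.row1[j]? = some l2 ∧ b = l2b then [l2b, l1b] else [b, b]).flatten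

/-- Kashiwara–Nakashima tableaux. -/
def Tableau.IsKN (t : Tableau) : Prop :=
  t.IsSemistandard ∧ t.IsAdmissible ∧ t.split.IsSemistandard

/-- The weight: `t_i` is the number of letters `i` minus the number of letters `ī`, and the weight is
`(t₁ - t₂) ϖ₁ + t₂ ϖ₂`. -/
def Tableau.wt (t : Tableau) : Weight :=
  let n (a : Letter) : ℤ := (t.row1.count a + t.row2.count a : ℕ)
  ((n l1 - n l1b) - (n l2 - n l2b), n l2 - n l2b)

/-- The crystal `B(λ)`: the Kashiwara–Nakashima tableaux of shape `[λ₁ + λ₂, λ₂]`. -/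
def crystal (lam : DomWeight) : Set Tableau :=
  {t | t.row1.length = lam.1 + lam.2 ∧ t.row2.length = lam.2 ∧ t.IsKN}

/-- The first step of `Φ`: add a `1` at the left end and a `1̄` at the right end of the first row. -/
def Tableau.extend (t : Tableau) : Tableau where
  row1 := l1 :: (t.row1 ++ [l1b])
  row2 := t.row2

/-- The second step of `Φ`: replace a column with entries `1`, `1̄` by the column with entries
`2`, `2̄`. -/
def Tableau.repair (t : Tableau) : Tableau where
  row1 := t.row1.mapIdx fun j a => if a = l1 ∧ t.row2[j]? = some l1b then l2 else a
  row2 := t.row2.mapIdx fun j b => if t.row1[j]? = some l1 ∧ b = l1b then l2b else b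

/-- The embedding of crystals `Φ : B(λ) → B(λ + 2ϖ₁)`, on tableaux. -/
def Tableau.Phi (t : Tableau) : Tableau := t.extend.repair

/-- The principal preatom `P(λ)`: the complement of `Φ(B(λ - 2ϖ₁))` in `B(λ)` if `λ₁ ≥ 2`, and
`B(λ)` if `λ₁ ≤ 1`. -/
def principalPreatom (lam : DomWeight) : Set Tableau :=
  if 2 ≤ lam.1 then crystal lam \ (Tableau.Phi '' crystal (lam.1 - 2, lam.2)) else crystal lam

/-- The ungraded dominant character: the sum of `e^{wt(T)}` over the elements `T` of `C` of dominant
weight. -/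
noncomputable def domChar (C : Set Tableau) : AddMonoidAlgebra ℤ DomWeight :=
  ∑ᶠ t ∈ {t ∈ C | 0 ≤ t.wt.1 ∧ 0 ≤ t.wt.2},
    AddMonoidAlgebra.single (t.wt.1.toNat, t.wt.2.toNat) 1

end TypeC2

namespace TypeC2

open LaurentPolynomial

/-! ### The Weyl group -/

/-! Both sides count weight multiplicities of the irreducible representation of `Sp₄` with highest
weight `λ`; the Hecke side does so with a grading.

Hecke side. Lusztig's `v²`-analogue `qMult` of the multiplicity is the alternating sum over `W` of
the `v²`-analogue `kpf` of Kostant's partition function. The Kazhdan–Lusztig element is `lusztigElt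
λ = ∑ qMult λ μ • H_μ`. By `isKL_unique` it is enough to verify the defining property. The
coefficient at `λ` is `1` and the others lie in `v ℤ[v]`, because every nonempty sum of positive
roots contributes a positive power of `v` (`qMult_self`, `qMult_mem_posPart`). Bar invariance goes
by induction on `λ₁ + λ₂` with two operators that commute with `bar`: multiplication by the
length-zero element `omegaElt`, or by `H_{s₀} + v`, each followed by symmetrization under `W`. They
act on the elements `lusztigElt` as tensoring with the representations of highest weights `ϖ₁` and
`ϖ₂`, up to a bar-invariant multiple of the original element in the second case
(`heckeSym_heckeOmega_lusztigElt`, `heckeSym_heckeB_lusztigElt`). Near the walls of the chamber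
these Pieri rules rest on the fact that the partition function with `α_i` left out is invariant
under `s_i`.

Crystal side. Removing the leftmost column of a tableau gives recursions for characters of tableaux
with bounded entries. Solved in a field, they yield the Weyl character formula
`weylDenom_mul_tabsChar`. Multiplication by `1 - e^{-α}` is a difference operator on coefficients,
and the product of these operators over the positive roots turns `kpf` at `v = 1` into a delta
function. These operators are injective on functions that vanish at all sufficiently positive
weights, so both sides have the same coefficients (`eq_mult`, `coeff_tabsChar`). This proves the
first equality, `domChar_crystal`.

Preatoms. The only positive root of height at least `3` is `2ϖ₁`, so at `v = 1` the element `Ñ³_λ`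
becomes the difference of the Kazhdan–Lusztig elements of `λ` and `λ - 2ϖ₁`; for `λ₁ = 1` the second
is zero, since `λ - 2ϖ₁ + ρ` is singular. On the other side `Φ` is injective and preserves weights,
so the character of its complement is the same difference (`domChar_principalPreatom`). -/

@[simp] theorem weylAct_one (mu : Weight) : weylAct 1 mu = mu := rfl

@[simp] theorem weylAct_mul (w u : weylGroup) (mu : Weight) :
    weylAct (w * u) mu = weylAct w (weylAct u mu) := rfl

theorem weylAct_add (w : weylGroup) (mu nu : Weight) :
    weylAct w (mu + nu) = weylAct w mu + weylAct w nu := by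
  simp [weylAct, ofAdd_add, map_mul, toAdd_mul]

theorem weylAct_zero (w : weylGroup) : weylAct w 0 = 0 := by
  simp [weylAct]

@[simp] theorem weylAct_s1 (a b : ℤ) : weylAct weylS1 (a, b) = (-a, a + b) := by
  change refl1 (a, b) = _
  ext <;> simp [refl1, pairing, alpha1] <;> ring

@[simp] theorem weylAct_s2 (a b : ℤ) : weylAct weylS2 (a, b) = (a + 2 * b, -b) := by
  change refl2 (a, b) = _
  ext <;> simp [refl2, pairing, alpha2] <;> ring

theorem weylAct_ext {w u : weylGroup} (h : ∀ a b, weylAct w (a, b) = weylAct u (a, b)) :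
    w = u := by
  apply Subtype.ext
  apply MulEquiv.ext
  intro x
  exact h x.toAdd.1 x.toAdd.2

theorem weylS1_mul_self : weylS1 * weylS1 = 1 := weylAct_ext (by intros; simp)

theorem weylS2_mul_self : weylS2 * weylS2 = 1 :=
  weylAct_ext (by intros; simp)

theorem weyl_braid : weylS1 * weylS2 * weylS1 * weylS2 = weylS2 * weylS1 * weylS2 * weylS1 :=
  weylAct_ext (by intros; simp only [weylAct_mul, weylAct_s1, weylAct_s2]; ext <;> dsimp <;> ring)

/-- Every element of `W` is a product of simple reflections. -/
theorem weyl_induction {p : weylGroup → Prop} (one : p 1)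
    (s1 : ∀ w, p w → p (weylS1 * w)) (s2 : ∀ w, p w → p (weylS2 * w)) (w : weylGroup) : p w := by
  obtain ⟨w, hw⟩ := w
  have h1 : (weylS1 : weylGroup)⁻¹ = weylS1 := inv_eq_of_mul_eq_one_left weylS1_mul_self
  have h2 : (weylS2 : weylGroup)⁻¹ = weylS2 := inv_eq_of_mul_eq_one_left weylS2_mul_self
  induction hw using Subgroup.closure_induction_left with
  | one => exact one
  | mul_left x hx y hy ih =>
    rcases hx with rfl | rfl
    · exact s1 _ ih
    · exact s2 _ ih
  | inv_mul_cancel x hx y hy ih =>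
    rcases hx with rfl | rfl
    · have := s1 _ ih
      rw [← h1] at this
      exact this
    · have := s2 _ ih
      rw [← h2] at this
      exact this

/-- The eight elements of the Weyl group. -/
theorem weyl_cases (w : weylGroup) :
    w = 1 ∨ w = weylS1 ∨ w = weylS2 ∨ w = weylS1 * weylS2 ∨ w = weylS2 * weylS1 ∨
      w = weylS1 * weylS2 * weylS1 ∨ w = weylS2 * weylS1 * weylS2 ∨
      w = weylS1 * weylS2 * weylS1 * weylS2 := by
  have h1 := weylS1_mul_self
  have h2 := weylS2_mul_self
  have h1' : ∀ u : weylGroup, weylS1 * (weylS1 * u) = u := fun u => by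
    rw [← mul_assoc, h1, one_mul]
  have h2' : ∀ u : weylGroup, weylS2 * (weylS2 * u) = u := fun u => by
    rw [← mul_assoc, h2, one_mul]
  have hb := weyl_braid
  simp only [mul_assoc] at hb ⊢
  have hb' : weylS2 * (weylS1 * (weylS2 * weylS1)) = weylS1 * (weylS2 * (weylS1 * weylS2)) :=
    hb.symm
  induction w using weyl_induction with
  | one => simp
  | s1 w ih => rcases ih with h | h | h | h | h | h | h | h <;> subst h <;> simp [h1, h1']
  | s2 w ih =>
    have : weylS2 * (weylS1 * (weylS2 * (weylS1 * weylS2))) = weylS1 * (weylS2 * weylS1) := by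
      rw [← hb', h2']
    rcases ih with h | h | h | h | h | h | h | h <;> subst h <;>
      simp [h2, h2', this, hb']

instance : Finite weylGroup := by
  have : (Set.univ : Set weylGroup) ⊆ {1, weylS1, weylS2, weylS1 * weylS2, weylS2 * weylS1,
      weylS1 * weylS2 * weylS1, weylS2 * weylS1 * weylS2,
      weylS1 * weylS2 * weylS1 * weylS2} := fun w _ => by
    simpa using weyl_cases w
  exact Set.finite_univ_iff.mp ((Set.toFinite _).subset this)

/-! ### The action on alcoves -/

/-- The image of the point `ρ / 4` of the fundamental alcove under `x`, scaled by `4`. -/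
def alcovePt (x : ExtAffWeyl) : Weight :=
  4 • Multiplicative.toAdd x.left + weylAct x.right rho

/-- The translation part of `x`. -/
def transPart (x : ExtAffWeyl) : Weight := Multiplicative.toAdd x.left

theorem transPart_transl (mu : Weight) : transPart (transl mu) = mu := rfl

theorem transPart_ofWeyl_mul (w : weylGroup) (x : ExtAffWeyl) :
    transPart (ofWeyl w * x) = weylAct w (transPart x) := by
  simp [transPart, ofWeyl, SemidirectProduct.mul_left, weylAct]

theorem transPart_transl_mul (mu : Weight) (x : ExtAffWeyl) :
    transPart (transl mu * x) = mu + transPart x := by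
  simp [transPart, transl, SemidirectProduct.mul_left]

theorem transPart_mul_ofWeyl (w : weylGroup) (x : ExtAffWeyl) :
    transPart (x * ofWeyl w) = transPart x := by
  simp [transPart, ofWeyl, SemidirectProduct.mul_left]

theorem right_ofWeyl_mul (w : weylGroup) (x : ExtAffWeyl) :
    (ofWeyl w * x).right = w * x.right := by
  simp [ofWeyl, SemidirectProduct.mul_right]

theorem right_transl_mul (mu : Weight) (x : ExtAffWeyl) :
    (transl mu * x).right = x.right := by
  simp [transl, SemidirectProduct.mul_right]

theorem eq_transl_mul_ofWeyl (x : ExtAffWeyl) : x = transl (transPart x) * ofWeyl x.right := by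
  refine SemidirectProduct.ext ?_ ?_
  · simp [transl, ofWeyl, transPart]
  · simp [transl, ofWeyl, SemidirectProduct.mul_right]

theorem extAffWeyl_ext {x y : ExtAffWeyl} (h : transPart x = transPart y)
    (h' : ∀ a b, weylAct x.right (a, b) = weylAct y.right (a, b)) : x = y :=
  SemidirectProduct.ext h (weylAct_ext h')

theorem alcovePt_ofWeyl_mul (w : weylGroup) (x : ExtAffWeyl) :
    alcovePt (ofWeyl w * x) = weylAct w (alcovePt x) := by
  change 4 • transPart (ofWeyl w * x) + _ = weylAct w (4 • transPart x + _)
  rw [transPart_ofWeyl_mul, right_ofWeyl_mul, weylAct_add, weylAct_mul]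
  congr 1
  simp only [succ_nsmul, zero_nsmul, weylAct_add, weylAct_zero]

theorem alcovePt_transl_mul (mu : Weight) (x : ExtAffWeyl) :
    alcovePt (transl mu * x) = 4 • mu + alcovePt x := by
  change 4 • transPart (transl mu * x) + _ = 4 • mu + (4 • transPart x + _)
  rw [transPart_transl_mul, right_transl_mul, smul_add, add_assoc]

theorem affS_one_eq : affS 1 = ofWeyl weylS1 := rfl

theorem affS_two_eq : affS 2 = ofWeyl weylS2 := rfl

theorem affS_zero_eq : affS 0 = transl (0, 1) * ofWeyl (weylS2 * weylS1 * weylS2) := by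
  change transl _ * _ = _
  congr 2

/-- The action of the simple reflections on scaled alcove points. -/
def ptRefl : Fin 3 → Weight → Weight
  | 0, p => (p.1, 4 - p.1 - p.2)
  | 1, p => (-p.1, p.1 + p.2)
  | 2, p => (p.1 + 2 * p.2, -p.2)

/-- The action of the simple reflections on the weight lattice. -/
def wtRefl : Fin 3 → Weight → Weight
  | 0, p => (p.1, 1 - p.1 - p.2)
  | 1, p => (-p.1, p.1 + p.2)
  | 2, p => (p.1 + 2 * p.2, -p.2)

theorem alcovePt_affS_mul (i : Fin 3) (x : ExtAffWeyl) :
    alcovePt (affS i * x) = ptRefl i (alcovePt x) := by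
  fin_cases i
  · change alcovePt (affS 0 * x) = ptRefl 0 (alcovePt x)
    rw [affS_zero_eq, mul_assoc, alcovePt_transl_mul, alcovePt_ofWeyl_mul]
    obtain ⟨a, b⟩ := alcovePt x
    ext <;> simp [ptRefl] <;> ring
  · exact alcovePt_ofWeyl_mul _ _ |>.trans (weylAct_s1 _ _)
  · exact alcovePt_ofWeyl_mul _ _ |>.trans (weylAct_s2 _ _)

theorem transPart_affS_mul (i : Fin 3) (x : ExtAffWeyl) :
    transPart (affS i * x) = wtRefl i (transPart x) := by
  fin_cases i
  · change transPart (affS 0 * x) = wtRefl 0 (transPart x)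
    rw [affS_zero_eq, mul_assoc, transPart_transl_mul, transPart_ofWeyl_mul]
    obtain ⟨a, b⟩ := transPart x
    ext <;> simp [wtRefl] <;> ring
  · exact transPart_ofWeyl_mul _ _ |>.trans (weylAct_s1 _ _)
  · exact transPart_ofWeyl_mul _ _ |>.trans (weylAct_s2 _ _)

theorem ofWeyl_mul_ofWeyl (w u : weylGroup) : ofWeyl w * ofWeyl u = ofWeyl (w * u) := by
  simp [ofWeyl]

theorem ofWeyl_one : ofWeyl 1 = 1 := by simp [ofWeyl]

theorem affS_mul_self (i : Fin 3) : affS i * affS i = 1 := by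
  fin_cases i
  · change affS 0 * affS 0 = 1
    rw [affS_zero_eq]
    apply extAffWeyl_ext
    · rw [mul_assoc, transPart_transl_mul, transPart_ofWeyl_mul, transPart_mul_ofWeyl,
        transPart_transl]
      simp
      rfl
    · intro a b
      rw [mul_assoc, right_transl_mul, right_ofWeyl_mul, right_transl_mul]
      simp only [SemidirectProduct.right_inr, ofWeyl, SemidirectProduct.one_right,
        weylAct_mul, weylAct_one, weylAct_s1, weylAct_s2]
      ext <;> dsimp <;> ring
  · change ofWeyl _ * ofWeyl _ = 1
    rw [ofWeyl_mul_ofWeyl, weylS1_mul_self, ofWeyl_one]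
  · change ofWeyl _ * ofWeyl _ = 1
    rw [ofWeyl_mul_ofWeyl, weylS2_mul_self, ofWeyl_one]

@[simp] theorem affS_mul_affS_mul (i : Fin 3) (x : ExtAffWeyl) :
    affS i * (affS i * x) = x := by
  rw [← mul_assoc, affS_mul_self, one_mul]

/-- The element of length zero that generates the stabilizer of the fundamental alcove. -/
def omegaElt : ExtAffWeyl := transl (1, 0) * ofWeyl (weylS1 * weylS2 * weylS1)

theorem omegaElt_mul_self : omegaElt * omegaElt = 1 := by
  apply extAffWeyl_ext
  · rw [omegaElt, mul_assoc, transPart_transl_mul, transPart_ofWeyl_mul, transPart_mul_ofWeyl,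
      transPart_transl]
    simp
    rfl
  · intro a b
    rw [omegaElt, mul_assoc, right_transl_mul, right_ofWeyl_mul, right_transl_mul]
    simp only [SemidirectProduct.right_inr, ofWeyl, SemidirectProduct.one_right,
      weylAct_mul, weylAct_one, weylAct_s1, weylAct_s2]
    ext <;> dsimp <;> ring

@[simp] theorem omegaElt_mul_omegaElt_mul (x : ExtAffWeyl) : omegaElt * (omegaElt * x) = x := by
  rw [← mul_assoc, omegaElt_mul_self, one_mul]

/-- The automorphism of the affine Dynkin diagram induced by `omegaElt`. -/
def diagAut : Fin 3 → Fin 3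
  | 0 => 1
  | 1 => 0
  | 2 => 2

@[simp] theorem diagAut_diagAut (i : Fin 3) : diagAut (diagAut i) = i := by
  fin_cases i <;> rfl

theorem omegaElt_mul_affS (i : Fin 3) : omegaElt * affS i = affS (diagAut i) * omegaElt := by
  fin_cases i
  · change omegaElt * affS 0 = affS 1 * omegaElt
    rw [affS_zero_eq, affS_one_eq, omegaElt]
    apply extAffWeyl_ext
    · rw [mul_assoc, transPart_transl_mul, transPart_ofWeyl_mul, transPart_mul_ofWeyl,
        transPart_transl, transPart_ofWeyl_mul, transPart_mul_ofWeyl, transPart_transl]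
      simp
    · intro a b
      rw [mul_assoc, right_transl_mul, right_ofWeyl_mul, right_transl_mul, right_ofWeyl_mul,
        right_transl_mul]
      simp only [SemidirectProduct.right_inr, ofWeyl,
        weylAct_mul, weylAct_s1, weylAct_s2]
      ext <;> dsimp <;> ring
  · change omegaElt * affS 1 = affS 0 * omegaElt
    rw [affS_zero_eq, affS_one_eq, omegaElt]
    apply extAffWeyl_ext
    · rw [transPart_mul_ofWeyl, transPart_mul_ofWeyl, mul_assoc (transl (0, 1)),
        transPart_transl_mul, transPart_ofWeyl_mul, transPart_mul_ofWeyl, transPart_transl]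
      simp
    · intro a b
      rw [mul_assoc, right_transl_mul, mul_assoc (transl (0, 1)), right_transl_mul,
        right_ofWeyl_mul, right_ofWeyl_mul, right_transl_mul]
      simp only [SemidirectProduct.right_inr, ofWeyl,
        weylAct_mul, weylAct_s1, weylAct_s2]
      ext <;> dsimp <;> ring
  · change omegaElt * affS 2 = affS 2 * omegaElt
    rw [affS_two_eq, omegaElt]
    apply extAffWeyl_ext
    · rw [transPart_mul_ofWeyl, transPart_mul_ofWeyl, transPart_ofWeyl_mul, transPart_mul_ofWeyl,
        transPart_transl]
      simp
    · intro a b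
      rw [mul_assoc, right_transl_mul, right_ofWeyl_mul, right_ofWeyl_mul, right_transl_mul]
      simp only [SemidirectProduct.right_inr, ofWeyl,
        weylAct_mul, weylAct_s1, weylAct_s2]
      ext <;> dsimp <;> ring

theorem omegaElt_mul_affS_mul (i : Fin 3) (x : ExtAffWeyl) :
    omegaElt * (affS i * x) = affS (diagAut i) * (omegaElt * x) := by
  rw [← mul_assoc, omegaElt_mul_affS, mul_assoc]

theorem alcovePt_omegaElt_mul (x : ExtAffWeyl) :
    alcovePt (omegaElt * x)
      = (4 - (alcovePt x).1 - 2 * (alcovePt x).2, (alcovePt x).2) := by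
  rw [omegaElt, mul_assoc, alcovePt_transl_mul, alcovePt_ofWeyl_mul]
  obtain ⟨a, b⟩ := alcovePt x
  ext <;> simp <;> ring

theorem transPart_omegaElt_mul (x : ExtAffWeyl) :
    transPart (omegaElt * x)
      = (1 - (transPart x).1 - 2 * (transPart x).2, (transPart x).2) := by
  rw [omegaElt, mul_assoc, transPart_transl_mul, transPart_ofWeyl_mul]
  obtain ⟨a, b⟩ := transPart x
  ext <;> simp <;> ring

/-! ### Lengths and descents -/

/-- The number of hyperplanes separating the alcove of the scaled point `p` from the fundamental
alcove. -/
def ptLen (p : Weight) : ℕ :=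
  (p.1 / 4).natAbs + (p.2 / 4).natAbs + ((p.1 + 2 * p.2) / 4).natAbs + ((p.1 + p.2) / 4).natAbs

theorem weylAct_rho (w : weylGroup) : ∃ a b : ℤ, weylAct w rho = (a, b) ∧
    ((a = 1 ∧ b = 1) ∨ (a = -1 ∧ b = 2) ∨ (a = 3 ∧ b = -1) ∨ (a = -3 ∧ b = 2) ∨
      (a = 3 ∧ b = -2) ∨ (a = -3 ∧ b = 1) ∨ (a = 1 ∧ b = -2) ∨ (a = -1 ∧ b = -1)) := by
  refine ⟨(weylAct w rho).1, (weylAct w rho).2, rfl, ?_⟩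
  rw [show rho = ((1, 1) : ℤ × ℤ) from rfl]
  rcases weyl_cases w with h | h | h | h | h | h | h | h <;> subst h <;>
    simp only [weylAct_mul, weylAct_one, weylAct_s1, weylAct_s2] <;> norm_num

theorem exists_transPart_alcovePt (x : ExtAffWeyl) : ∃ k l a b : ℤ, transPart x = (k, l) ∧
    weylAct x.right rho = (a, b) ∧ alcovePt x = (4 * k + a, 4 * l + b) ∧
    ((a = 1 ∧ b = 1) ∨ (a = -1 ∧ b = 2) ∨ (a = 3 ∧ b = -1) ∨ (a = -3 ∧ b = 2) ∨
      (a = 3 ∧ b = -2) ∨ (a = -3 ∧ b = 1) ∨ (a = 1 ∧ b = -2) ∨ (a = -1 ∧ b = -1)) := by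
  obtain ⟨a, b, h, h'⟩ := weylAct_rho x.right
  refine ⟨(transPart x).1, (transPart x).2, a, b, rfl, h, ?_, h'⟩
  change 4 • transPart x + _ = _
  rw [h]
  ext <;> simp

/-- Since `|e| < 4`, the integer `n - [e < 0]` is the floor of `n + e/4`. This turns the case
distinction in `len` into integer division. -/
theorem natAbs_sub_ite (n e : ℤ) (h : -4 < e) (h' : e < 4) :
    Int.natAbs (n - if e < 0 then 1 else 0) = Int.natAbs ((4 * n + e) / 4) := by
  congr 1
  split_ifs <;> omega

theorem len_eq_ptLen (x : ExtAffWeyl) : len x = ptLen (alcovePt x) := by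
  obtain ⟨k, l, a, b, h1, h2, h3, h4⟩ := exists_transPart_alcovePt x
  have h1' : Multiplicative.toAdd x.left = (k, l) := h1
  rw [h3, len, h1', h2]
  have key : ∀ c ∈ posCoroots, Int.natAbs (pairing (k, l) c - if pairing (a, b) c < 0 then 1 else 0)
      = Int.natAbs ((4 * pairing (k, l) c + pairing (a, b) c) / 4) := by
    intro c hc
    simp only [posCoroots, Finset.mem_insert, Finset.mem_singleton] at hc
    apply natAbs_sub_ite <;> rcases hc with rfl | rfl | rfl | rfl <;> simp only [pairing] <;> omega
  rw [Finset.sum_congr rfl key, posCoroots, Finset.sum_insert (by decide), Finset.sum_insert (by decide),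
    Finset.sum_insert (by decide), Finset.sum_singleton]
  simp only [pairing, ptLen]
  ring_nf

/-- The point `ρ/4` pairs with the positive coroots to `1/4, 1/4, 3/4, 2/4`, so it is interior to
the fundamental alcove and its images lie on no reflection hyperplane. -/
theorem alcovePt_mod (x : ExtAffWeyl) : (alcovePt x).1 % 4 ≠ 0 ∧ (alcovePt x).2 % 4 ≠ 0 ∧
    ((alcovePt x).1 + 2 * (alcovePt x).2) % 4 ≠ 0 ∧ ((alcovePt x).1 + (alcovePt x).2) % 4 ≠ 0 := by
  obtain ⟨k, l, a, b, h1, h2, h3, h4⟩ := exists_transPart_alcovePt x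
  rw [h3]
  dsimp only
  omega

/-- `s_i` is a left descent at the scaled point `p`. -/
def ptDesc : Fin 3 → Weight → Prop
  | 0, p => 4 < p.1 + 2 * p.2
  | 1, p => p.1 < 0
  | 2, p => p.2 < 0

instance (i : Fin 3) (p : Weight) : Decidable (ptDesc i p) := by
  match i with
  | 0 => exact inferInstanceAs (Decidable (4 < p.1 + 2 * p.2))
  | 1 => exact inferInstanceAs (Decidable (p.1 < 0))
  | 2 => exact inferInstanceAs (Decidable (p.2 < 0))

/-- `s_i` is a left descent of `x`. -/
def IsDesc (i : Fin 3) (x : ExtAffWeyl) : Prop := ptDesc i (alcovePt x)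

instance (i : Fin 3) (x : ExtAffWeyl) : Decidable (IsDesc i x) := by
  unfold IsDesc; infer_instance

/-- A simple reflection changes in absolute value only the floor belonging to its own wall, and that
one by `1`. It permutes the other three pairings, in the case of `s₀` up to `y ↦ 4 - y`, which
merely negates `⌊y/4⌋` when `4 ∤ y`. -/
theorem ptLen_ptRefl {p : Weight} (h1 : p.1 % 4 ≠ 0) (h2 : p.2 % 4 ≠ 0)
    (h3 : (p.1 + 2 * p.2) % 4 ≠ 0) (h4 : (p.1 + p.2) % 4 ≠ 0) (i : Fin 3) :
    (ptDesc i p → ptLen (ptRefl i p) + 1 = ptLen p) ∧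
      (¬ ptDesc i p → ptLen (ptRefl i p) = ptLen p + 1) := by
  obtain ⟨a, b⟩ := p
  dsimp only at h1 h2 h3 h4
  match i with
  | 0 =>
    simp only [ptDesc, ptRefl, ptLen]
    rw [show a + (4 - a - b) = 4 - b by ring,
      show a + 2 * (4 - a - b) = 8 - (a + 2 * b) by ring]
    have e1 : ((4 - a - b) / 4).natAbs = ((a + b) / 4).natAbs := by
      rw [show (4 - a - b) / 4 = -((a + b) / 4) by omega, Int.natAbs_neg]
    have e2 : ((4 - b) / 4).natAbs = (b / 4).natAbs := by
      rw [show (4 - b) / 4 = -(b / 4) by omega, Int.natAbs_neg]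
    rw [e1, e2]
    generalize a + 2 * b = c at *
    constructor <;> intro h
    · rw [show (c / 4).natAbs = ((8 - c) / 4).natAbs + 1 by omega]; ring
    · rw [show ((8 - c) / 4).natAbs = (c / 4).natAbs + 1 by omega]; ring
  | 1 =>
    simp only [ptDesc, ptRefl, ptLen]
    rw [show -a + 2 * (a + b) = a + 2 * b by ring, show -a + (a + b) = b by ring]
    constructor <;> intro h
    · rw [show (a / 4).natAbs = ((-a) / 4).natAbs + 1 by omega]; ring
    · rw [show ((-a) / 4).natAbs = (a / 4).natAbs + 1 by omega]; ring
  | 2 =>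
    simp only [ptDesc, ptRefl, ptLen]
    rw [show a + 2 * b + 2 * -b = a by ring, show a + 2 * b + -b = a + b by ring]
    constructor <;> intro h
    · rw [show (b / 4).natAbs = ((-b) / 4).natAbs + 1 by omega]; ring
    · rw [show ((-b) / 4).natAbs = (b / 4).natAbs + 1 by omega]; ring

theorem len_affS_mul_of_isDesc {i : Fin 3} {x : ExtAffWeyl} (h : IsDesc i x) :
    len (affS i * x) + 1 = len x := by
  obtain ⟨h1, h2, h3, h4⟩ := alcovePt_mod x
  rw [len_eq_ptLen, len_eq_ptLen, alcovePt_affS_mul]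
  exact (ptLen_ptRefl h1 h2 h3 h4 i).1 h

theorem len_affS_mul_of_not_isDesc {i : Fin 3} {x : ExtAffWeyl} (h : ¬ IsDesc i x) :
    len (affS i * x) = len x + 1 := by
  obtain ⟨h1, h2, h3, h4⟩ := alcovePt_mod x
  rw [len_eq_ptLen, len_eq_ptLen, alcovePt_affS_mul]
  exact (ptLen_ptRefl h1 h2 h3 h4 i).2 h

theorem isDesc_iff_len_lt {i : Fin 3} {x : ExtAffWeyl} :
    IsDesc i x ↔ len (affS i * x) < len x := by
  by_cases h : IsDesc i x
  · have := len_affS_mul_of_isDesc h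
    simp only [h, true_iff]; omega
  · have := len_affS_mul_of_not_isDesc h
    simp only [h, false_iff]; omega

theorem not_isDesc_iff_lt_len {i : Fin 3} {x : ExtAffWeyl} :
    ¬ IsDesc i x ↔ len x < len (affS i * x) := by
  by_cases h : IsDesc i x
  · have := len_affS_mul_of_isDesc h
    simp only [h, not_true_eq_false, false_iff]; omega
  · have := len_affS_mul_of_not_isDesc h
    simp only [h, not_false_eq_true, true_iff]; omega

theorem isDesc_affS_mul {i : Fin 3} {x : ExtAffWeyl} : IsDesc i (affS i * x) ↔ ¬ IsDesc i x := by
  rw [isDesc_iff_len_lt, not_isDesc_iff_lt_len, affS_mul_affS_mul]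

theorem len_omegaElt_mul (x : ExtAffWeyl) : len (omegaElt * x) = len x := by
  obtain ⟨h1, h2, h3, h4⟩ := alcovePt_mod x
  rw [len_eq_ptLen, len_eq_ptLen, alcovePt_omegaElt_mul]
  generalize alcovePt x = p at *
  obtain ⟨a, b⟩ := p
  dsimp only at h1 h2 h3 h4
  simp only [ptLen]
  rw [show 4 - a - 2 * b + 2 * b = 4 - a by ring, show 4 - a - 2 * b + b = 4 - (a + b) by ring,
    show 4 - a - 2 * b = 4 - (a + 2 * b) by ring]
  have key : ∀ y : ℤ, y % 4 ≠ 0 → ((4 - y) / 4).natAbs = (y / 4).natAbs := fun y hy => by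
    rw [show (4 - y) / 4 = -(y / 4) by omega, Int.natAbs_neg]
  rw [key _ h1, key _ h3, key _ h4]
  ring

theorem isDesc_omegaElt_mul {i : Fin 3} {x : ExtAffWeyl} :
    IsDesc (diagAut i) (omegaElt * x) ↔ IsDesc i x := by
  rw [isDesc_iff_len_lt, isDesc_iff_len_lt, ← omegaElt_mul_affS_mul, len_omegaElt_mul,
    len_omegaElt_mul]

theorem affS_comm (x : ExtAffWeyl) :
    affS 0 * (affS 1 * x) = affS 1 * (affS 0 * x) := by
  suffices h : affS 0 * affS 1 = affS 1 * affS 0 by rw [← mul_assoc, h, mul_assoc]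
  apply extAffWeyl_ext
  · rw [transPart_affS_mul, transPart_affS_mul]
    rw [affS_zero_eq, affS_one_eq, transPart_mul_ofWeyl, transPart_transl]
    rfl
  · intro a b
    rw [affS_zero_eq, affS_one_eq, mul_assoc, right_transl_mul, right_ofWeyl_mul, right_ofWeyl_mul,
      right_transl_mul]
    simp only [SemidirectProduct.right_inr, ofWeyl,
      weylAct_mul, weylAct_s1, weylAct_s2]
    ext <;> dsimp <;> ring

theorem affS_braid (x : ExtAffWeyl) : affS 1 * (affS 2 * (affS 1 * (affS 2 * x))) =
    affS 2 * (affS 1 * (affS 2 * (affS 1 * x))) := by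
  have := congrArg ofWeyl weyl_braid
  simp only [← ofWeyl_mul_ofWeyl] at this
  simp only [affS_one_eq, affS_two_eq, ← mul_assoc, this]

/-! ### Operators on the affine Hecke algebra -/

/-- Left multiplication by `H_{s_i}` as a linear map. -/
noncomputable def heckeL (i : Fin 3) : Hecke →ₗ[ℤ[T;T⁻¹]] Hecke :=
  Finsupp.linearCombination ℤ[T;T⁻¹] (simpleMulStd i)

theorem heckeL_single (i : Fin 3) (x : ExtAffWeyl) (f : ℤ[T;T⁻¹]) :
    heckeL i (Finsupp.single x f) = f • simpleMulStd i x := by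
  simp [heckeL]

theorem simpleMulStd_eq (i : Fin 3) (x : ExtAffWeyl) :
    simpleMulStd i x = Finsupp.single (affS i * x) 1 +
      if IsDesc i x then Finsupp.single x (T (-1) - T 1) else 0 := by
  unfold simpleMulStd
  by_cases h : IsDesc i x
  · rw [if_neg (by rw [← not_isDesc_iff_lt_len]; simpa using h), if_pos h]
  · rw [if_pos (not_isDesc_iff_lt_len.mp h), if_neg h, add_zero]

/-- Only `H_{sy}` and `H_y` contribute to the coefficient of `H_y`. With this formula the relations
of the Hecke algebra can be checked coefficient by coefficient. -/
theorem heckeL_apply (i : Fin 3) (h : Hecke) (y : ExtAffWeyl) :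
    heckeL i h y = h (affS i * y) + if IsDesc i y then (T (-1) - T 1) * h y else 0 := by
  induction h using Finsupp.induction_linear with
  | zero => simp
  | add f g hf hg =>
    rw [map_add, Finsupp.add_apply, hf, hg, Finsupp.add_apply, Finsupp.add_apply]
    split_ifs <;> ring
  | single x f =>
    rw [heckeL_single, simpleMulStd_eq, Finsupp.smul_apply, Finsupp.add_apply, smul_eq_mul, mul_add]
    congr 1
    · by_cases hx : affS i * x = y
      · subst hx
        simp
      · have hx' : x ≠ affS i * y := fun h => hx (by rw [h, affS_mul_affS_mul])
        rw [Finsupp.single_eq_of_ne' hx, Finsupp.single_eq_of_ne' hx', mul_zero]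
    · by_cases hx : x = y
      · subst hx
        split_ifs <;> simp [mul_comm]
      · split_ifs <;> simp [Finsupp.single_eq_of_ne' hx]

/-- Left multiplication by the element of length zero `omegaElt`. -/
noncomputable def heckeOmega : Hecke →ₗ[ℤ[T;T⁻¹]] Hecke :=
  Finsupp.lmapDomain ℤ[T;T⁻¹] ℤ[T;T⁻¹] (omegaElt * ·)

theorem heckeOmega_single (x : ExtAffWeyl) (f : ℤ[T;T⁻¹]) :
    heckeOmega (Finsupp.single x f) = Finsupp.single (omegaElt * x) f := by
  simp [heckeOmega]

theorem heckeOmega_apply (h : Hecke) (y : ExtAffWeyl) :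
    heckeOmega h y = h (omegaElt * y) := by
  have := Finsupp.mapDomain_apply (f := (omegaElt * · : ExtAffWeyl → ExtAffWeyl))
    (mul_right_injective omegaElt) h (omegaElt * y)
  simpa [heckeOmega] using this

theorem heckeL_heckeL (i : Fin 3) (h : Hecke) :
    heckeL i (heckeL i h) = h + (T (-1) - T 1 : ℤ[T;T⁻¹]) • heckeL i h := by
  ext1 y
  simp only [heckeL_apply, affS_mul_affS_mul, isDesc_affS_mul, Finsupp.add_apply,
    Finsupp.smul_apply, smul_eq_mul]
  by_cases hy : IsDesc i y <;> simp [hy]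

theorem heckeOmega_heckeOmega (h : Hecke) : heckeOmega (heckeOmega h) = h := by
  ext1 y
  simp [heckeOmega_apply]

theorem heckeOmega_heckeL (i : Fin 3) (h : Hecke) :
    heckeOmega (heckeL i h) = heckeL (diagAut i) (heckeOmega h) := by
  ext1 y
  rw [heckeOmega_apply, heckeL_apply, heckeL_apply, heckeOmega_apply, heckeOmega_apply,
    omegaElt_mul_affS_mul, diagAut_diagAut]
  have : IsDesc i (omegaElt * y) ↔ IsDesc (diagAut i) y := by
    rw [← isDesc_omegaElt_mul (i := i), omegaElt_mul_omegaElt_mul]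
  simp only [this]

theorem heckeL_comm (h : Hecke) : heckeL 0 (heckeL 1 h) = heckeL 1 (heckeL 0 h) := by
  ext1 x
  have e1 : IsDesc 1 (affS 0 * x) ↔ IsDesc 1 x := by
    simp [IsDesc, alcovePt_affS_mul, ptDesc, ptRefl]
  have e0 : IsDesc 0 (affS 1 * x) ↔ IsDesc 0 x := by
    simp only [IsDesc, alcovePt_affS_mul, ptDesc, ptRefl]
    constructor <;> intro h <;> linarith
  simp only [heckeL_apply, e0, e1, affS_comm]
  split_ifs <;> ring

/-- All descents along the orbit of `x` under `⟨s₁, s₂⟩` are decided by the signs of the four coroot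
pairings of the alcove point. Once the signs are fixed both sides are explicit polynomials; sign
patterns that belong to no chamber are contradictory. -/
theorem heckeL_braid (h : Hecke) : heckeL 1 (heckeL 2 (heckeL 1 (heckeL 2 h))) =
    heckeL 2 (heckeL 1 (heckeL 2 (heckeL 1 h))) := by
  ext1 x
  obtain ⟨m1, m2, m3, m4⟩ := alcovePt_mod x
  have d1 : IsDesc 1 x ↔ (alcovePt x).1 < 0 := Iff.rfl
  have d2 : IsDesc 2 x ↔ (alcovePt x).2 < 0 := Iff.rfl
  have d12 : IsDesc 1 (affS 2 * x) ↔ (alcovePt x).1 + 2 * (alcovePt x).2 < 0 := by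
    simp only [IsDesc, alcovePt_affS_mul, ptDesc, ptRefl]
  have d21 : IsDesc 2 (affS 1 * x) ↔ (alcovePt x).1 + (alcovePt x).2 < 0 := by
    simp only [IsDesc, alcovePt_affS_mul, ptDesc, ptRefl]
  have d121 : IsDesc 1 (affS 2 * (affS 1 * x)) ↔ (alcovePt x).1 + 2 * (alcovePt x).2 < 0 := by
    simp only [IsDesc, alcovePt_affS_mul, ptDesc, ptRefl]
    constructor <;> intro h <;> linarith
  have d212 : IsDesc 2 (affS 1 * (affS 2 * x)) ↔ (alcovePt x).1 + (alcovePt x).2 < 0 := by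
    simp only [IsDesc, alcovePt_affS_mul, ptDesc, ptRefl]
    constructor <;> intro h <;> linarith
  have d1212 : IsDesc 1 (affS 2 * (affS 1 * (affS 2 * x))) ↔ (alcovePt x).1 < 0 := by
    simp only [IsDesc, alcovePt_affS_mul, ptDesc, ptRefl]
    constructor <;> intro h <;> linarith
  have d2121 : IsDesc 2 (affS 1 * (affS 2 * (affS 1 * x))) ↔ (alcovePt x).2 < 0 := by
    simp only [IsDesc, alcovePt_affS_mul, ptDesc, ptRefl]
    constructor <;> intro h <;> linarith
  have hb := affS_braid x
  simp only [heckeL_apply, affS_mul_affS_mul, isDesc_affS_mul, d1, d2, d12, d21, d121, d212, d1212,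
    d2121, hb]
  by_cases c1 : (alcovePt x).1 < 0 <;> by_cases c2 : (alcovePt x).2 < 0 <;>
    by_cases c3 : (alcovePt x).1 + (alcovePt x).2 < 0 <;>
    by_cases c4 : (alcovePt x).1 + 2 * (alcovePt x).2 < 0 <;>
    first
    | (exfalso; omega)
    | (simp only [c1, c2, c3, c4, if_true, if_false, not_true_eq_false, not_false_eq_true]; try ring)

/-- Left multiplication by the Kazhdan–Lusztig generator `H_{s_i} + v`. -/
noncomputable def heckeB (i : Fin 3) (h : Hecke) : Hecke :=
  heckeL i h + (T 1 : ℤ[T;T⁻¹]) • h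

/-- Left multiplication by `H_{s_i}⁻¹`. -/
noncomputable def heckeLinv (i : Fin 3) : Hecke →ₗ[ℤ[T;T⁻¹]] Hecke :=
  heckeL i + (T 1 - T (-1) : ℤ[T;T⁻¹]) • LinearMap.id

theorem simpleInvMul_eq (i : Fin 3) (h : Hecke) : simpleInvMul i h = heckeLinv i h := rfl

theorem heckeLinv_apply (i : Fin 3) (h : Hecke) :
    heckeLinv i h = heckeL i h + (T 1 - T (-1) : ℤ[T;T⁻¹]) • h := rfl

theorem heckeL_heckeLinv (i : Fin 3) (h : Hecke) : heckeL i (heckeLinv i h) = h := by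
  rw [heckeLinv_apply, map_add, map_smul, heckeL_heckeL]
  module

theorem heckeLinv_heckeL (i : Fin 3) (h : Hecke) : heckeLinv i (heckeL i h) = h := by
  rw [heckeLinv_apply, heckeL_heckeL]
  module

theorem heckeL_injective (i : Fin 3) : Function.Injective (heckeL i) :=
  Function.LeftInverse.injective (heckeLinv_heckeL i)

theorem heckeLinv_coe (i : Fin 3) (h : Hecke) (y : ExtAffWeyl) :
    heckeLinv i h y = h (affS i * y) + if IsDesc i y then 0 else (T 1 - T (-1)) * h y := by
  rw [heckeLinv_apply, Finsupp.add_apply, heckeL_apply, Finsupp.smul_apply, smul_eq_mul]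
  split_ifs <;> ring

theorem heckeOmega_heckeLinv (i : Fin 3) (h : Hecke) :
    heckeOmega (heckeLinv i h) = heckeLinv (diagAut i) (heckeOmega h) := by
  simp only [heckeLinv_apply, map_add, map_smul, heckeOmega_heckeL]

theorem heckeLinv_comm (h : Hecke) :
    heckeLinv 0 (heckeLinv 1 h) = heckeLinv 1 (heckeLinv 0 h) := by
  apply heckeL_injective 1
  apply heckeL_injective 0
  rw [heckeL_heckeLinv, heckeL_comm, heckeL_heckeLinv, heckeL_heckeLinv, heckeL_heckeLinv]

theorem heckeLinv_braid (h : Hecke) :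
    heckeLinv 1 (heckeLinv 2 (heckeLinv 1 (heckeLinv 2 h))) =
      heckeLinv 2 (heckeLinv 1 (heckeLinv 2 (heckeLinv 1 h))) := by
  apply heckeL_injective 1
  apply heckeL_injective 2
  apply heckeL_injective 1
  apply heckeL_injective 2
  conv_rhs => rw [← heckeL_braid]
  simp only [heckeL_heckeLinv]

/-- Conjugation by `omegaElt` exchanges `s₀` and `s₁` and fixes `s₂`. -/
theorem heckeLinv_braid' (h : Hecke) :
    heckeLinv 0 (heckeLinv 2 (heckeLinv 0 (heckeLinv 2 h))) =
      heckeLinv 2 (heckeLinv 0 (heckeLinv 2 (heckeLinv 0 h))) := by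
  have := congrArg heckeOmega (heckeLinv_braid (heckeOmega h))
  simpa only [heckeOmega_heckeLinv, heckeOmega_heckeOmega, diagAut] using this

/-! ### The bar involution -/

theorem barStd_of_forall {x : ExtAffWeyl} (h : ∀ i, ¬ IsDesc i x) :
    barStd x = Finsupp.single x 1 := by
  rw [barStd, dif_neg]
  rintro ⟨i, hi⟩
  exact h i (isDesc_iff_len_lt.mpr hi)

theorem exists_barStd_eq {x : ExtAffWeyl} (h : ∃ i, IsDesc i x) :
    ∃ i, IsDesc i x ∧ barStd x = heckeLinv i (barStd (affS i * x)) := by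
  have h' : ∃ i, len (affS i * x) < len x := by
    obtain ⟨i, hi⟩ := h
    exact ⟨i, isDesc_iff_len_lt.mp hi⟩
  refine ⟨h'.choose, isDesc_iff_len_lt.mpr h'.choose_spec, ?_⟩
  rw [barStd, dif_pos h', simpleInvMul_eq]

theorem isDesc_chain_one_two {x : ExtAffWeyl} (h1 : IsDesc 1 x) (h2 : IsDesc 2 x) :
    IsDesc 2 (affS 1 * x) ∧ IsDesc 1 (affS 2 * (affS 1 * x)) ∧
      IsDesc 2 (affS 1 * (affS 2 * (affS 1 * x))) ∧ IsDesc 1 (affS 2 * x) ∧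
      IsDesc 2 (affS 1 * (affS 2 * x)) ∧ IsDesc 1 (affS 2 * (affS 1 * (affS 2 * x))) := by
  simp only [IsDesc, alcovePt_affS_mul, ptDesc, ptRefl] at *
  refine ⟨?_, ?_, ?_, ?_, ?_, ?_⟩ <;> linarith

theorem isDesc_chain_zero_two {x : ExtAffWeyl} (h1 : IsDesc 0 x) (h2 : IsDesc 2 x) :
    IsDesc 2 (affS 0 * x) ∧ IsDesc 0 (affS 2 * (affS 0 * x)) ∧
      IsDesc 2 (affS 0 * (affS 2 * (affS 0 * x))) ∧ IsDesc 0 (affS 2 * x) ∧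
      IsDesc 2 (affS 0 * (affS 2 * x)) ∧ IsDesc 0 (affS 2 * (affS 0 * (affS 2 * x))) := by
  simp only [IsDesc, alcovePt_affS_mul, ptDesc, ptRefl] at *
  refine ⟨?_, ?_, ?_, ?_, ?_, ?_⟩ <;> linarith

theorem isDesc_chain_zero_one {x : ExtAffWeyl} (h1 : IsDesc 0 x) (h2 : IsDesc 1 x) :
    IsDesc 1 (affS 0 * x) ∧ IsDesc 0 (affS 1 * x) := by
  simp only [IsDesc, alcovePt_affS_mul, ptDesc, ptRefl] at *
  refine ⟨?_, ?_⟩ <;> linarith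

theorem affS_braid' (x : ExtAffWeyl) : affS 0 * (affS 2 * (affS 0 * (affS 2 * x))) =
    affS 2 * (affS 0 * (affS 2 * (affS 0 * x))) := by
  have := congrArg (omegaElt * ·) (affS_braid (omegaElt * x))
  simpa only [omegaElt_mul_affS_mul, omegaElt_mul_omegaElt_mul, diagAut] using this

/-- The recursion for the bar involution does not depend on the chosen descent. -/
theorem barStd_of_isDesc {i : Fin 3} {x : ExtAffWeyl} (h : IsDesc i x) :
    barStd x = heckeLinv i (barStd (affS i * x)) := by
  induction hn : len x using Nat.strong_induction_on generalizing x i with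
  | _ n ih =>
  subst hn
  have step : ∀ {i : Fin 3} {x' : ExtAffWeyl}, len x' < len x → IsDesc i x' →
      barStd x' = heckeLinv i (barStd (affS i * x')) := fun hl hd => ih _ hl hd rfl
  have lt : ∀ {i : Fin 3} {x' : ExtAffWeyl}, IsDesc i x' → len (affS i * x') < len x' :=
    fun hd => isDesc_iff_len_lt.mp hd
  -- If two simple reflections are descents of `x`, then `x` is longest in its coset of the dihedral
  -- group they generate. Both alternating chains go down to the same element, and the induction
  -- hypothesis applies along them, so the braid relation compares the two results.
  have e12 : IsDesc 1 x → IsDesc 2 x →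
      heckeLinv 1 (barStd (affS 1 * x)) = heckeLinv 2 (barStd (affS 2 * x)) := by
    intro h1 h2
    obtain ⟨a1, a2, a3, b1, b2, b3⟩ := isDesc_chain_one_two h1 h2
    have l1 := lt h1
    have l2 := (lt a1).trans l1
    have l3 := (lt a2).trans l2
    have k1 := lt h2
    have k2 := (lt b1).trans k1
    have k3 := (lt b2).trans k2
    rw [step l1 a1, step l2 a2, step l3 a3, step k1 b1, step k2 b2, step k3 b3, affS_braid,
      heckeLinv_braid]
  have e02 : IsDesc 0 x → IsDesc 2 x →
      heckeLinv 0 (barStd (affS 0 * x)) = heckeLinv 2 (barStd (affS 2 * x)) := by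
    intro h1 h2
    obtain ⟨a1, a2, a3, b1, b2, b3⟩ := isDesc_chain_zero_two h1 h2
    have l1 := lt h1
    have l2 := (lt a1).trans l1
    have l3 := (lt a2).trans l2
    have k1 := lt h2
    have k2 := (lt b1).trans k1
    have k3 := (lt b2).trans k2
    rw [step l1 a1, step l2 a2, step l3 a3, step k1 b1, step k2 b2, step k3 b3, affS_braid',
      heckeLinv_braid']
  have e01 : IsDesc 0 x → IsDesc 1 x →
      heckeLinv 0 (barStd (affS 0 * x)) = heckeLinv 1 (barStd (affS 1 * x)) := by
    intro h1 h2
    obtain ⟨a1, b1⟩ := isDesc_chain_zero_one h1 h2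
    rw [step (lt h1) a1, step (lt h2) b1, affS_comm, heckeLinv_comm]
  obtain ⟨j, hj, hx⟩ := exists_barStd_eq ⟨i, h⟩
  rw [hx]
  have fin3 : ∀ k : Fin 3, k = 0 ∨ k = 1 ∨ k = 2 := by decide
  rcases fin3 i with rfl | rfl | rfl <;> rcases fin3 j with rfl | rfl | rfl
  · rfl
  · exact (e01 h hj).symm
  · exact (e02 h hj).symm
  · exact e01 hj h
  · rfl
  · exact (e12 h hj).symm
  · exact e02 hj h
  · exact e12 hj h
  · rfl

theorem barStd_affS_mul (i : Fin 3) (x : ExtAffWeyl) (h : ¬ IsDesc i x) :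
    barStd (affS i * x) = heckeLinv i (barStd x) := by
  rw [barStd_of_isDesc (isDesc_affS_mul.mpr h), affS_mul_affS_mul]

theorem barStd_omegaElt_mul (x : ExtAffWeyl) :
    barStd (omegaElt * x) = heckeOmega (barStd x) := by
  induction hn : len x using Nat.strong_induction_on generalizing x with
  | _ n ih =>
  subst hn
  by_cases h : ∃ i, IsDesc i x
  · obtain ⟨i, hi⟩ := h
    rw [barStd_of_isDesc hi, heckeOmega_heckeLinv, ← ih _ (isDesc_iff_len_lt.mp hi) _ rfl,
      omegaElt_mul_affS_mul, ← barStd_of_isDesc (isDesc_omegaElt_mul.mpr hi)]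
  · rw [not_exists] at h
    rw [barStd_of_forall h, barStd_of_forall, heckeOmega_single]
    intro i hi
    apply h (diagAut i)
    rwa [← isDesc_omegaElt_mul, diagAut_diagAut]

theorem bar_zero : bar 0 = 0 := by simp [bar]

theorem bar_single (x : ExtAffWeyl) (f : ℤ[T;T⁻¹]) :
    bar (Finsupp.single x f) = invert f • barStd x := by
  simp [bar]

theorem bar_add (h k : Hecke) : bar (h + k) = bar h + bar k := by
  unfold bar
  rw [Finsupp.sum_add_index']
  · simp
  · intro x f g
    rw [map_add, add_smul]

theorem bar_smul (f : ℤ[T;T⁻¹]) (h : Hecke) : bar (f • h) = invert f • bar h := by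
  induction h using Finsupp.induction_linear with
  | zero => simp [bar_zero]
  | add h k hh hk => rw [smul_add, bar_add, hh, hk, bar_add, smul_add]
  | single x g => rw [Finsupp.smul_single, bar_single, bar_single, smul_eq_mul, map_mul, mul_smul]

theorem bar_neg (h : Hecke) : bar (-h) = -bar h := by
  have := bar_smul (-1) h
  simpa using this

theorem bar_sub (h k : Hecke) : bar (h - k) = bar h - bar k := by
  rw [sub_eq_add_neg, bar_add, bar_neg, ← sub_eq_add_neg]

theorem bar_heckeL (i : Fin 3) (h : Hecke) : bar (heckeL i h) = heckeLinv i (bar h) := by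
  induction h using Finsupp.induction_linear with
  | zero => simp [bar_zero]
  | add h k hh hk => rw [map_add, bar_add, hh, hk, bar_add, map_add]
  | single x g =>
    rw [heckeL_single, bar_smul, bar_single, map_smul, simpleMulStd_eq, bar_add, bar_single,
      map_one, one_smul]
    congr 1
    by_cases h : IsDesc i x
    · rw [if_pos h, bar_single, barStd_of_isDesc h, map_sub, invert_T, invert_T]
      set b := barStd (affS i * x)
      rw [heckeLinv_apply i (heckeLinv i b), heckeL_heckeLinv]
      simp
    · rw [if_neg h, bar_zero, add_zero, barStd_affS_mul _ _ h]

theorem bar_heckeOmega (h : Hecke) : bar (heckeOmega h) = heckeOmega (bar h) := by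
  induction h using Finsupp.induction_linear with
  | zero => simp [bar_zero]
  | add h k hh hk => rw [map_add, bar_add, hh, hk, bar_add, map_add]
  | single x g => rw [heckeOmega_single, bar_single, bar_single, map_smul, barStd_omegaElt_mul]

/-- Because `H_s⁻¹ + v⁻¹ = H_s + v`. -/
theorem bar_heckeB (i : Fin 3) (h : Hecke) : bar (heckeB i h) = heckeB i (bar h) := by
  rw [heckeB, bar_add, bar_smul, bar_heckeL, heckeLinv_apply, heckeB, invert_T]
  module

/-- Unitriangularity of the bar involution. -/
theorem barStd_triangular (x : ExtAffWeyl) :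
    barStd x x = 1 ∧ ∀ y, y ≠ x → barStd x y ≠ 0 → len y < len x := by
  induction hn : len x using Nat.strong_induction_on generalizing x with
  | _ n ih =>
  subst hn
  by_cases h : ∃ i, IsDesc i x
  · obtain ⟨i, hi⟩ := h
    obtain ⟨ih1, ih2⟩ := ih _ (isDesc_iff_len_lt.mp hi) _ rfl
    have hl := len_affS_mul_of_isDesc hi
    have hl' : ∀ y, len y ≤ len (affS i * y) + 1 := fun y => by
      by_cases hy : IsDesc i y
      · exact (len_affS_mul_of_isDesc hy).ge
      · have := len_affS_mul_of_not_isDesc hy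
        omega
    rw [barStd_of_isDesc hi]
    refine ⟨by rw [heckeLinv_coe, if_pos hi, ih1, add_zero], fun y hy hne => ?_⟩
    rw [heckeLinv_coe] at hne
    by_cases h1 : barStd (affS i * x) (affS i * y) = 0
    · rw [h1, zero_add] at hne
      have h2 : barStd (affS i * x) y ≠ 0 := by
        intro h0
        rw [h0] at hne
        simp at hne
      by_cases h3 : y = affS i * x
      · subst h3; omega
      · have := ih2 y h3 h2
        omega
    · by_cases h3 : affS i * y = affS i * x
      · exact absurd (mul_left_cancel h3) hy
      · have := ih2 _ h3 h1
        have := hl' y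
        omega
  · rw [not_exists] at h
    rw [barStd_of_forall h]
    refine ⟨by simp, fun y hy hne => ?_⟩
    exact absurd (Finsupp.single_eq_of_ne hy) hne

/-! ### Bar-invariant elements with coefficients in `v ℤ[v]` -/

/-- The Laurent polynomials that lie in `v ℤ[v]`. -/
def posPart : AddSubgroup ℤ[T;T⁻¹] where
  carrier := {f | ∃ p : Polynomial ℤ, f = Polynomial.toLaurent (Polynomial.X * p)}
  zero_mem' := ⟨0, by simp⟩
  add_mem' := by
    rintro _ _ ⟨p, rfl⟩ ⟨q, rfl⟩
    exact ⟨p + q, by rw [mul_add, map_add]⟩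
  neg_mem' := by
    rintro _ ⟨p, rfl⟩
    exact ⟨-p, by rw [mul_neg, map_neg]⟩

theorem mul_T_mem_posPart {f : ℤ[T;T⁻¹]} (hf : f ∈ posPart) {n : ℤ} (hn : 0 ≤ n) :
    f * T n ∈ posPart := by
  obtain ⟨p, rfl⟩ := hf
  refine ⟨p * Polynomial.X ^ n.toNat, ?_⟩
  rw [← mul_assoc, map_mul _ (Polynomial.X * p), Polynomial.toLaurent_X_pow, Int.toNat_of_nonneg hn]

theorem T_mem_posPart {n : ℤ} (hn : 0 < n) : (T n : ℤ[T;T⁻¹]) ∈ posPart := by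
  have : (T 1 : ℤ[T;T⁻¹]) ∈ posPart := ⟨1, by rw [mul_one, Polynomial.toLaurent_X]⟩
  have := mul_T_mem_posPart this (n := n - 1) (by omega)
  rwa [← T_add, add_sub_cancel] at this

theorem coeff_of_mem_posPart {f : ℤ[T;T⁻¹]} (hf : f ∈ posPart) {n : ℤ} (hn : n ≤ 0) :
    f.coeff n = 0 := by
  obtain ⟨p, rfl⟩ := hf
  rw [coeff_toLaurent]
  by_cases h : n = 0
  · subst h
    have := Finsupp.mapDomain_apply (f := (Nat.castEmbedding : ℕ ↪ ℤ)) Nat.castEmbedding.injective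
      (Polynomial.X * p).toFinsupp.coeff 0
    simp only [Nat.castEmbedding_apply, Nat.cast_zero] at this
    rw [this]
    exact Polynomial.coeff_X_mul_zero p
  · apply Finsupp.mapDomain_of_notMem_range
    rintro ⟨m, rfl⟩
    simp at hn h
    omega

theorem eq_zero_of_mem_posPart {f : ℤ[T;T⁻¹]} (hf : f ∈ posPart) (h : invert f = f) : f = 0 := by
  apply LaurentPolynomial.ext
  intro n
  rcases le_total n 0 with hn | hn
  · simpa using coeff_of_mem_posPart hf hn
  · rw [← h, invert_apply]
    simpa using coeff_of_mem_posPart hf (neg_nonpos.mpr hn)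

/-- A bar-invariant element with coefficients in `v ℤ[v]` is zero. -/
theorem eq_zero_of_bar_eq {h : Hecke} (hb : bar h = h) (hp : ∀ x, h x ∈ posPart) : h = 0 := by
  by_contra hne
  -- At an element `x` of maximal length in the support, unitriangularity leaves only the diagonal
  -- term, so the coefficient `h x` is itself bar-invariant. Lying in `v ℤ[v]`, it must vanish.
  obtain ⟨x, hx, hmax⟩ := h.support.exists_max_image len (Finsupp.support_nonempty_iff.mpr hne)
  rw [Finsupp.mem_support_iff] at hx
  apply hx
  apply eq_zero_of_mem_posPart (hp x)
  have e : (bar h) x = invert (h x) := by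
    rw [bar, Finsupp.sum_apply, Finsupp.sum, Finset.sum_eq_single x]
    · rw [Finsupp.smul_apply, (barStd_triangular x).1, smul_eq_mul, mul_one]
    · intro y hy hyx
      rw [Finsupp.smul_apply, smul_eq_mul]
      by_cases h0 : barStd y x = 0
      · rw [h0, mul_zero]
      · have h1 := (barStd_triangular y).2 x (Ne.symm hyx) h0
        exact absurd (hmax y hy) (not_le.mpr h1)
    · intro hx'
      rw [Finsupp.notMem_support_iff.mp hx']
      simp
  rw [← e, hb]

/-! ### Dominant representatives -/

/-- The dominant weight in the Weyl group orbit of `mu`. -/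
def domRep (mu : Weight) : DomWeight :=
  (max (mu.1 + mu.2).natAbs mu.2.natAbs - min (mu.1 + mu.2).natAbs mu.2.natAbs,
    min (mu.1 + mu.2).natAbs mu.2.natAbs)

/-- In the coordinates `(μ₁ + μ₂, μ₂)` the group `W` acts by signed permutations, and `domRep` sorts
the absolute values. -/
theorem domRep_weylAct (w : weylGroup) (mu : Weight) : domRep (weylAct w mu) = domRep mu := by
  induction w using weyl_induction with
  | one => rfl
  | s1 w ih =>
    rw [weylAct_mul, ← ih]
    obtain ⟨a, b⟩ := weylAct w mu
    rw [weylAct_s1]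
    simp only [domRep]
    rw [show -a + (a + b) = b by ring, max_comm, min_comm]
  | s2 w ih =>
    rw [weylAct_mul, ← ih]
    obtain ⟨a, b⟩ := weylAct w mu
    rw [weylAct_s2]
    simp only [domRep]
    rw [show a + 2 * b + -b = a + b by ring, Int.natAbs_neg]

theorem domRep_toWeight (lam : DomWeight) : domRep lam.toWeight = lam := by
  obtain ⟨a, b⟩ := lam
  simp only [domRep, DomWeight.toWeight]
  ext <;> dsimp only <;> omega

theorem domRep_of_nonneg {a b : ℤ} (ha : 0 ≤ a) (hb : 0 ≤ b) :
    domRep (a, b) = (a.toNat, b.toNat) := by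
  simp only [domRep]
  ext <;> dsimp only <;> omega

theorem exists_weylAct_eq_dominant (mu : Weight) :
    ∃ w : weylGroup, weylAct w mu = (domRep mu).toWeight := by
  suffices h : ∃ (w : weylGroup) (c d : ℕ), weylAct w mu = ((c : ℤ), (d : ℤ)) by
    obtain ⟨w, c, d, h⟩ := h
    refine ⟨w, ?_⟩
    have h' : weylAct w mu = DomWeight.toWeight (c, d) := h
    rw [← domRep_weylAct w mu, h', domRep_toWeight]
  suffices h : ∃ (w : weylGroup) (c d : ℤ), weylAct w mu = (c, d) ∧ 0 ≤ c ∧ 0 ≤ d by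
    obtain ⟨w, c, d, h, hc, hd⟩ := h
    exact ⟨w, c.toNat, d.toNat, by rw [h, Int.toNat_of_nonneg hc, Int.toNat_of_nonneg hd]⟩
  obtain ⟨a, b⟩ := mu
  -- The eight closed Weyl chambers.
  have : (0 ≤ a ∧ 0 ≤ b) ∨ (0 ≤ -a ∧ 0 ≤ a + b) ∨ (0 ≤ a + 2 * b ∧ 0 ≤ -b) ∨
      (0 ≤ -(a + 2 * b) ∧ 0 ≤ a + b) ∨ (0 ≤ a + 2 * b ∧ 0 ≤ -(a + b)) ∨
      (0 ≤ -(a + 2 * b) ∧ 0 ≤ b) ∨ (0 ≤ a ∧ 0 ≤ -(a + b)) ∨ (0 ≤ -a ∧ 0 ≤ -b) := by omega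
  rcases this with h | h | h | h | h | h | h | h
  · exact ⟨1, _, _, rfl, h⟩
  · exact ⟨weylS1, _, _, weylAct_s1 a b, h⟩
  · exact ⟨weylS2, _, _, weylAct_s2 a b, h⟩
  · refine ⟨weylS1 * weylS2, -(a + 2 * b), a + b, ?_, h⟩
    simp only [weylAct_mul, weylAct_s1, weylAct_s2]
    ext <;> dsimp only <;> ring
  · refine ⟨weylS2 * weylS1, a + 2 * b, -(a + b), ?_, h⟩
    simp only [weylAct_mul, weylAct_s1, weylAct_s2]
    ext <;> dsimp only <;> ring
  · refine ⟨weylS1 * weylS2 * weylS1, -(a + 2 * b), b, ?_, h⟩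
    simp only [weylAct_mul, weylAct_s1, weylAct_s2]
    ext <;> dsimp only <;> ring
  · refine ⟨weylS2 * weylS1 * weylS2, a, -(a + b), ?_, h⟩
    simp only [weylAct_mul, weylAct_s1, weylAct_s2]
    ext <;> dsimp only <;> ring
  · refine ⟨weylS1 * weylS2 * weylS1 * weylS2, -a, -b, ?_, h⟩
    simp only [weylAct_mul, weylAct_s1, weylAct_s2]
    ext <;> dsimp only <;> ring

theorem weylAct_inv_weylAct (w : weylGroup) (mu : Weight) : weylAct w⁻¹ (weylAct w mu) = mu := by
  rw [← weylAct_mul, inv_mul_cancel, weylAct_one]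

/-! ### The standard basis of the spherical Hecke algebra -/

theorem ofWeyl_mul_transl_mul_ofWeyl (w u : weylGroup) (mu : Weight) :
    ofWeyl w * transl mu * ofWeyl u = transl (weylAct w mu) * ofWeyl (w * u) := by
  apply extAffWeyl_ext
  · rw [transPart_mul_ofWeyl, transPart_mul_ofWeyl, transPart_ofWeyl_mul, transPart_transl,
      transPart_transl]
  · intro a b
    rw [mul_assoc, right_ofWeyl_mul, right_transl_mul, right_transl_mul]
    rfl

theorem mem_dblCoset {lam : DomWeight} {x : ExtAffWeyl} :
    x ∈ dblCoset lam ↔ domRep (transPart x) = lam := by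
  constructor
  · rintro ⟨w, u, rfl⟩
    rw [transPart_mul_ofWeyl, transPart_ofWeyl_mul, transPart_transl, domRep_weylAct,
      domRep_toWeight]
  · rintro rfl
    obtain ⟨w, hw⟩ := exists_weylAct_eq_dominant (transPart x)
    refine ⟨w⁻¹, w * x.right, ?_⟩
    rw [ofWeyl_mul_transl_mul_ofWeyl, ← hw, weylAct_inv_weylAct, inv_mul_cancel_left]
    exact eq_transl_mul_ofWeyl x

theorem dblCoset_finite (lam : DomWeight) : (dblCoset lam).Finite := by
  have : dblCoset lam = Set.range fun p : weylGroup × weylGroup =>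
      ofWeyl p.1 * transl lam.toWeight * ofWeyl p.2 := by
    ext x
    constructor
    · rintro ⟨w, u, rfl⟩
      exact ⟨(w, u), rfl⟩
    · rintro ⟨⟨w, u⟩, rfl⟩
      exact ⟨w, u, rfl⟩
  rw [this]
  exact Set.finite_range _

/-- The sum of `|⟨μ, α^∨⟩|` over the positive coroots is invariant under `W`, and for dominant `λ`
it is `3λ₁ + 4λ₂`, the pairing with the sum of the positive coroots. Each of the four hyperplane
directions may add one more, in total the length `4` of the longest element of `W`. -/
theorem len_le (x : ExtAffWeyl) :
    len x ≤ 3 * (domRep (transPart x)).1 + 4 * (domRep (transPart x)).2 + 4 := by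
  obtain ⟨k, l, a, b, h1, h2, h3, h4⟩ := exists_transPart_alcovePt x
  have key : ∀ n e : ℤ, -4 < e → e < 4 → ((4 * n + e) / 4).natAbs ≤ n.natAbs + 1 := by
    intro n e h h'
    omega
  rw [len_eq_ptLen, h1, h3]
  simp only [ptLen, domRep]
  rw [show 4 * k + a + 2 * (4 * l + b) = 4 * (k + 2 * l) + (a + 2 * b) by ring,
    show 4 * k + a + (4 * l + b) = 4 * (k + l) + (a + b) by ring]
  have e1 := key k a (by omega) (by omega)
  have e2 := key l b (by omega) (by omega)
  have e3 := key (k + 2 * l) (a + 2 * b) (by omega) (by omega)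
  have e4 := key (k + l) (a + b) (by omega) (by omega)
  have e5 : k.natAbs + l.natAbs + (k + 2 * l).natAbs + (k + l).natAbs ≤
      3 * (max (k + l).natAbs l.natAbs - min (k + l).natAbs l.natAbs) +
        4 * min (k + l).natAbs l.natAbs := by
    clear e1 e2 e3 e4 h1 h2 h3 h4
    omega
  omega

theorem maxLen_eq (lam : DomWeight) : maxLen lam = 3 * lam.1 + 4 * lam.2 + 4 := by
  apply IsGreatest.csSup_eq
  constructor
  -- The bound is attained at `w₀ t_λ`, with `w₀` the longest element of `W`.
  · refine ⟨ofWeyl (weylS1 * weylS2 * weylS1 * weylS2) * transl lam.toWeight * ofWeyl 1,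
      ⟨_, _, rfl⟩, ?_⟩
    rw [len_eq_ptLen, mul_assoc, alcovePt_ofWeyl_mul, alcovePt_transl_mul]
    have : alcovePt (ofWeyl 1) = (1, 1) := by
      have := alcovePt_ofWeyl_mul 1 1
      rw [mul_one, weylAct_one] at this
      rw [this]
      rfl
    rw [this]
    obtain ⟨a, b⟩ := lam
    have : weylAct (weylS1 * weylS2 * weylS1 * weylS2)
        (4 • DomWeight.toWeight (a, b) + (1, 1)) = (-(4 * (a : ℤ) + 1), -(4 * (b : ℤ) + 1)) := by
      have : (4 • DomWeight.toWeight (a, b) + (1, 1) : Weight) =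
          (4 * (a : ℤ) + 1, 4 * (b : ℤ) + 1) := by
        ext <;> simp [DomWeight.toWeight]
      rw [this]
      simp only [weylAct_mul, weylAct_s1, weylAct_s2]
      ext <;> dsimp only <;> ring
    rw [this]
    simp only [ptLen]
    omega
  · rintro _ ⟨x, hx, rfl⟩
    rw [mem_dblCoset] at hx
    have := len_le x
    rwa [hx] at this

theorem sphStd_apply (lam : DomWeight) (x : ExtAffWeyl) :
    sphStd lam x = if domRep (transPart x) = lam then T ((maxLen lam : ℤ) - len x) else 0 := by
  classical
  rw [sphStd, finsum_mem_eq_finite_toFinset_sum _ (dblCoset_finite lam), Finsupp.finsetSum_apply]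
  split_ifs with h
  · rw [Finset.sum_eq_single x]
    · simp
    · intro y _ hy
      exact Finsupp.single_eq_of_ne' hy
    · intro hx
      simp [mem_dblCoset, h] at hx
  · apply Finset.sum_eq_zero
    intro y hy
    apply Finsupp.single_eq_of_ne'
    rintro rfl
    simp [mem_dblCoset, h] at hy

theorem sphToHecke_apply (b : Sph) (x : ExtAffWeyl) :
    sphToHecke b x = b (domRep (transPart x)) *
      T ((maxLen (domRep (transPart x)) : ℤ) - len x) := by
  rw [sphToHecke, Finsupp.sum_apply, Finsupp.sum, Finset.sum_eq_single (domRep (transPart x))]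
  · rw [Finsupp.smul_apply, sphStd_apply, if_pos rfl, smul_eq_mul]
  · intro lam _ h
    rw [Finsupp.smul_apply, sphStd_apply, if_neg (Ne.symm h), smul_zero]
  · intro h
    rw [Finsupp.notMem_support_iff.mp h, zero_smul, Finsupp.zero_apply]

theorem sphToHecke_zero : sphToHecke 0 = 0 := by simp [sphToHecke]

theorem sphToHecke_add (b c : Sph) : sphToHecke (b + c) = sphToHecke b + sphToHecke c := by
  ext1 x
  rw [Finsupp.add_apply, sphToHecke_apply, sphToHecke_apply, sphToHecke_apply, Finsupp.add_apply,
    add_mul]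

theorem sphToHecke_sub (b c : Sph) : sphToHecke (b - c) = sphToHecke b - sphToHecke c := by
  ext1 x
  rw [Finsupp.sub_apply, sphToHecke_apply, sphToHecke_apply, sphToHecke_apply, Finsupp.sub_apply,
    sub_mul]

theorem sphToHecke_smul (f : ℤ[T;T⁻¹]) (b : Sph) : sphToHecke (f • b) = f • sphToHecke b := by
  ext1 x
  rw [Finsupp.smul_apply, sphToHecke_apply, sphToHecke_apply, Finsupp.smul_apply, smul_eq_mul,
    smul_eq_mul, mul_assoc]

theorem transPart_toWeight_domRep (lam : DomWeight) :
    domRep (transPart (transl lam.toWeight)) = lam := by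
  rw [transPart_transl, domRep_toWeight]

theorem sphToHecke_injective : Function.Injective sphToHecke := by
  intro b c h
  ext1 lam
  have := DFunLike.congr_fun h (transl lam.toWeight)
  rw [sphToHecke_apply, sphToHecke_apply, transPart_toWeight_domRep] at this
  exact (isUnit_T _).mul_right_cancel this

/-! ### Uniqueness of the Kazhdan–Lusztig basis -/

/-- The difference of two candidates is bar-invariant with coefficients in `v ℤ[v]`. The inclusion
in the affine Hecke algebra only multiplies by nonnegative powers of `v`, so `eq_zero_of_bar_eq`
applies there. -/
theorem isKL_unique {lam : DomWeight} {b c : Sph} (hb : IsKL lam b) (hc : IsKL lam c) : b = c := by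
  rw [← sub_eq_zero]
  apply sphToHecke_injective
  rw [sphToHecke_zero]
  apply eq_zero_of_bar_eq
  · rw [sphToHecke_sub, bar_sub, hb.1, hc.1]
  · intro x
    rw [sphToHecke_apply]
    apply mul_T_mem_posPart
    · rw [Finsupp.sub_apply]
      by_cases h : domRep (transPart x) = lam
      · rw [h, hb.2.1, hc.2.1, sub_self]
        exact zero_mem _
      · exact sub_mem (hb.2.2 _ h) (hc.2.2 _ h)
    · have := len_le x
      rw [maxLen_eq]
      omega

theorem klDom_eq {lam : DomWeight} {b : Sph} (hb : IsKL lam b) : klDom lam = b := by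
  have h : ∃ b, IsKL lam b := ⟨b, hb⟩
  rw [klDom, dif_pos h]
  exact isKL_unique h.choose_spec hb

/-! ### Right spherical elements as functions on the weight lattice -/

/-- `h` is `∑ f(λ) v^{-ℓ(x)} H_x`, the sum over `x ∈ t_λ W`. -/
def IsRep (h : Hecke) (f : Weight → ℤ[T;T⁻¹]) : Prop :=
  ∀ x, h x = T (-(len x : ℤ)) * f (transPart x)

/-- The weights `mu` such that `s_i` does not decrease the lengths of `t_mu W`. -/
def wtAsc : Fin 3 → Weight → Prop
  | 0, mu => mu.1 + 2 * mu.2 ≤ 1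
  | 1, mu => 0 ≤ mu.1
  | 2, mu => 0 ≤ mu.2

open Classical in
/-- The action of `H_{s_i}` on functions on the weight lattice. -/
noncomputable def wtL (i : Fin 3) (f : Weight → ℤ[T;T⁻¹]) (mu : Weight) : ℤ[T;T⁻¹] :=
  if wtAsc i mu then T (-1) * f (wtRefl i mu)
  else T 1 * f (wtRefl i mu) + (T (-1) - T 1) * f mu

theorem wtRefl_wtRefl (i : Fin 3) (mu : Weight) : wtRefl i (wtRefl i mu) = mu := by
  obtain ⟨a, b⟩ := mu
  match i with
  | 0 => simp only [wtRefl]; ext <;> dsimp only; ring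
  | 1 => simp only [wtRefl]; ext <;> dsimp only <;> ring
  | 2 => simp only [wtRefl]; ext <;> dsimp only <;> ring

theorem wtAsc_wtRefl {i : Fin 3} {mu : Weight} (h : ¬ wtAsc i mu) : wtAsc i (wtRefl i mu) := by
  obtain ⟨a, b⟩ := mu
  revert h
  match i with
  | 0 => simp only [wtRefl, wtAsc]; intro h; linarith
  | 1 => simp only [wtRefl, wtAsc]; intro h; linarith
  | 2 => simp only [wtRefl, wtAsc]; intro h; linarith

theorem isDesc_of_not_wtAsc {i : Fin 3} {x : ExtAffWeyl} (h : ¬ wtAsc i (transPart x)) :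
    IsDesc i x := by
  obtain ⟨k, l, a, b, h1, h2, h3, h4⟩ := exists_transPart_alcovePt x
  rw [h1] at h
  rw [IsDesc, h3]
  revert h
  match i with
  | 0 => simp only [wtAsc, ptDesc]; omega
  | 1 => simp only [wtAsc, ptDesc]; omega
  | 2 => simp only [wtAsc, ptDesc]; omega

/-- If `μ` lies on the wall of `s_i`, some elements of `t_μ W` have `s_i` as a descent and others do
not. As `s_i` then fixes `μ`, both multiplication rules give `v⁻¹ f(μ)`, which is what makes `wtL`
well defined on functions of `μ` alone. -/
theorem wtRefl_eq_of_isDesc {i : Fin 3} {x : ExtAffWeyl} (h : wtAsc i (transPart x))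
    (hd : IsDesc i x) : wtRefl i (transPart x) = transPart x := by
  obtain ⟨k, l, a, b, h1, h2, h3, h4⟩ := exists_transPart_alcovePt x
  rw [h1] at h ⊢
  rw [IsDesc, h3] at hd
  revert h hd
  match i with
  | 0 =>
    simp only [wtAsc, ptDesc, wtRefl]
    intro h hd
    ext <;> dsimp only <;> omega
  | 1 =>
    simp only [wtAsc, ptDesc, wtRefl]
    intro h hd
    ext <;> dsimp only <;> omega
  | 2 =>
    simp only [wtAsc, ptDesc, wtRefl]
    intro h hd
    ext <;> dsimp only <;> omega

theorem IsRep.heckeL {h : Hecke} {f : Weight → ℤ[T;T⁻¹]} (hf : IsRep h f) (i : Fin 3) :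
    IsRep (heckeL i h) (wtL i f) := by
  intro x
  rw [heckeL_apply, hf, hf, transPart_affS_mul, wtL]
  by_cases hd : IsDesc i x
  · have hl := len_affS_mul_of_isDesc hd
    rw [if_pos hd, show (-(len (affS i * x) : ℤ)) = -(len x : ℤ) + 1 by omega, T_add]
    split_ifs with hc
    · rw [wtRefl_eq_of_isDesc hc hd]
      ring
    · ring
  · have hl := len_affS_mul_of_not_isDesc hd
    rw [if_neg hd, if_pos (by by_contra hc; exact hd (isDesc_of_not_wtAsc hc)), add_zero,
      show (-(len (affS i * x) : ℤ)) = -(len x : ℤ) + -1 by omega, T_add]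
    ring

/-- The action of `omegaElt` on the weight lattice. -/
def wtOmega (mu : Weight) : Weight := (1 - mu.1 - 2 * mu.2, mu.2)

theorem IsRep.heckeOmega {h : Hecke} {f : Weight → ℤ[T;T⁻¹]} (hf : IsRep h f) :
    IsRep (heckeOmega h) (fun mu => f (wtOmega mu)) := by
  intro x
  rw [heckeOmega_apply, hf, len_omegaElt_mul, transPart_omegaElt_mul]
  rfl

theorem IsRep.add {h k : Hecke} {f g : Weight → ℤ[T;T⁻¹]} (hf : IsRep h f) (hg : IsRep k g) :
    IsRep (h + k) (f + g) := fun x => by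
  rw [Finsupp.add_apply, hf, hg, Pi.add_apply, mul_add]

theorem IsRep.smul {h : Hecke} {f : Weight → ℤ[T;T⁻¹]} (hf : IsRep h f) (c : ℤ[T;T⁻¹]) :
    IsRep (c • h) (c • f) := fun x => by
  rw [Finsupp.smul_apply, hf, Pi.smul_apply, smul_eq_mul, smul_eq_mul]
  ring

theorem IsRep.ext_left {h k : Hecke} {f : Weight → ℤ[T;T⁻¹]} (hf : IsRep h f) (hk : IsRep k f) :
    h = k := by
  ext1 x
  rw [hf, hk]

theorem IsRep.ext_right {h : Hecke} {f g : Weight → ℤ[T;T⁻¹]} (hf : IsRep h f) (hg : IsRep h g) :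
    f = g := by
  ext1 mu
  have := hf (transl mu)
  rw [hg] at this
  exact ((isUnit_T _).mul_left_cancel this).symm

/-- The function on the weight lattice attached to an element of the spherical Hecke algebra. -/
noncomputable def sphFun (b : Sph) (mu : Weight) : ℤ[T;T⁻¹] :=
  b (domRep mu) * T (maxLen (domRep mu))

theorem isRep_sphToHecke (b : Sph) : IsRep (sphToHecke b) (sphFun b) := by
  intro x
  rw [sphToHecke_apply, sphFun, sub_eq_add_neg, T_add]
  ring

/-- `h` is an eigenvector for `H_{s_i}` with eigenvalue `v⁻¹`. -/
def IsEigen (i : Fin 3) (h : Hecke) : Prop := heckeL i h = (T (-1) : ℤ[T;T⁻¹]) • h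

theorem wtRefl_one (mu : Weight) : wtRefl 1 mu = weylAct weylS1 mu := (weylAct_s1 mu.1 mu.2).symm

theorem wtRefl_two (mu : Weight) : wtRefl 2 mu = weylAct weylS2 mu := (weylAct_s2 mu.1 mu.2).symm

theorem IsRep.isEigen_iff {h : Hecke} {f : Weight → ℤ[T;T⁻¹]} (hf : IsRep h f) (i : Fin 3) :
    IsEigen i h ↔ ∀ mu, f (wtRefl i mu) = f mu := by
  constructor
  · intro he
    have e := (hf.heckeL i)
    rw [he] at e
    have e' := e.ext_right (hf.smul _)
    have key : ∀ mu, wtAsc i mu → f (wtRefl i mu) = f mu := fun mu hmu => by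
      have := congrFun e' mu
      rw [wtL, if_pos hmu] at this
      exact (isUnit_T _).mul_left_cancel this
    intro mu
    by_cases hmu : wtAsc i mu
    · exact key mu hmu
    · have := key _ (wtAsc_wtRefl hmu)
      rw [wtRefl_wtRefl] at this
      exact this.symm
  · intro he
    refine (hf.heckeL i).ext_left ?_
    convert hf.smul _ using 1
    ext1 mu
    rw [wtL, he, Pi.smul_apply, smul_eq_mul]
    split_ifs <;> ring

theorem isEigen_sphToHecke (b : Sph) : IsEigen 1 (sphToHecke b) ∧ IsEigen 2 (sphToHecke b) := by
  constructor
  · rw [(isRep_sphToHecke b).isEigen_iff]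
    intro mu
    rw [sphFun, sphFun, wtRefl_one, domRep_weylAct]
  · rw [(isRep_sphToHecke b).isEigen_iff]
    intro mu
    rw [sphFun, sphFun, wtRefl_two, domRep_weylAct]

/-- Spherical elements are determined by their values at the dominant weights. -/
theorem IsRep.eq_of_dominant {h k : Hecke} {f g : Weight → ℤ[T;T⁻¹]} (hf : IsRep h f)
    (hg : IsRep k g) (h1 : IsEigen 1 h) (h2 : IsEigen 2 h) (k1 : IsEigen 1 k) (k2 : IsEigen 2 k)
    (e : ∀ lam : DomWeight, f lam.toWeight = g lam.toWeight) : h = k := by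
  rw [hf.isEigen_iff] at h1 h2
  rw [hg.isEigen_iff] at k1 k2
  simp only [wtRefl_one, wtRefl_two] at h1 h2 k1 k2
  have inv : ∀ {f : Weight → ℤ[T;T⁻¹]}, (∀ mu, f (weylAct weylS1 mu) = f mu) →
      (∀ mu, f (weylAct weylS2 mu) = f mu) → ∀ (w : weylGroup) mu, f (weylAct w mu) = f mu := by
    intro f h1 h2 w mu
    induction w using weyl_induction with
    | one => rfl
    | s1 w ih => rw [weylAct_mul, h1, ih]
    | s2 w ih => rw [weylAct_mul, h2, ih]
  have : f = g := by
    ext1 mu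
    obtain ⟨w, hw⟩ := exists_weylAct_eq_dominant mu
    rw [← inv h1 h2 w mu, ← inv k1 k2 w mu, hw, e]
  subst this
  exact hf.ext_left hg

/-! ### Bar-invariant operators on spherical elements -/

theorem T_one_mul_T_neg_one : (T 1 : ℤ[T;T⁻¹]) * T (-1) = 1 := by
  rw [← T_add]
  rfl

theorem T_two_eq : (T 2 : ℤ[T;T⁻¹]) = T 1 * T 1 := by
  rw [← T_add]
  rfl

theorem T_three_eq : (T 3 : ℤ[T;T⁻¹]) = T 1 * T 1 * T 1 := by
  rw [← T_add, ← T_add]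
  rfl

/-- If `h` is an eigenvector for `H_{s_j}`, with `i, j` the two simple reflections of `W`, this is
the symmetrization of `h` under `W`. -/
noncomputable def heckeSym (i j : Fin 3) (h : Hecke) : Hecke :=
  heckeB i (heckeB j (heckeB i h)) - (2 : ℤ[T;T⁻¹]) • heckeB i h

theorem isEigen_heckeB (i : Fin 3) (h : Hecke) : IsEigen i (heckeB i h) := by
  rw [IsEigen, heckeB, map_add, map_smul, heckeL_heckeL]
  ext1 x
  simp only [Finsupp.add_apply, Finsupp.smul_apply, smul_eq_mul]
  linear_combination (-(h x)) * T_one_mul_T_neg_one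

theorem IsEigen.sub {i : Fin 3} {h k : Hecke} (hh : IsEigen i h) (hk : IsEigen i k) :
    IsEigen i (h - k) := by
  rw [IsEigen, map_sub, hh, hk, smul_sub]

theorem IsEigen.smul {i : Fin 3} {h : Hecke} (hh : IsEigen i h) (c : ℤ[T;T⁻¹]) :
    IsEigen i (c • h) := by
  rw [IsEigen, map_smul, hh, smul_comm]

/-- Write `B_i = H_{s_i} + v`. In the Hecke algebra of the dihedral group of order eight, `(B_i B_j
B_i - 2 B_i) B_j` is the Kazhdan–Lusztig element of the longest element, and on an eigenvector of
`H_{s_j}` the last factor is a scalar. The right-hand side is the corresponding sum over the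
shortest representatives of the cosets `w⟨s_j⟩`. -/
theorem heckeSym_eq {i j : Fin 3} {h : Hecke} (hj : IsEigen j h) :
    heckeSym i j h = (T 3 : ℤ[T;T⁻¹]) • h + (T 2 : ℤ[T;T⁻¹]) • heckeL i h +
      (T 1 : ℤ[T;T⁻¹]) • heckeL j (heckeL i h) + heckeL i (heckeL j (heckeL i h)) := by
  rw [IsEigen] at hj
  simp only [heckeSym, heckeB, map_add, map_smul, heckeL_heckeL, hj]
  ext1 x
  simp only [Finsupp.add_apply, Finsupp.sub_apply, Finsupp.smul_apply, smul_eq_mul, T_two_eq,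
    T_three_eq]
  linear_combination (2 * heckeL i h x + T 1 * h x) * T_one_mul_T_neg_one

theorem isEigen_heckeSym_left (i j : Fin 3) (h : Hecke) : IsEigen i (heckeSym i j h) :=
  (isEigen_heckeB _ _).sub ((isEigen_heckeB _ _).smul _)

theorem isEigen_heckeSym_right {i j : Fin 3} (hb : ∀ h, heckeL i (heckeL j (heckeL i (heckeL j h)))
    = heckeL j (heckeL i (heckeL j (heckeL i h)))) {h : Hecke} (hj : IsEigen j h) :
    IsEigen j (heckeSym i j h) := by
  rw [IsEigen, heckeSym_eq hj]
  have hb' := hb h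
  rw [IsEigen] at hj
  simp only [map_add, map_smul, hj, heckeL_heckeL, ← hb']
  ext1 x
  simp only [Finsupp.add_apply, Finsupp.smul_apply, smul_eq_mul, T_two_eq, T_three_eq]
  linear_combination (-(T 1 * heckeL i h x)) * T_one_mul_T_neg_one

theorem bar_heckeSym {i j : Fin 3} {h : Hecke} (hh : bar h = h) :
    bar (heckeSym i j h) = heckeSym i j h := by
  rw [heckeSym, bar_sub, bar_smul, bar_heckeB, bar_heckeB, bar_heckeB, hh, map_ofNat]

theorem IsEigen.heckeOmega {i : Fin 3} {h : Hecke} (hh : IsEigen i h) :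
    IsEigen (diagAut i) (heckeOmega h) := by
  rw [IsEigen] at hh ⊢
  rw [← heckeOmega_heckeL, hh, map_smul]

theorem IsEigen.heckeB_zero {h : Hecke} (hh : IsEigen 1 h) : IsEigen 1 (heckeB 0 h) := by
  rw [IsEigen, heckeB, map_add, map_smul, ← heckeL_comm, hh, map_smul, smul_add,
    smul_comm (T 1 : ℤ[T;T⁻¹])]

theorem IsRep.heckeSym {i j : Fin 3} {h : Hecke} {f : Weight → ℤ[T;T⁻¹]} (hf : IsRep h f)
    (hj : IsEigen j h) : IsRep (heckeSym i j h) ((T 3 : ℤ[T;T⁻¹]) • f +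
      (T 2 : ℤ[T;T⁻¹]) • wtL i f + (T 1 : ℤ[T;T⁻¹]) • wtL j (wtL i f) + wtL i (wtL j (wtL i f))) := by
  rw [heckeSym_eq hj]
  exact (((hf.smul _).add ((hf.heckeL i).smul _)).add (((hf.heckeL i).heckeL j).smul _)).add
    (((hf.heckeL i).heckeL j).heckeL i)

theorem wtL_of_asc {i : Fin 3} {f : Weight → ℤ[T;T⁻¹]} {mu : Weight} (h : wtAsc i mu) :
    wtL i f mu = T (-1) * f (wtRefl i mu) := if_pos h

/-- The value of the symmetrization `heckeSym 1 2 h` at a dominant weight. -/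
theorem sym_one_two_apply (f : Weight → ℤ[T;T⁻¹]) {a b : ℤ} (ha : 0 ≤ a) (hb : 0 ≤ b) :
    ((T 3 : ℤ[T;T⁻¹]) • f + (T 2 : ℤ[T;T⁻¹]) • wtL 1 f + (T 1 : ℤ[T;T⁻¹]) • wtL 2 (wtL 1 f) +
      wtL 1 (wtL 2 (wtL 1 f))) (a, b) =
    T 3 * f (a, b) + T 1 * f (-a, a + b) + T (-1) * f (-a - 2 * b, a + b) +
      T (-3) * f (-a - 2 * b, b) := by
  have e1 : ∀ g, wtL 1 g (a, b) = T (-1) * g (-a, a + b) := fun g => wtL_of_asc (by exact ha)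
  have e2 : ∀ g, wtL 2 g (a, b) = T (-1) * g (a + 2 * b, -b) := fun g => wtL_of_asc (by exact hb)
  have e3 : ∀ g, wtL 1 g (a + 2 * b, -b) = T (-1) * g (-a - 2 * b, a + b) := fun g => by
    rw [wtL_of_asc (by change 0 ≤ a + 2 * b; omega)]
    congr 2
    ext <;> simp only [wtRefl] <;> ring
  have e4 : ∀ g, wtL 2 g (-a, a + b) = T (-1) * g (a + 2 * b, -a - b) := fun g => by
    rw [wtL_of_asc (by change 0 ≤ a + b; omega)]
    congr 2
    ext <;> simp only [wtRefl] <;> ring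
  have e5 : ∀ g, wtL 1 g (a + 2 * b, -a - b) = T (-1) * g (-a - 2 * b, b) := fun g => by
    rw [wtL_of_asc (by change 0 ≤ a + 2 * b; omega)]
    congr 2
    ext <;> simp only [wtRefl] <;> ring
  simp only [Pi.add_apply, Pi.smul_apply, smul_eq_mul, e1, e2, e3, e4, e5, ← mul_assoc, ← T_add]
  norm_num

/-- The value of the symmetrization `heckeSym 2 1 h` at a dominant weight. -/
theorem sym_two_one_apply (f : Weight → ℤ[T;T⁻¹]) {a b : ℤ} (ha : 0 ≤ a) (hb : 0 ≤ b) :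
    ((T 3 : ℤ[T;T⁻¹]) • f + (T 2 : ℤ[T;T⁻¹]) • wtL 2 f + (T 1 : ℤ[T;T⁻¹]) • wtL 1 (wtL 2 f) +
      wtL 2 (wtL 1 (wtL 2 f))) (a, b) =
    T 3 * f (a, b) + T 1 * f (a + 2 * b, -b) + T (-1) * f (a + 2 * b, -a - b) +
      T (-3) * f (a, -a - b) := by
  have e1 : ∀ g, wtL 1 g (a, b) = T (-1) * g (-a, a + b) := fun g => wtL_of_asc (by exact ha)
  have e2 : ∀ g, wtL 2 g (a, b) = T (-1) * g (a + 2 * b, -b) := fun g => wtL_of_asc (by exact hb)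
  have e3 : ∀ g, wtL 1 g (a + 2 * b, -b) = T (-1) * g (-a - 2 * b, a + b) := fun g => by
    rw [wtL_of_asc (by change 0 ≤ a + 2 * b; omega)]
    congr 2
    ext <;> simp only [wtRefl] <;> ring
  have e4 : ∀ g, wtL 2 g (-a, a + b) = T (-1) * g (a + 2 * b, -a - b) := fun g => by
    rw [wtL_of_asc (by change 0 ≤ a + b; omega)]
    congr 2
    ext <;> simp only [wtRefl] <;> ring
  have e5 : ∀ g, wtL 2 g (-a - 2 * b, a + b) = T (-1) * g (a, -a - b) := fun g => by
    rw [wtL_of_asc (by change 0 ≤ a + b; omega)]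
    congr 2
    ext <;> simp only [wtRefl] <;> ring
  simp only [Pi.add_apply, Pi.smul_apply, smul_eq_mul, e1, e2, e3, e4, e5, ← mul_assoc, ← T_add]
  norm_num

/-! ### The Kazhdan–Lusztig element of the trivial weight -/

theorem isEigen_apply_eq_zero {i : Fin 3} {h : Hecke} (hh : IsEigen i h) {x : ExtAffWeyl}
    (hx : h x = 0) : h (affS i * x) = 0 := by
  have := DFunLike.congr_fun hh x
  rw [heckeL_apply, Finsupp.smul_apply, hx] at this
  simpa using this

theorem alcovePt_one : alcovePt 1 = (1, 1) := rfl

/-- `H_0 = ∑_{w ∈ W} v^{4 - ℓ(w)} H_w` is the symmetrization of `(H_{s₂} + v) H_1`, which is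
bar-invariant. The difference of the two is supported on `W` and is an eigenvector for `s₁` and
`s₂`, so it vanishes as soon as its coefficient at `1` does; both coefficients there are `v⁴`. -/
theorem bar_sphToHecke_single_zero :
    bar (sphToHecke (Finsupp.single (0, 0) 1)) = sphToHecke (Finsupp.single (0, 0) 1) := by
  set b := heckeB 2 (Finsupp.single 1 1) with hb
  have hbar : bar (Finsupp.single (1 : ExtAffWeyl) (1 : ℤ[T;T⁻¹])) = Finsupp.single 1 1 := by
    rw [bar_single, barStd_of_forall, map_one, one_smul]
    intro i
    rw [IsDesc, alcovePt_one]
    revert i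
    decide
  have hbinv : bar b = b := by rw [hb, bar_heckeB, hbar]
  have hbe : IsEigen 2 b := isEigen_heckeB _ _
  suffices h : sphToHecke (Finsupp.single (0, 0) 1) = heckeSym 1 2 b by
    rw [h, bar_heckeSym hbinv]
  rw [← sub_eq_zero]
  set k := sphToHecke (Finsupp.single (0, 0) 1) - heckeSym 1 2 b with hk
  have k1 : IsEigen 1 k := (isEigen_sphToHecke _).1.sub (isEigen_heckeSym_left _ _ _)
  have k2 : IsEigen 2 k :=
    (isEigen_sphToHecke _).2.sub (isEigen_heckeSym_right heckeL_braid hbe)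
  have kw : ∀ (w : weylGroup) x, k x = 0 → k (ofWeyl w * x) = 0 := by
    intro w x hx
    induction w using weyl_induction with
    | one => rwa [ofWeyl_one, one_mul]
    | s1 w ih =>
      rw [← ofWeyl_mul_ofWeyl, mul_assoc]
      exact isEigen_apply_eq_zero k1 ih
    | s2 w ih =>
      rw [← ofWeyl_mul_ofWeyl, mul_assoc]
      exact isEigen_apply_eq_zero k2 ih
  have single0 : ∀ x : ExtAffWeyl, alcovePt x ≠ (1, 1) →
      (Finsupp.single (1 : ExtAffWeyl) (1 : ℤ[T;T⁻¹])) x = 0 := fun x hx => by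
    apply Finsupp.single_eq_of_ne
    rintro rfl
    exact hx alcovePt_one
  have bz : ∀ x : ExtAffWeyl, alcovePt x ≠ (1, 1) → alcovePt x ≠ (3, -1) → b x = 0 := by
    intro x h1 h2
    rw [hb, heckeB, Finsupp.add_apply, heckeL_apply, Finsupp.smul_apply, single0 _ h1, single0]
    · simp
    · rw [alcovePt_affS_mul]
      intro h
      apply h2
      have h3 := congrArg (ptRefl 2) h
      rw [← alcovePt_affS_mul, ← alcovePt_affS_mul, affS_mul_affS_mul] at h3
      rw [h3]
      rfl
  have nd1 : ∀ {x : ExtAffWeyl}, 0 ≤ (alcovePt x).1 → ∀ h : Hecke,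
      heckeL 1 h x = h (affS 1 * x) := fun hx h => by
    rw [heckeL_apply, if_neg (by rw [IsDesc]; exact not_lt.mpr hx), add_zero]
  have nd2 : ∀ {x : ExtAffWeyl}, 0 ≤ (alcovePt x).2 → ∀ h : Hecke,
      heckeL 2 h x = h (affS 2 * x) := fun hx h => by
    rw [heckeL_apply, if_neg (by rw [IsDesc]; exact not_lt.mpr hx), add_zero]
  have kone : k 1 = 0 := by
    have p1 : alcovePt (affS 1 * 1) = (-1, 2) := by rw [alcovePt_affS_mul]; rfl
    have p2 : alcovePt (affS 2 * 1) = (3, -1) := by rw [alcovePt_affS_mul]; rfl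
    have p21 : alcovePt (affS 2 * (affS 1 * 1)) = (3, -2) := by
      rw [alcovePt_affS_mul, p1]; rfl
    have p12 : alcovePt (affS 1 * (affS 2 * 1)) = (-3, 2) := by
      rw [alcovePt_affS_mul, p2]; rfl
    have p121 : alcovePt (affS 1 * (affS 2 * (affS 1 * 1))) = (-3, 1) := by
      rw [alcovePt_affS_mul, p21]; rfl
    have b1 : b 1 = T 1 := by
      rw [hb, heckeB, Finsupp.add_apply, nd2 (by rw [alcovePt_one]; norm_num), single0]
      · simp
      · rw [p2]; decide
    rw [hk, Finsupp.sub_apply, heckeSym_eq hbe]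
    simp only [Finsupp.add_apply, Finsupp.smul_apply]
    rw [nd1 (x := 1) (by rw [alcovePt_one]; norm_num),
      nd1 (x := 1) (by rw [alcovePt_one]; norm_num),
      nd2 (x := 1) (by rw [alcovePt_one]; norm_num),
      nd2 (x := affS 1 * 1) (by rw [p1]; norm_num),
      nd1 (x := affS 2 * 1) (by rw [p2]; norm_num),
      nd1 (x := affS 2 * (affS 1 * 1)) (by rw [p21]; norm_num),
      bz (affS 1 * 1) (by rw [p1]; decide) (by rw [p1]; decide),
      bz (affS 1 * (affS 2 * 1)) (by rw [p12]; decide) (by rw [p12]; decide),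
      bz (affS 1 * (affS 2 * (affS 1 * 1))) (by rw [p121]; decide) (by rw [p121]; decide), b1, sphToHecke_apply]
    have e1 : domRep (transPart 1) = (0, 0) := rfl
    have e2 : len 1 = 0 := by rw [len_eq_ptLen, alcovePt_one]; rfl
    rw [e1, e2, maxLen_eq]
    simp only [smul_eq_mul, mul_zero, add_zero, one_mul, Finsupp.single_eq_same]
    rw [← T_add, sub_eq_zero]
    norm_num
  ext1 x
  rw [Finsupp.zero_apply]
  by_cases hx : transPart x = 0
  · have : x = ofWeyl x.right * 1 := by
      conv_lhs => rw [eq_transl_mul_ofWeyl x, hx]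
      simp [transl]
    rw [this]
    exact kw _ _ kone
  · have L0 : ∀ (i : Fin 3) (h : Hecke), i ≠ 0 → (∀ x, transPart x ≠ 0 → h x = 0) →
        ∀ x, transPart x ≠ 0 → heckeL i h x = 0 := by
      intro i h hi hh x hx
      rw [heckeL_apply, hh x hx, hh]
      · simp
      · rw [transPart_affS_mul]
        intro h0
        apply hx
        rw [← wtRefl_wtRefl i (transPart x), h0]
        match i, hi with
        | 1, _ => rfl
        | 2, _ => rfl
    have s0 : ∀ x : ExtAffWeyl, transPart x ≠ 0 →
        (Finsupp.single (1 : ExtAffWeyl) (1 : ℤ[T;T⁻¹])) x = 0 := fun x hx => by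
      apply Finsupp.single_eq_of_ne
      rintro rfl
      exact hx rfl
    have b0 : ∀ x, transPart x ≠ 0 → b x = 0 := by
      intro x hx
      rw [hb, heckeB, Finsupp.add_apply, Finsupp.smul_apply, s0 x hx,
        L0 2 _ (by decide) s0 x hx]
      simp
    have c1 := L0 1 _ (by decide) b0
    have c2 := L0 2 _ (by decide) c1
    have c3 := L0 1 _ (by decide) c2
    rw [hk, Finsupp.sub_apply, heckeSym_eq hbe]
    simp only [Finsupp.add_apply, Finsupp.smul_apply]
    rw [b0 x hx, c1 x hx, c2 x hx, c3 x hx, sphToHecke_apply, Finsupp.single_eq_of_ne]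
    · simp
    · intro h0
      apply hx
      obtain ⟨w, hw⟩ := exists_weylAct_eq_dominant (transPart x)
      rw [h0] at hw
      rw [← weylAct_inv_weylAct w (transPart x), hw]
      exact weylAct_zero _

/-! ### The `t`-analogue of Kostant's partition function -/

/-- The contribution of `i α₂₁ + j α₁₂ + k α₁ + l α₂`. -/
noncomputable def kpfTerm (x y : ℤ) (i j k l : ℕ) : ℤ[T;T⁻¹] :=
  if 2 * (j : ℤ) + 2 * k - 2 * l = x ∧ (i : ℤ) - k + 2 * l = y then
    T (2 * ((i : ℤ) + j + k + l)) else 0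

/-- Truncation of Kostant's partition function. -/
noncomputable def kpfTrunc (N : ℕ) (x y : ℤ) : ℤ[T;T⁻¹] :=
  ∑ i ∈ Finset.range N, ∑ j ∈ Finset.range N, ∑ k ∈ Finset.range N, ∑ l ∈ Finset.range N,
    kpfTerm x y i j k l

/-- The `v²`-analogue of Kostant's partition function, at the weight `(x, y)`. -/
noncomputable def kpf (x y : ℤ) : ℤ[T;T⁻¹] := kpfTrunc (x.natAbs + 2 * y.natAbs + 1) x y

/-- The conditions give `x + y = i + 2j + k` and `x + 2y = 2(i + j + l)`, which bound all four
multiplicities. The same two identities show that `kpf` vanishes when `x + y` or `x + 2y` is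
negative. -/
theorem kpfTerm_eq_zero {x y : ℤ} {i j k l N : ℕ} (hN : x.natAbs + 2 * y.natAbs < N)
    (h : N ≤ i ∨ N ≤ j ∨ N ≤ k ∨ N ≤ l) : kpfTerm x y i j k l = 0 := by
  rw [kpfTerm, if_neg]
  omega

theorem sum_range_of_le {M : Type*} [AddCommMonoid M] {f : ℕ → M} {N N' : ℕ} (h : N ≤ N')
    (hf : ∀ i, N ≤ i → f i = 0) : ∑ i ∈ Finset.range N', f i = ∑ i ∈ Finset.range N, f i := by
  symm
  apply Finset.sum_subset (Finset.range_mono h)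
  intro i _ hi
  exact hf i (by simpa using hi)

theorem kpfTrunc_of_le {x y : ℤ} {N N' : ℕ} (hN : x.natAbs + 2 * y.natAbs < N) (h : N ≤ N') :
    kpfTrunc N' x y = kpfTrunc N x y := by
  unfold kpfTrunc
  rw [sum_range_of_le h]
  swap
  · intro i hi
    exact Finset.sum_eq_zero fun j _ => Finset.sum_eq_zero fun k _ => Finset.sum_eq_zero fun l _ =>
      kpfTerm_eq_zero hN (Or.inl hi)
  refine Finset.sum_congr rfl fun i _ => ?_
  rw [sum_range_of_le h]
  swap
  · intro j hj
    exact Finset.sum_eq_zero fun k _ => Finset.sum_eq_zero fun l _ =>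
      kpfTerm_eq_zero hN (Or.inr (Or.inl hj))
  refine Finset.sum_congr rfl fun j _ => ?_
  rw [sum_range_of_le h]
  swap
  · intro k hk
    exact Finset.sum_eq_zero fun l _ => kpfTerm_eq_zero hN (Or.inr (Or.inr (Or.inl hk)))
  refine Finset.sum_congr rfl fun k _ => ?_
  exact sum_range_of_le h fun l hl => kpfTerm_eq_zero hN (Or.inr (Or.inr (Or.inr hl)))

theorem kpf_eq_kpfTrunc {x y : ℤ} {N : ℕ} (hN : x.natAbs + 2 * y.natAbs < N) :
    kpf x y = kpfTrunc N x y :=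
  (kpfTrunc_of_le (Nat.lt_succ_self _) hN).symm

theorem kpf_eq_zero {x y : ℤ} (h : x + y < 0 ∨ x + 2 * y < 0) : kpf x y = 0 := by
  unfold kpf kpfTrunc
  refine Finset.sum_eq_zero fun i _ => Finset.sum_eq_zero fun j _ => Finset.sum_eq_zero fun k _ =>
    Finset.sum_eq_zero fun l _ => ?_
  rw [kpfTerm, if_neg]
  omega

theorem kpf_zero : kpf 0 0 = 1 := by
  rw [kpf_eq_kpfTrunc (N := 1) (by decide)]
  simp [kpfTrunc, kpfTerm]

theorem kpf_mem_posPart {x y : ℤ} (h : x ≠ 0 ∨ y ≠ 0) : kpf x y ∈ posPart := by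
  unfold kpf kpfTrunc
  refine sum_mem fun i _ => sum_mem fun j _ => sum_mem fun k _ => sum_mem fun l _ => ?_
  rw [kpfTerm]
  split_ifs with hc
  · exact T_mem_posPart (by omega)
  · exact zero_mem _

/-- Telescoping of a sum along multiples of a root. -/
theorem sum_range_sub_mul_sum_range {f g : ℕ → ℤ[T;T⁻¹]} {N : ℕ} {c : ℤ[T;T⁻¹]}
    (h : ∀ k, c * g k = f (k + 1)) (hN : f N = 0) :
    ∑ k ∈ Finset.range N, f k - c * ∑ k ∈ Finset.range N, g k = f 0 := by
  rw [Finset.mul_sum, ← Finset.sum_sub_distrib]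
  simp only [h]
  rw [Finset.sum_range_sub', hN, sub_zero]

/-- Multiplying the generating function of `kpf` by `1 - v² e^{α₁}` cancels the geometric series of
`α₁`: the sum over `k` telescopes to its term `k = 0`. -/
theorem kpf_sub_alpha1 {x y : ℤ} {N : ℕ} (hN : x.natAbs + 2 * y.natAbs + 4 < N) :
    kpf x y - T 2 * kpf (x - 2) (y + 1) = ∑ i ∈ Finset.range N, ∑ j ∈ Finset.range N,
      ∑ l ∈ Finset.range N, kpfTerm x y i j 0 l := by
  rw [kpf_eq_kpfTrunc (N := N) (by omega), kpf_eq_kpfTrunc (N := N) (by omega), kpfTrunc, kpfTrunc]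
  simp only [Finset.mul_sum (s := Finset.range N), ← Finset.sum_sub_distrib]
  refine Finset.sum_congr rfl fun i _ => Finset.sum_congr rfl fun j _ => ?_
  rw [Finset.sum_comm]
  refine Finset.sum_congr rfl fun l _ => ?_
  rw [Finset.sum_sub_distrib, ← Finset.mul_sum]
  apply sum_range_sub_mul_sum_range (f := fun k => kpfTerm x y i j k l)
  · intro k
    simp only [kpfTerm]
    by_cases hc : 2 * (j : ℤ) + 2 * k - 2 * l = x - 2 ∧ (i : ℤ) - k + 2 * l = y + 1
    · rw [if_pos hc, if_pos (by push_cast; omega), ← T_add]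
      congr 1
      push_cast
      ring
    · rw [if_neg hc, if_neg (by push_cast; omega), mul_zero]
  · exact kpfTerm_eq_zero (N := N) (by omega) (by omega)

theorem kpf_sub_alpha2 {x y : ℤ} {N : ℕ} (hN : x.natAbs + 2 * y.natAbs + 6 < N) :
    kpf x y - T 2 * kpf (x + 2) (y - 2) = ∑ i ∈ Finset.range N, ∑ j ∈ Finset.range N,
      ∑ k ∈ Finset.range N, kpfTerm x y i j k 0 := by
  rw [kpf_eq_kpfTrunc (N := N) (by omega), kpf_eq_kpfTrunc (N := N) (by omega), kpfTrunc, kpfTrunc]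
  simp only [Finset.mul_sum (s := Finset.range N), ← Finset.sum_sub_distrib]
  refine Finset.sum_congr rfl fun i _ => Finset.sum_congr rfl fun j _ =>
    Finset.sum_congr rfl fun k _ => ?_
  rw [Finset.sum_sub_distrib, ← Finset.mul_sum]
  apply sum_range_sub_mul_sum_range (f := fun l => kpfTerm x y i j k l)
  · intro l
    simp only [kpfTerm]
    by_cases hc : 2 * (j : ℤ) + 2 * k - 2 * l = x + 2 ∧ (i : ℤ) - k + 2 * l = y - 2
    · rw [if_pos hc, if_pos (by push_cast; omega), ← T_add]
      congr 1
      push_cast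
      ring
    · rw [if_neg hc, if_neg (by push_cast; omega), mul_zero]
  · exact kpfTerm_eq_zero (N := N) (by omega) (by omega)

/-- The partition function for the positive roots other than `α₁` is invariant under `s₁`. -/
theorem kpf_sub_alpha1_invariant (x y : ℤ) :
    kpf (-x) (x + y) - T 2 * kpf (-x - 2) (x + y + 1) = kpf x y - T 2 * kpf (x - 2) (y + 1) := by
  rw [kpf_sub_alpha1 (N := 3 * x.natAbs + 2 * y.natAbs + 5) (by omega),
    kpf_sub_alpha1 (N := 3 * x.natAbs + 2 * y.natAbs + 5) (by omega)]
  refine Finset.sum_congr rfl fun i _ => ?_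
  -- `s₁` fixes `α₂₁` and exchanges `α₁₂` with `α₂`, hence the exchange of `j` and `l`.
  rw [Finset.sum_comm]
  refine Finset.sum_congr rfl fun j _ => Finset.sum_congr rfl fun l _ => ?_
  simp only [kpfTerm]
  by_cases hc : 2 * (j : ℤ) + 2 * (0 : ℕ) - 2 * l = x ∧ (i : ℤ) - (0 : ℕ) + 2 * l = y
  · rw [if_pos hc, if_pos (by omega)]
    congr 1
    push_cast
    ring
  · rw [if_neg hc, if_neg (by omega)]

/-- The partition function for the positive roots other than `α₂` is invariant under `s₂`. -/
theorem kpf_sub_alpha2_invariant (x y : ℤ) :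
    kpf (x + 2 * y) (-y) - T 2 * kpf (x + 2 * y + 2) (-y - 2)
      = kpf x y - T 2 * kpf (x + 2) (y - 2) := by
  rw [kpf_sub_alpha2 (N := x.natAbs + 4 * y.natAbs + 7) (by omega),
    kpf_sub_alpha2 (N := x.natAbs + 4 * y.natAbs + 7) (by omega)]
  have swap : ∀ (N : ℕ) (f : ℕ → ℕ → ℕ → ℤ[T;T⁻¹]),
      ∑ i ∈ Finset.range N, ∑ j ∈ Finset.range N, ∑ k ∈ Finset.range N, f i j k =
      ∑ i ∈ Finset.range N, ∑ j ∈ Finset.range N, ∑ k ∈ Finset.range N, f k j i := by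
    intro N f
    rw [Finset.sum_comm]
    conv_rhs => rw [Finset.sum_comm]
    exact Finset.sum_congr rfl fun j _ => Finset.sum_comm
  -- `s₂` fixes `α₁₂` and exchanges `α₂₁` with `α₁`, hence the exchange of `i` and `k`.
  rw [swap]
  refine Finset.sum_congr rfl fun i _ => Finset.sum_congr rfl fun j _ =>
    Finset.sum_congr rfl fun k _ => ?_
  simp only [kpfTerm]
  by_cases hc : 2 * (j : ℤ) + 2 * k - 2 * (0 : ℕ) = x ∧ (i : ℤ) - k + 2 * (0 : ℕ) = y
  · rw [if_pos hc, if_pos (by omega)]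
    congr 1
    push_cast
    ring
  · rw [if_neg hc, if_neg (by omega)]

/-! ### Alternating sums over the Weyl group -/

/-- The alternating sum `∑_w (-1)^{ℓ(w)} F(w (a, b) - (c, e))`. -/
def altSum {R : Type*} [Ring R] (F : ℤ → ℤ → R) (a b c e : ℤ) : R :=
  F (a - c) (b - e) - F (-a - c) (a + b - e) - F (a + 2 * b - c) (-b - e)
    + F (-a - 2 * b - c) (a + b - e) + F (a + 2 * b - c) (-a - b - e)
    - F (-a - 2 * b - c) (b - e) - F (a - c) (-a - b - e) + F (-a - c) (-b - e)

section
variable {R : Type*} [CommRing R] (F : ℤ → ℤ → R)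

theorem altSum_neg_left (a b c e : ℤ) : altSum F (-a) (a + b) c e = -altSum F a b c e := by
  simp only [altSum]
  ring_nf

theorem altSum_zero_left (b c e : ℤ) : altSum F 0 b c e = 0 := by
  simp only [altSum]
  ring_nf

theorem altSum_zero_right (a c e : ℤ) : altSum F a 0 c e = 0 := by
  simp only [altSum]
  ring_nf

variable {F}

/-- By invariance `F(wλ - s₁μ) = F(s₁wλ - μ)`, and the substitution `w ↦ s₁w` changes the sign of
every term. The combination below pairs the terms in this way. -/
theorem altSum_refl1 (hF : ∀ x y, F (-x) (x + y) = F x y) (a b c e : ℤ) :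
    altSum F a b (-c) (c + e) = -altSum F a b c e := by
  have h : ∀ x y x' y', x' = -x → y' = x + y → F x' y' = F x y := by
    rintro x y _ _ rfl rfl
    exact hF x y
  simp only [altSum]
  linear_combination h (-a - c) (a + b - e) (a - -c) (b - (c + e)) (by ring) (by ring) -
    h (a - c) (b - e) (-a - -c) (a + b - (c + e)) (by ring) (by ring) -
    h (-a - 2 * b - c) (a + b - e) (a + 2 * b - -c) (-b - (c + e)) (by ring) (by ring) +
    h (a + 2 * b - c) (-b - e) (-a - 2 * b - -c) (a + b - (c + e)) (by ring) (by ring) +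
    h (-a - 2 * b - c) (b - e) (a + 2 * b - -c) (-a - b - (c + e)) (by ring) (by ring) -
    h (a + 2 * b - c) (-a - b - e) (-a - 2 * b - -c) (b - (c + e)) (by ring) (by ring) -
    h (-a - c) (-b - e) (a - -c) (-a - b - (c + e)) (by ring) (by ring) +
    h (a - c) (-a - b - e) (-a - -c) (-b - (c + e)) (by ring) (by ring)

/-- A weight with first coordinate `0` is fixed by `s₁`. Antisymmetry would only give that twice the
sum is zero, so the terms for `w` and `s₁w` are cancelled against each other directly. -/
theorem altSum_of_fst_eq_zero (hF : ∀ x y, F (-x) (x + y) = F x y) (a b e : ℤ) :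
    altSum F a b 0 e = 0 := by
  have h : ∀ x y x' y', x' = -x → y' = x + y → F x' y' = F x y := by
    rintro x y _ _ rfl rfl
    exact hF x y
  simp only [altSum]
  linear_combination h (-a - 0) (a + b - e) (a - 0) (b - e) (by ring) (by ring) +
    h (a + 2 * b - 0) (-b - e) (-a - 2 * b - 0) (a + b - e) (by ring) (by ring) +
    h (-a - 2 * b - 0) (b - e) (a + 2 * b - 0) (-a - b - e) (by ring) (by ring) +
    h (a - 0) (-a - b - e) (-a - 0) (-b - e) (by ring) (by ring)

theorem altSum_of_snd_eq_zero (hF : ∀ x y, F (x + 2 * y) (-y) = F x y) (a b c : ℤ) :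
    altSum F a b c 0 = 0 := by
  have h : ∀ x y x' y', x' = x + 2 * y → y' = -y → F x' y' = F x y := by
    rintro x y _ _ rfl rfl
    exact hF x y
  simp only [altSum]
  linear_combination h (a + 2 * b - c) (-b - 0) (a - c) (b - 0) (by ring) (by ring) -
    h (a + 2 * b - c) (-a - b - 0) (-a - c) (a + b - 0) (by ring) (by ring) +
    h (a - c) (-a - b - 0) (-a - 2 * b - c) (a + b - 0) (by ring) (by ring) -
    h (-a - c) (-b - 0) (-a - 2 * b - c) (b - 0) (by ring) (by ring)

/-- The shifts run over the weights of the representation of highest weight `ϖ₁`, a single `W`-orbit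
closed under negation. In each term of the alternating sum `w` permutes the orbit, so shifting `μ`
or `λ` comes to the same. The next lemma is the analogue for the orbit of `ϖ₂`. -/
theorem altSum_pieri1 (F : ℤ → ℤ → R) (a b c e : ℤ) :
    altSum F a b (c - 1) e + altSum F a b (c + 1) (e - 1) + altSum F a b (c - 1) (e + 1) +
        altSum F a b (c + 1) e =
      altSum F (a + 1) b c e + altSum F (a - 1) (b + 1) c e + altSum F (a + 1) (b - 1) c e +
        altSum F (a - 1) b c e := by
  simp only [altSum]
  ring_nf

theorem altSum_pieri2 (F : ℤ → ℤ → R) (a b c e : ℤ) :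
    altSum F a b c (e - 1) + altSum F a b (c - 2) (e + 1) + altSum F a b (c + 2) (e - 1) +
        altSum F a b c (e + 1) =
      altSum F a (b + 1) c e + altSum F (a + 2) (b - 1) c e + altSum F (a - 2) (b + 1) c e +
        altSum F a (b - 1) c e := by
  simp only [altSum]
  ring_nf

end

/-! ### The `q`-analogue of weight multiplicities -/

/-- Lusztig's `v²`-analogue of the multiplicity of the weight `mu` in the representation of highest
weight `lam`. -/
noncomputable def qMult (lam mu : Weight) : ℤ[T;T⁻¹] :=
  altSum kpf (lam.1 + 1) (lam.2 + 1) (mu.1 + 1) (mu.2 + 1)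

theorem altSum_kpf_sub_alpha1 (a b c e : ℤ) :
    altSum kpf a b c e - T 2 * altSum kpf a b (c + 2) (e - 1) =
      altSum (fun x y => kpf x y - T 2 * kpf (x - 2) (y + 1)) a b c e := by
  simp only [altSum]
  ring_nf

theorem altSum_kpf_sub_alpha2 (a b c e : ℤ) :
    altSum kpf a b c e - T 2 * altSum kpf a b (c - 2) (e + 2) =
      altSum (fun x y => kpf x y - T 2 * kpf (x + 2) (y - 2)) a b c e := by
  simp only [altSum]
  ring_nf

/-- Here `μ + ρ` lies on the wall of `s₁`, where the alternating sum of the `s₁`-invariant function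
`kpf(·) - v² kpf(· - α₁)` vanishes. -/
theorem qMult_fst_eq_neg_one (lam : Weight) (m : ℤ) :
    qMult lam (-1, m) = T 2 * qMult lam (1, m - 1) := by
  have h1 := altSum_kpf_sub_alpha1 (lam.1 + 1) (lam.2 + 1) 0 (m + 1)
  rw [altSum_of_fst_eq_zero (F := fun x y => kpf x y - T 2 * kpf (x - 2) (y + 1))
    kpf_sub_alpha1_invariant, sub_eq_zero] at h1
  simp only [qMult]
  rw [show (-1 : ℤ) + 1 = 0 by norm_num, show m - 1 + 1 = m + 1 - 1 by ring]
  exact h1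

theorem qMult_snd_eq_neg_one (lam : Weight) (n : ℤ) :
    qMult lam (n, -1) = T 2 * qMult lam (n - 2, 1) := by
  have h1 := altSum_kpf_sub_alpha2 (lam.1 + 1) (lam.2 + 1) (n + 1) 0
  rw [altSum_of_snd_eq_zero (F := fun x y => kpf x y - T 2 * kpf (x + 2) (y - 2))
    kpf_sub_alpha2_invariant, sub_eq_zero] at h1
  simp only [qMult]
  rw [show (-1 : ℤ) + 1 = 0 by norm_num, show n - 2 + 1 = n + 1 - 2 by ring]
  exact h1

/-- One step beyond the wall: the alternating sum of the same `s₁`-invariant function takes opposite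
values at `μ + ρ` and at its mirror image, whose first coordinates are `-1` and `1`. -/
theorem qMult_fst_eq_neg_two (lam : Weight) (m : ℤ) :
    qMult lam (-2, m) = (T 2 - 1) * qMult lam (0, m - 1) + T 2 * qMult lam (2, m - 2) := by
  have h1 := altSum_kpf_sub_alpha1 (lam.1 + 1) (lam.2 + 1) (-1) (m + 1)
  have h2 := altSum_kpf_sub_alpha1 (lam.1 + 1) (lam.2 + 1) 1 m
  have h3 := altSum_refl1 (F := fun x y => kpf x y - T 2 * kpf (x - 2) (y + 1))
    kpf_sub_alpha1_invariant (lam.1 + 1) (lam.2 + 1) 1 m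
  rw [add_comm 1 m, ← h1, ← h2] at h3
  simp only [qMult]
  norm_num at h3 ⊢
  rw [show m - 2 + 1 = m - 1 by ring]
  linear_combination h3

theorem qMult_neg_one_left (m : ℤ) (mu : Weight) : qMult (-1, m) mu = 0 := by
  simp [qMult, altSum_zero_left]

theorem qMult_neg_one_right (n : ℤ) (mu : Weight) : qMult (n, -1) mu = 0 := by
  simp [qMult, altSum_zero_right]

theorem qMult_neg_two_left (m : ℤ) (mu : Weight) :
    qMult (-2, m) mu = -qMult (0, m - 1) mu := by
  have := altSum_neg_left kpf 1 m (mu.1 + 1) (mu.2 + 1)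
  simp only [qMult]
  norm_num
  rw [← this, add_comm 1 m]

theorem qMult_pieri1 (lam : Weight) (a b : ℤ) :
    qMult lam (a - 1, b) + qMult lam (a + 1, b - 1) + qMult lam (a - 1, b + 1) +
        qMult lam (a + 1, b) =
      qMult (lam.1 + 1, lam.2) (a, b) + qMult (lam.1 - 1, lam.2 + 1) (a, b) +
        qMult (lam.1 + 1, lam.2 - 1) (a, b) + qMult (lam.1 - 1, lam.2) (a, b) := by
  have := altSum_pieri1 kpf (lam.1 + 1) (lam.2 + 1) (a + 1) (b + 1)
  simp only [qMult]
  ring_nf at this ⊢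
  linear_combination this

theorem qMult_pieri2 (lam : Weight) (a b : ℤ) :
    qMult lam (a, b - 1) + qMult lam (a - 2, b + 1) + qMult lam (a + 2, b - 1) +
        qMult lam (a, b + 1) =
      qMult (lam.1, lam.2 + 1) (a, b) + qMult (lam.1 + 2, lam.2 - 1) (a, b) +
        qMult (lam.1 - 2, lam.2 + 1) (a, b) + qMult (lam.1, lam.2 - 1) (a, b) := by
  have := altSum_pieri2 kpf (lam.1 + 1) (lam.2 + 1) (a + 1) (b + 1)
  simp only [qMult]
  ring_nf at this ⊢
  linear_combination this

theorem qMult_self (lam : DomWeight) : qMult lam.toWeight lam.toWeight = 1 := by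
  obtain ⟨a, b⟩ := lam
  simp only [qMult, altSum, DomWeight.toWeight]
  rw [sub_self, sub_self, kpf_zero, kpf_eq_zero (by omega), kpf_eq_zero (by omega),
    kpf_eq_zero (by omega), kpf_eq_zero (by omega), kpf_eq_zero (by omega), kpf_eq_zero (by omega),
    kpf_eq_zero (by omega)]
  ring

/-- `μ + ρ` and `λ + ρ` are strictly dominant and different, so no `w(λ + ρ) - (μ + ρ)` is zero and
the constant term of `kpf` never occurs. -/
theorem qMult_mem_posPart {lam mu : DomWeight} (h : mu ≠ lam) :
    qMult lam.toWeight mu.toWeight ∈ posPart := by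
  obtain ⟨a, b⟩ := lam
  obtain ⟨c, e⟩ := mu
  have h' : ¬ (c = a ∧ e = b) := fun h' => h (Prod.ext h'.1 h'.2)
  simp only [qMult, altSum, DomWeight.toWeight]
  refine add_mem (sub_mem (sub_mem (add_mem (add_mem (sub_mem (sub_mem ?_ ?_) ?_) ?_) ?_) ?_) ?_)
    ?_ <;> exact kpf_mem_posPart (by omega)

theorem qMult_eq_zero {lam mu : Weight}
    (h : 3 * (lam.1 + 1).natAbs + 3 * (lam.2 + 1).natAbs < mu.1 + mu.2 + 2) :
    qMult lam mu = 0 := by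
  simp only [qMult, altSum]
  rw [kpf_eq_zero (by omega), kpf_eq_zero (by omega), kpf_eq_zero (by omega),
    kpf_eq_zero (by omega), kpf_eq_zero (by omega), kpf_eq_zero (by omega), kpf_eq_zero (by omega),
    kpf_eq_zero (by omega)]
  ring

/-! ### The candidates for the Kazhdan–Lusztig elements -/

/-- The element `∑ m_λ(μ; v²) H_μ` of the spherical Hecke algebra, the sum over dominant `μ`. -/
noncomputable def lusztigElt (lam : Weight) : Sph :=
  Finsupp.onFinset
    (Finset.range (3 * (lam.1 + 1).natAbs + 3 * (lam.2 + 1).natAbs) ×ˢ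
      Finset.range (3 * (lam.1 + 1).natAbs + 3 * (lam.2 + 1).natAbs))
    (fun mu => qMult lam mu.toWeight) (by
      rintro ⟨a, b⟩ h
      by_contra hne
      apply h
      apply qMult_eq_zero
      simp only [Finset.mem_product, Finset.mem_range, not_and_or, not_lt] at hne
      simp only [DomWeight.toWeight]
      omega)

theorem lusztigElt_apply (lam : Weight) (mu : DomWeight) :
    lusztigElt lam mu = qMult lam mu.toWeight := rfl

/-- The function `mu ↦ v^{3a+4b+4} m_λ(mu; v²)` at `mu = (a, b)`. -/
noncomputable def multFun (lam mu : Weight) : ℤ[T;T⁻¹] :=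
  T (3 * mu.1 + 4 * mu.2 + 4) * qMult lam mu

theorem sphFun_lusztigElt (lam mu : Weight) :
    sphFun (lusztigElt lam) mu = multFun lam (domRep mu).toWeight := by
  rw [sphFun, lusztigElt_apply, multFun, maxLen_eq, mul_comm]
  congr 2

theorem sphFun_weylAct (b : Sph) (w : weylGroup) (mu : Weight) :
    sphFun b (weylAct w mu) = sphFun b mu := by
  rw [sphFun, sphFun, domRep_weylAct]

theorem sphFun_s1 (b : Sph) (x y : ℤ) : sphFun b (-x, x + y) = sphFun b (x, y) := by
  rw [← weylAct_s1, sphFun_weylAct]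

theorem sphFun_s2 (b : Sph) (x y : ℤ) : sphFun b (x + 2 * y, -y) = sphFun b (x, y) := by
  rw [← weylAct_s2, sphFun_weylAct]

theorem sphFun_of_nonneg (lam : Weight) {a b : ℤ} (ha : 0 ≤ a) (hb : 0 ≤ b) :
    sphFun (lusztigElt lam) (a, b) = multFun lam (a, b) := by
  rw [sphFun_lusztigElt, domRep_of_nonneg ha hb]
  simp [DomWeight.toWeight, ha, hb]

/-- Passing from `(-1, m)` to `(1, m - 1)` raises the exponent `3a + 4b + 4` by `2`, which absorbs
the factor `v²`. Thus `multFun` is symmetric across the wall as far as one step outside the chamber.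
-/
theorem multFun_fst_eq_neg_one (lam : Weight) (m : ℤ) :
    multFun lam (-1, m) = multFun lam (1, m - 1) := by
  rw [multFun, multFun, qMult_fst_eq_neg_one, ← mul_assoc, ← T_add]
  congr 2
  ring

theorem multFun_snd_eq_neg_one (lam : Weight) (n : ℤ) :
    multFun lam (n, -1) = multFun lam (n - 2, 1) := by
  rw [multFun, multFun, qMult_snd_eq_neg_one, ← mul_assoc, ← T_add]
  congr 2
  ring

theorem sphFun_neg_one_one (lam : Weight) :
    sphFun (lusztigElt lam) (-1, 1) = multFun lam (-1, 1) := by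
  rw [multFun_fst_eq_neg_one, ← sphFun_of_nonneg _ (by norm_num) (by norm_num)]
  exact sphFun_s1 _ 1 0

theorem sphFun_one_neg_one (lam : Weight) :
    sphFun (lusztigElt lam) (1, -1) = multFun lam (1, -1) := by
  have h := sphFun_s2 (lusztigElt lam) (-1) 1
  rw [sphFun_neg_one_one] at h
  rw [multFun_snd_eq_neg_one]
  norm_num at h ⊢
  exact h

theorem sphFun_fst_neg_one (lam : Weight) {b : ℤ} (hb : 0 ≤ b) :
    sphFun (lusztigElt lam) (-1, b) = multFun lam (-1, b) := by
  rw [multFun_fst_eq_neg_one]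
  have := sphFun_s1 (lusztigElt lam) 1 (b - 1)
  rw [add_sub_cancel] at this
  rw [this]
  rcases hb.eq_or_lt with rfl | hb
  · exact sphFun_one_neg_one lam
  · exact sphFun_of_nonneg _ (by norm_num) (by omega)

theorem sphFun_snd_neg_one (lam : Weight) {a : ℤ} (ha : 1 ≤ a) :
    sphFun (lusztigElt lam) (a, -1) = multFun lam (a, -1) := by
  rw [multFun_snd_eq_neg_one]
  have := sphFun_s2 (lusztigElt lam) (a - 2) 1
  rw [show a - 2 + 2 * 1 = a by ring] at this
  rw [this]
  by_cases h : a = 1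
  · subst h
    exact sphFun_neg_one_one lam
  · exact sphFun_of_nonneg _ (by omega) (by norm_num)

/-- The Pieri rules at a dominant weight involve neighbours that may lie just outside the chamber.
There the `W`-invariant function `sphFun` still agrees with the formula `multFun`. The point `(0,
-1)` is left out: its mirror image `(-2, 1)` is again outside this region. -/
theorem sphFun_of_neg_one_le (lam : Weight) {a b : ℤ}
    (h : (0 ≤ a ∧ 0 ≤ b) ∨ (a = -1 ∧ 0 ≤ b) ∨ (1 ≤ a ∧ b = -1)) :
    sphFun (lusztigElt lam) (a, b) = multFun lam (a, b) := by
  rcases h with ⟨ha, hb⟩ | ⟨rfl, hb⟩ | ⟨ha, rfl⟩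
  · exact sphFun_of_nonneg lam ha hb
  · exact sphFun_fst_neg_one lam hb
  · exact sphFun_snd_neg_one lam ha

theorem multFun_smul_T (lam : Weight) (a b : ℤ) {n c d : ℤ} (h : n + (3 * c + 4 * d + 4) = 3 * a + 4 * b + 4) :
    T n * multFun lam (c, d) = T (3 * a + 4 * b + 4) * qMult lam (c, d) := by
  rw [multFun, ← mul_assoc, ← T_add, h]

/-! ### Pieri formulas -/

theorem sphFun_add (b c : Sph) (mu : Weight) : sphFun (b + c) mu = sphFun b mu + sphFun c mu := by
  simp only [sphFun, Finsupp.add_apply, add_mul]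

theorem sphFun_smul (r : ℤ[T;T⁻¹]) (c : Sph) (mu : Weight) :
    sphFun (r • c) mu = r * sphFun c mu := by
  simp only [sphFun, Finsupp.smul_apply, smul_eq_mul, mul_assoc]

/-- The four terms of the symmetrization evaluate `sphFun` at the four weights `μ - ν`, with `ν` a
weight of the representation of highest weight `ϖ₁`. Their factors `v^{±3}, v^{±1}` compensate for
the change of the exponent `3a + 4b + 4`, so `qMult_pieri1` can transfer the shifts to `λ`. -/
theorem heckeSym_heckeOmega_lusztigElt (lam : Weight) :
    heckeSym 1 2 (heckeOmega (sphToHecke (lusztigElt lam))) =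
      sphToHecke (lusztigElt (lam.1 + 1, lam.2) + lusztigElt (lam.1 - 1, lam.2 + 1) +
        lusztigElt (lam.1 + 1, lam.2 - 1) + lusztigElt (lam.1 - 1, lam.2)) := by
  have he : IsEigen 2 (heckeOmega (sphToHecke (lusztigElt lam))) :=
    (isEigen_sphToHecke (lusztigElt lam)).2.heckeOmega
  refine IsRep.eq_of_dominant ((isRep_sphToHecke (lusztigElt lam)).heckeOmega.heckeSym he)
    (isRep_sphToHecke _) (isEigen_heckeSym_left _ _ _) (isEigen_heckeSym_right heckeL_braid he)
    (isEigen_sphToHecke _).1 (isEigen_sphToHecke _).2 ?_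
  rintro ⟨a, b⟩
  have ha : (0 : ℤ) ≤ a := Int.natCast_nonneg a
  have hb : (0 : ℤ) ≤ b := Int.natCast_nonneg b
  change _ = sphFun _ ((a : ℤ), (b : ℤ))
  simp only [DomWeight.toWeight]
  generalize (a : ℤ) = a at ha ⊢
  generalize (b : ℤ) = b at hb ⊢
  rw [sym_one_two_apply _ ha hb]
  have e1 : sphFun (lusztigElt lam) (wtOmega (a, b)) = sphFun (lusztigElt lam) (a - 1, b) := by
    rw [← sphFun_s1 _ (a - 1) b, ← sphFun_s2 _ (-(a - 1)) (a - 1 + b),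
      ← sphFun_s1 _ _ (-(a - 1 + b))]
    congr 1
    simp only [wtOmega]
    ext <;> dsimp only <;> ring
  have e2 : sphFun (lusztigElt lam) (wtOmega (-a, a + b))
      = sphFun (lusztigElt lam) (a + 1, b - 1) := by
    rw [← sphFun_s2 _ (a + 1) (b - 1), ← sphFun_s1 _ _ (-(b - 1))]
    congr 1
    simp only [wtOmega]
    ext <;> dsimp only <;> ring
  have e3 : sphFun (lusztigElt lam) (wtOmega (-a - 2 * b, a + b))
      = sphFun (lusztigElt lam) (a - 1, b + 1) := by
    rw [← sphFun_s1 _ (a - 1) (b + 1)]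
    congr 1
    simp only [wtOmega]
    ext <;> dsimp only <;> ring
  have e4 : sphFun (lusztigElt lam) (wtOmega (-a - 2 * b, b))
      = sphFun (lusztigElt lam) (a + 1, b) := by
    congr 1
    simp only [wtOmega]
    ext <;> dsimp only <;> ring
  rw [e1, e2, e3, e4, sphFun_of_neg_one_le lam (by omega), sphFun_of_neg_one_le lam (by omega),
    sphFun_of_neg_one_le lam (by omega), sphFun_of_neg_one_le lam (by omega),
    multFun_smul_T lam a b (by ring), multFun_smul_T lam a b (by ring),
    multFun_smul_T lam a b (by ring), multFun_smul_T lam a b (by ring), ← mul_add, ← mul_add,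
    ← mul_add, qMult_pieri1]
  simp only [sphFun_add, sphFun_of_nonneg _ ha hb, multFun, mul_add]

theorem wtL_zero_of_le {f : Weight → ℤ[T;T⁻¹]} {a b : ℤ} (h : a + 2 * b ≤ 1) :
    wtL 0 f (a, b) = T (-1) * f (a, 1 - a - b) := wtL_of_asc (i := 0) h

theorem wtL_zero_of_one_le {f : Weight → ℤ[T;T⁻¹]} {a b : ℤ} (h : 1 ≤ a + 2 * b) :
    wtL 0 f (a, b) = T 1 * f (a, 1 - a - b) + (T (-1) - T 1) * f (a, b) := by
  rcases h.eq_or_lt with h | h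
  · rw [wtL_zero_of_le h.ge, show 1 - a - b = b by linarith]
    ring
  · exact if_neg (by change ¬ (a + 2 * b ≤ 1); omega)

/-- The contribution of `s₀ t_μ` for `μ` dominant. -/
theorem sphFun_sub_varpi2 (lam : Weight) {a b : ℤ} (ha : 0 ≤ a) (hb : 0 ≤ b) :
    T 3 * (wtL 0 (sphFun (lusztigElt lam)) (a, b) + T 1 * sphFun (lusztigElt lam) (a, b)) =
      T (3 * a + 4 * b + 4) * qMult lam (a, b - 1) + T 2 * sphFun (lusztigElt lam) (a, b) := by
  have e : sphFun (lusztigElt lam) (a, 1 - a - b) = sphFun (lusztigElt lam) (a, b - 1) := by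
    rw [← sphFun_s2 _ a (b - 1), ← sphFun_s1 _ _ (-(b - 1)), ← sphFun_s2 _ _ (_ + -(b - 1))]
    congr 1
    ext <;> dsimp only <;> ring
  have e3 : (T 3 : ℤ[T;T⁻¹]) = T 2 * T 1 := by rw [← T_add]; norm_num
  by_cases h : 1 ≤ a + 2 * b
  · rw [wtL_zero_of_one_le h, e, sphFun_of_neg_one_le lam (a := a) (b := b - 1) (by omega),
      ← multFun_smul_T lam a b (n := 4) (by ring),
      show (T 4 : ℤ[T;T⁻¹]) = T 3 * T 1 by rw [← T_add]; norm_num, e3]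
    linear_combination (T 2 * sphFun (lusztigElt lam) (a, b)) * T_one_mul_T_neg_one
  -- For `μ = 0` the neighbour `(0, -1)` is beyond the reach of `sphFun_of_neg_one_le`. The
  -- relations across the walls of `s₂`, `s₁` and `s₂`, used in turn, express its `qMult` through
  -- the values at `(0, 0)` and `(0, 1)`.
  · obtain rfl : a = 0 := by omega
    obtain rfl : b = 0 := by omega
    have h1 := qMult_snd_eq_neg_one lam 0
    have h2 := qMult_fst_eq_neg_two lam 1
    have h3 := qMult_snd_eq_neg_one lam 2
    have hT (n : ℕ) : (T n : ℤ[T;T⁻¹]) = T 1 ^ n := by rw [T_pow, mul_one]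
    have t2 : (T 2 : ℤ[T;T⁻¹]) = T 1 ^ 2 := hT 2
    have t3 : (T 3 : ℤ[T;T⁻¹]) = T 1 ^ 3 := hT 3
    have t4 : (T 4 : ℤ[T;T⁻¹]) = T 1 ^ 4 := hT 4
    have t8 : (T 8 : ℤ[T;T⁻¹]) = T 1 ^ 8 := hT 8
    rw [wtL_zero_of_le (by omega), e, sphFun_of_neg_one_le lam (a := 0) (b := 0) (by omega)]
    have h4 : sphFun (lusztigElt lam) (0, 0 - 1) = T 8 * qMult lam (0, 1) := by
      rw [← e, sphFun_of_neg_one_le lam (by omega), multFun]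
      norm_num
    have h0 : multFun lam (0, 0) = T 4 * qMult lam (0, 0) := rfl
    have h1' : qMult lam (0, 0 - 1) = T 2 * qMult lam (-2, 1) := h1
    have h2' : qMult lam (-2, 1) = (T 2 - 1) * qMult lam (0, 0) + T 2 * qMult lam (2, -1) := h2
    have h3' : qMult lam (2, -1) = T 2 * qMult lam (0, 1) := h3
    rw [h4, h0, h1', h2', h3', show (3 * 0 + 4 * 0 + 4 : ℤ) = 4 by norm_num, t8, t4, t3, t2]
    linear_combination (T 1 ^ 10 * qMult lam (0, 1)) * T_one_mul_T_neg_one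

/-- The contribution of `s₀ t_μ` for `μ` in the `s₂`-image of the dominant chamber. -/
theorem sphFun_sub_alpha1 (lam : Weight) {a b : ℤ} (ha : 0 ≤ a) (hb : 0 ≤ b) :
    T 1 * (wtL 0 (sphFun (lusztigElt lam)) (a + 2 * b, -b) +
        T 1 * sphFun (lusztigElt lam) (a + 2 * b, -b)) =
      T (3 * a + 4 * b + 4) * qMult lam (a - 2, b + 1) + sphFun (lusztigElt lam) (a, b) := by
  have e : sphFun (lusztigElt lam) (a + 2 * b, 1 - (a + 2 * b) - -b) =
      sphFun (lusztigElt lam) (a - 2, b + 1) := by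
    rw [← sphFun_s1 _ (a - 2) (b + 1), ← sphFun_s2 _ _ (a - 2 + (b + 1))]
    congr 1
    ext <;> dsimp only <;> ring
  have h5 : (T 2 : ℤ[T;T⁻¹]) = T 1 * T 1 := T_two_eq
  rw [sphFun_s2]
  by_cases h : 1 ≤ a
  · rw [wtL_zero_of_one_le (by omega), e, sphFun_s2,
      sphFun_of_neg_one_le lam (a := a - 2) (b := b + 1) (by omega),
      ← multFun_smul_T lam a b (n := 2) (by ring)]
    linear_combination (sphFun (lusztigElt lam) (a, b)) * T_one_mul_T_neg_one
      - multFun lam (a - 2, b + 1) * h5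
  -- Now `(-2, b + 1)` lies two steps outside the chamber. The term with `v² - 1` in
  -- `qMult_fst_eq_neg_two` makes up for the missing term `(v⁻¹ - v) f(μ)` of `wtL`.
  · obtain rfl : a = 0 := by omega
    have h2 := qMult_fst_eq_neg_two lam (b + 1)
    have e' := sphFun_s1 (lusztigElt lam) 2 (b - 1)
    rw [show (2 : ℤ) + (b - 1) = b + 1 by ring,
      sphFun_of_neg_one_le lam (a := 2) (b := b - 1) (by omega)] at e'
    rw [wtL_zero_of_le (by omega), e, zero_sub, e',
      sphFun_of_neg_one_le lam (a := 0) (b := b) (by omega), h2,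
      show b + 1 - 1 = b by ring, show b + 1 - 2 = b - 1 by ring, multFun, multFun]
    dsimp only
    rw [show (3 : ℤ) * 2 + 4 * (b - 1) + 4 = 3 * 0 + 4 * b + 4 + 2 by ring, T_add _ 2]
    linear_combination (T (3 * 0 + 4 * b + 4) * T 2 * qMult lam (2, b - 1)) * T_one_mul_T_neg_one
      - T (3 * 0 + 4 * b + 4) * qMult lam (0, b) * h5

/-- The counterpart for `ϖ₂`, whose representation has the zero weight besides the orbit of `ϖ₂`.
The four terms of the symmetrization return `v², 1, 1, v⁻²` times the original element; the shifts
by the orbit are transferred to `λ` by `qMult_pieri2`. -/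
theorem heckeSym_heckeB_lusztigElt (lam : Weight) :
    heckeSym 2 1 (heckeB 0 (sphToHecke (lusztigElt lam))) =
      sphToHecke (lusztigElt (lam.1, lam.2 + 1) + lusztigElt (lam.1 + 2, lam.2 - 1) +
        lusztigElt (lam.1 - 2, lam.2 + 1) + lusztigElt (lam.1, lam.2 - 1) +
        (T 2 + 2 + T (-2) : ℤ[T;T⁻¹]) • lusztigElt lam) := by
  have he : IsEigen 1 (heckeB 0 (sphToHecke (lusztigElt lam))) :=
    (isEigen_sphToHecke (lusztigElt lam)).1.heckeB_zero
  have hr : IsRep (heckeB 0 (sphToHecke (lusztigElt lam))) _ :=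
    ((isRep_sphToHecke (lusztigElt lam)).heckeL 0).add ((isRep_sphToHecke (lusztigElt lam)).smul _)
  refine IsRep.eq_of_dominant (hr.heckeSym he) (isRep_sphToHecke _)
    (isEigen_heckeSym_right (fun h => (heckeL_braid h).symm) he) (isEigen_heckeSym_left _ _ _)
    (isEigen_sphToHecke _).1 (isEigen_sphToHecke _).2 ?_
  rintro ⟨a, b⟩
  have ha : (0 : ℤ) ≤ a := Int.natCast_nonneg a
  have hb : (0 : ℤ) ≤ b := Int.natCast_nonneg b
  change _ = sphFun _ ((a : ℤ), (b : ℤ))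
  simp only [DomWeight.toWeight]
  generalize (a : ℤ) = a at ha ⊢
  generalize (b : ℤ) = b at hb ⊢
  rw [sym_two_one_apply _ ha hb]
  simp only [Pi.add_apply, Pi.smul_apply, smul_eq_mul]
  rw [sphFun_sub_varpi2 lam ha hb, sphFun_sub_alpha1 lam ha hb, wtL_zero_of_le (by omega),
    wtL_zero_of_le (by omega)]
  have e1 : sphFun (lusztigElt lam) (a + 2 * b, 1 - (a + 2 * b) - (-a - b)) =
      sphFun (lusztigElt lam) (a + 2, b - 1) := by
    rw [← sphFun_s2 _ (a + 2) (b - 1)]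
    congr 1
    ext <;> dsimp only <;> ring
  have e2 : sphFun (lusztigElt lam) (a, 1 - a - (-a - b)) =
      sphFun (lusztigElt lam) (a, b + 1) := by
    congr 1
    ext <;> dsimp only <;> ring
  have e3 : sphFun (lusztigElt lam) (a + 2 * b, -a - b) = sphFun (lusztigElt lam) (a, b) := by
    rw [← sphFun_s1 _ a b, ← sphFun_s2 _ (-a) (a + b)]
    congr 1
    ext <;> dsimp only <;> ring
  have e4 : sphFun (lusztigElt lam) (a, -a - b) = sphFun (lusztigElt lam) (a, b) := by
    rw [← sphFun_s2 _ a b, ← sphFun_s1 _ _ (-b), ← sphFun_s2 _ _ (_ + -b)]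
    congr 1
    ext <;> dsimp only <;> ring
  rw [e1, e2, e3, e4, sphFun_of_neg_one_le lam (a := a + 2) (by omega),
    sphFun_of_neg_one_le lam (b := b + 1) (by omega)]
  have m1 := multFun_smul_T lam a b (n := -2) (c := a + 2) (d := b - 1) (by ring)
  have m2 := multFun_smul_T lam a b (n := -4) (c := a) (d := b + 1) (by ring)
  have t2 : (T (-2) : ℤ[T;T⁻¹]) = T (-1) * T (-1) := by rw [← T_add]; norm_num
  have t3 : (T (-3) : ℤ[T;T⁻¹]) = T (-1) * T (-1) * T (-1) := by simp only [← T_add]; norm_num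
  have t4 : (T (-4) : ℤ[T;T⁻¹]) = T (-1) * T (-1) * T (-1) * T (-1) := by
    simp only [← T_add]; norm_num
  have p := qMult_pieri2 lam a b
  rw [t2] at m1
  rw [t4] at m2
  simp only [sphFun_add, sphFun_smul, sphFun_of_nonneg _ ha hb, multFun]
  simp only [multFun] at m1 m2
  rw [t3, t2]
  linear_combination m1 + m2 + T (3 * a + 4 * b + 4) * p +
    (T (3 * a + 4 * b + 4) * qMult lam (a, b) * (1 + T (-1) * T (-1))) * T_one_mul_T_neg_one

/-! ### Bar invariance -/

/-- The bar-invariant elements of the spherical Hecke algebra. -/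
noncomputable def barInvariant : AddSubgroup Sph where
  carrier := {b | bar (sphToHecke b) = sphToHecke b}
  zero_mem' := by
    change bar (sphToHecke 0) = sphToHecke 0
    rw [sphToHecke_zero, bar_zero]
  add_mem' := fun {b c} hb hc => by
    change bar (sphToHecke (b + c)) = sphToHecke (b + c)
    rw [sphToHecke_add, bar_add, hb, hc]
  neg_mem' := fun {b} hb => by
    change bar (sphToHecke (-b)) = sphToHecke (-b)
    rw [← zero_sub, sphToHecke_sub, bar_sub, hb, sphToHecke_zero, bar_zero]

theorem smul_mem_barInvariant {f : ℤ[T;T⁻¹]} (hf : invert f = f) {b : Sph}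
    (hb : b ∈ barInvariant) : f • b ∈ barInvariant := by
  change bar (sphToHecke (f • b)) = sphToHecke (f • b)
  rw [sphToHecke_smul, bar_smul, hf]
  exact congrArg _ hb

theorem lusztigElt_neg_one_left (m : ℤ) : lusztigElt (-1, m) = 0 := by
  ext1 mu
  rw [lusztigElt_apply, qMult_neg_one_left, Finsupp.zero_apply]

theorem lusztigElt_neg_one_right (n : ℤ) : lusztigElt (n, -1) = 0 := by
  ext1 mu
  rw [lusztigElt_apply, qMult_neg_one_right, Finsupp.zero_apply]

theorem lusztigElt_neg_two_left (m : ℤ) : lusztigElt (-2, m) = -lusztigElt (0, m - 1) := by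
  ext1 mu
  rw [lusztigElt_apply, qMult_neg_two_left, Finsupp.neg_apply, lusztigElt_apply]

theorem lusztigElt_zero : lusztigElt (0, 0) = Finsupp.single (0, 0) 1 := by
  ext1 mu
  rw [lusztigElt_apply]
  by_cases h : mu = (0, 0)
  · subst h
    rw [Finsupp.single_eq_same]
    exact qMult_self (0, 0)
  · rw [Finsupp.single_eq_of_ne h]
    obtain ⟨c, e⟩ := mu
    have h' : ¬ (c = 0 ∧ e = 0) := fun h' => h (Prod.ext h'.1 h'.2)
    simp only [qMult, altSum, DomWeight.toWeight]
    rw [kpf_eq_zero (by omega), kpf_eq_zero (by omega), kpf_eq_zero (by omega),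
      kpf_eq_zero (by omega), kpf_eq_zero (by omega), kpf_eq_zero (by omega),
      kpf_eq_zero (by omega), kpf_eq_zero (by omega)]
    ring

theorem pieri1_mem_barInvariant {lam : Weight} (h : lusztigElt lam ∈ barInvariant) :
    lusztigElt (lam.1 + 1, lam.2) + lusztigElt (lam.1 - 1, lam.2 + 1) +
      lusztigElt (lam.1 + 1, lam.2 - 1) + lusztigElt (lam.1 - 1, lam.2) ∈ barInvariant := by
  change bar (sphToHecke _) = sphToHecke _
  rw [← heckeSym_heckeOmega_lusztigElt, bar_heckeSym]
  rw [bar_heckeOmega, h]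

theorem pieri2_mem_barInvariant {lam : Weight} (h : lusztigElt lam ∈ barInvariant) :
    lusztigElt (lam.1, lam.2 + 1) + lusztigElt (lam.1 + 2, lam.2 - 1) +
        lusztigElt (lam.1 - 2, lam.2 + 1) + lusztigElt (lam.1, lam.2 - 1) ∈ barInvariant := by
  have h1 : lusztigElt (lam.1, lam.2 + 1) + lusztigElt (lam.1 + 2, lam.2 - 1) +
        lusztigElt (lam.1 - 2, lam.2 + 1) + lusztigElt (lam.1, lam.2 - 1) +
        (T 2 + 2 + T (-2) : ℤ[T;T⁻¹]) • lusztigElt lam ∈ barInvariant := by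
    change bar (sphToHecke _) = sphToHecke _
    rw [← heckeSym_heckeB_lusztigElt, bar_heckeSym]
    rw [bar_heckeB, h]
  have h2 : (T 2 + 2 + T (-2) : ℤ[T;T⁻¹]) • lusztigElt lam ∈ barInvariant := by
    apply smul_mem_barInvariant _ h
    rw [map_add, map_add, invert_T, invert_T, map_ofNat, neg_neg]
    ring
  exact (add_mem_cancel_right h2).mp h1

/-- The rule for `ϖ₁` at `(n, m)` produces `(n + 1, m)`, the other three terms having coordinate sum
at most `n + m`; terms with a coordinate `-1` vanish. This reaches every weight with positive first
coordinate. The weight `(0, s + 1)` comes from the rule for `ϖ₂` at `(0, s)`: there `(2, s - 1)` has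
just been reached and `(-2, s + 1)` gives minus the element of `(0, s)`. -/
theorem lusztigElt_mem_barInvariant_of_le (s : ℕ) :
    ∀ n m : ℕ, n + m ≤ s → lusztigElt (n, m) ∈ barInvariant := by
  induction s with
  | zero =>
    intro n m h
    obtain rfl : n = 0 := by omega
    obtain rfl : m = 0 := by omega
    have : lusztigElt (((0 : ℕ) : ℤ), ((0 : ℕ) : ℤ)) = Finsupp.single (0, 0) 1 := lusztigElt_zero
    rw [this]
    exact bar_sphToHecke_single_zero
  | succ s ih =>
    have ih' : ∀ n m : ℤ, -1 ≤ n → -1 ≤ m → n + m ≤ s → lusztigElt (n, m) ∈ barInvariant := by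
      intro n m hn hm h
      rcases hn.eq_or_lt with rfl | hn
      · rw [lusztigElt_neg_one_left]
        exact zero_mem _
      rcases hm.eq_or_lt with rfl | hm
      · rw [lusztigElt_neg_one_right]
        exact zero_mem _
      have := ih n.toNat m.toNat (by omega)
      rwa [Int.toNat_of_nonneg (by omega), Int.toNat_of_nonneg (by omega)] at this
    have first : ∀ n m : ℤ, 0 ≤ n → 0 ≤ m → n + m ≤ s →
        lusztigElt (n + 1, m) ∈ barInvariant := by
      intro n m hn hm h
      have h0 := pieri1_mem_barInvariant (ih' n m (by omega) (by omega) h)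
      dsimp only at h0
      rw [add_mem_cancel_right (ih' _ _ (by omega) (by omega) (by omega)),
        add_mem_cancel_right (ih' _ _ (by omega) (by omega) (by omega)),
        add_mem_cancel_right (ih' _ _ (by omega) (by omega) (by omega))] at h0
      exact h0
    intro n m h
    rcases Nat.lt_or_ge (n + m) (s + 1) with h1 | h1
    · exact ih n m (by omega)
    rcases Nat.eq_zero_or_pos n with rfl | hn
    · obtain rfl : m = s + 1 := by omega
      have h0 := pieri2_mem_barInvariant (ih' 0 s (by omega) (by omega) (by omega))
      dsimp only at h0
      rw [zero_sub, lusztigElt_neg_two_left, zero_add, add_sub_cancel_right] at h0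
      have h2 : lusztigElt (2, (s : ℤ) - 1) ∈ barInvariant := by
        rcases Nat.eq_zero_or_pos s with rfl | hs
        · rw [Nat.cast_zero, zero_sub, lusztigElt_neg_one_right]
          exact zero_mem _
        · exact first 1 (s - 1) (by omega) (by omega) (by omega)
      rw [add_mem_cancel_right (ih' _ _ (by omega) (by omega) (by omega)),
        add_mem_cancel_right (neg_mem (ih' _ _ (by omega) (by omega) (by omega))),
        add_mem_cancel_right h2] at h0
      exact_mod_cast h0
    · have := first (n - 1) m (by omega) (by omega) (by omega)
      rwa [sub_add_cancel] at this

theorem isKL_lusztigElt (lam : DomWeight) : IsKL lam (lusztigElt lam.toWeight) :=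
  ⟨lusztigElt_mem_barInvariant_of_le _ lam.1 lam.2 le_rfl, qMult_self lam,
    fun _ h => qMult_mem_posPart h⟩

/-! ### The Kazhdan–Lusztig basis -/

theorem klDom_eq_lusztigElt (lam : DomWeight) : klDom lam = lusztigElt lam.toWeight :=
  klDom_eq (isKL_lusztigElt lam)

/-- A strictly dominant weight has trivial stabilizer and is the only dominant weight of its orbit.
Hence the choice made in `kl` is forced at dominant weights. -/
theorem dotAct_eq_toWeight {w : weylGroup} {lam mu : DomWeight}
    (h : dotAct w lam.toWeight = mu.toWeight) : w = 1 ∧ mu = lam := by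
  obtain ⟨a, b⟩ := lam
  obtain ⟨c, e⟩ := mu
  have h1 : weylAct w ((a : ℤ) + 1, (b : ℤ) + 1) = ((c : ℤ) + 1, (e : ℤ) + 1) :=
    sub_eq_iff_eq_add.mp h
  rcases weyl_cases w with hw | hw | hw | hw | hw | hw | hw | hw <;> subst hw <;>
    simp only [weylAct_mul, weylAct_one, weylAct_s1, weylAct_s2, Prod.mk.injEq] at h1
  · refine ⟨rfl, Prod.ext ?_ ?_⟩ <;> dsimp only <;> omega
  all_goals omega

theorem kl_toWeight (lam : DomWeight) : kl lam.toWeight = lusztigElt lam.toWeight := by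
  have h : ∃ p : weylGroup × DomWeight, dotAct p.1 lam.toWeight = p.2.toWeight :=
    ⟨(1, lam), by simp [dotAct]⟩
  rw [kl, dif_pos h]
  obtain ⟨h1, h2⟩ := dotAct_eq_toWeight h.choose_spec
  rw [h1, h2, klDom_eq_lusztigElt, ofWeyl_one]
  have : len 1 = 0 := by rw [len_eq_ptLen, alcovePt_one]; rfl
  rw [this, pow_zero, one_smul]

theorem kl_neg_one (m : ℤ) : kl (-1, m) = 0 := by
  rw [kl, dif_neg]
  rintro ⟨⟨w, ⟨c, e⟩⟩, h⟩
  have h1 : weylAct w ((-1, m) + rho) = ((c : ℤ) + 1, (e : ℤ) + 1) := sub_eq_iff_eq_add.mp h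
  have h2 : ((-1, m) + rho : Weight) = (0, m + 1) := rfl
  rw [h2] at h1
  rcases weyl_cases w with hw | hw | hw | hw | hw | hw | hw | hw <;> subst hw <;>
    simp only [weylAct_mul, weylAct_one, weylAct_s1, weylAct_s2, Prod.mk.injEq] at h1 <;> omega

/-! ### Multiplicities at `v = 1` -/

section
variable {R : Type*} [CommRing R]

/-- The difference operator `F ↦ F(μ) - t F(μ - α)` for `α = (r, s)`. -/
def rootDiff (t : R) (r s : ℤ) (F : ℤ → ℤ → R) (x y : ℤ) : R := F x y - t * F (x - r) (y - s)

theorem altSum_rootDiff (t : R) (r s : ℤ) (F : ℤ → ℤ → R) (a b c e : ℤ) :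
    altSum (rootDiff t r s F) a b c e =
      altSum F a b c e - t * altSum F a b (c + r) (e + s) := by
  simp only [altSum, rootDiff, sub_sub]
  ring_nf

end

/-- The roots are removed from the partition function one at a time, each by a telescoping sum.
After all four only the empty partition is left. -/
theorem rootDiff_kpf_alpha1_alpha2 {x y : ℤ} {N : ℕ} (hN : x.natAbs + 2 * y.natAbs + 10 < N) :
    rootDiff (T 2) (-2) 2 (rootDiff (T 2) 2 (-1) kpf) x y =
      ∑ i ∈ Finset.range N, ∑ j ∈ Finset.range N, kpfTerm x y i j 0 0 := by
  have h (x y : ℤ) : rootDiff (T 2) 2 (-1) kpf x y = kpf x y - T 2 * kpf (x - 2) (y + 1) := by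
    rw [rootDiff, sub_neg_eq_add]
  rw [rootDiff, h, h, kpf_sub_alpha1 (N := N) (by omega), kpf_sub_alpha1 (N := N) (by omega)]
  simp only [Finset.mul_sum (s := Finset.range N), ← Finset.sum_sub_distrib]
  refine Finset.sum_congr rfl fun i _ => Finset.sum_congr rfl fun j _ => ?_
  rw [Finset.sum_sub_distrib, ← Finset.mul_sum]
  apply sum_range_sub_mul_sum_range (f := fun l => kpfTerm x y i j 0 l)
  · intro l
    simp only [kpfTerm]
    by_cases hc : 2 * (j : ℤ) + 2 * (0 : ℕ) - 2 * l = x - -2 ∧ (i : ℤ) - (0 : ℕ) + 2 * l = y - 2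
    · rw [if_pos hc, if_pos (by push_cast; omega), ← T_add]
      congr 1
      push_cast
      ring
    · rw [if_neg hc, if_neg (by push_cast; omega), mul_zero]
  · rw [kpfTerm, if_neg]
    omega

theorem rootDiff_kpf_three {x y : ℤ} {N : ℕ} (hN : x.natAbs + 2 * y.natAbs + 12 < N) :
    rootDiff (T 2) 0 1 (rootDiff (T 2) (-2) 2 (rootDiff (T 2) 2 (-1) kpf)) x y =
      ∑ j ∈ Finset.range N, kpfTerm x y 0 j 0 0 := by
  rw [rootDiff, rootDiff_kpf_alpha1_alpha2 (N := N) (by omega),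
    rootDiff_kpf_alpha1_alpha2 (N := N) (by omega),
    Finset.sum_comm (f := fun i j => kpfTerm x y i j 0 0),
    Finset.sum_comm (f := fun i j => kpfTerm (x - 0) (y - 1) i j 0 0)]
  simp only [Finset.mul_sum (s := Finset.range N), ← Finset.sum_sub_distrib]
  refine Finset.sum_congr rfl fun j _ => ?_
  rw [Finset.sum_sub_distrib, ← Finset.mul_sum]
  apply sum_range_sub_mul_sum_range (f := fun i => kpfTerm x y i j 0 0)
  · intro i
    simp only [kpfTerm]
    by_cases hc : 2 * (j : ℤ) + 2 * (0 : ℕ) - 2 * (0 : ℕ) = x - 0 ∧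
        (i : ℤ) - (0 : ℕ) + 2 * (0 : ℕ) = y - 1
    · rw [if_pos hc, if_pos (by push_cast; omega), ← T_add]
      congr 1
      push_cast
      ring
    · rw [if_neg hc, if_neg (by push_cast; omega), mul_zero]
  · rw [kpfTerm, if_neg]
    omega

/-- Kostant's partition function inverts the product of the difference operators of the positive
roots. -/
theorem rootDiff_kpf (x y : ℤ) :
    rootDiff (T 2) 2 0 (rootDiff (T 2) 0 1 (rootDiff (T 2) (-2) 2 (rootDiff (T 2) 2 (-1) kpf))) x y =
      if x = 0 ∧ y = 0 then 1 else 0 := by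
  obtain ⟨N, hN⟩ : ∃ N, x.natAbs + 2 * y.natAbs + 14 < N := ⟨_, Nat.lt_succ_self _⟩
  rw [rootDiff, rootDiff_kpf_three (N := N) (by omega), rootDiff_kpf_three (N := N) (by omega),
    sum_range_sub_mul_sum_range (f := fun j => kpfTerm x y 0 j 0 0)]
  · simp only [kpfTerm, CharP.cast_eq_zero, mul_zero, add_zero, sub_zero, T_zero, eq_comm]
  · intro j
    simp only [kpfTerm]
    by_cases hc : 2 * (j : ℤ) + 2 * (0 : ℕ) - 2 * (0 : ℕ) = x - 2 ∧
        ((0 : ℕ) : ℤ) - (0 : ℕ) + 2 * (0 : ℕ) = y - 0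
    · rw [if_pos hc, if_pos (by push_cast; omega), ← T_add]
      congr 1
      push_cast
      ring
    · rw [if_neg hc, if_neg (by push_cast; omega), mul_zero]
  · rw [kpfTerm, if_neg]
    omega

/-- The specialization `v = 1` of Laurent polynomials. -/
noncomputable def atOne : ℤ[T;T⁻¹] →+* ℤ := LaurentPolynomial.eval₂ (RingHom.id ℤ) (1 : ℤˣ)

theorem atOne_T (n : ℤ) : atOne (T n) = 1 := by
  simp [atOne]

/-- The difference operator `f ↦ f(μ) - f(μ + α)`. -/
def wtDiff (al : Weight) (f : Weight → ℤ) (mu : Weight) : ℤ := f mu - f (mu + al)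

theorem wtDiff_atOne_altSum (r s : ℤ) (F : ℤ → ℤ → ℤ[T;T⁻¹]) (lam : Weight) :
    wtDiff (r, s) (fun mu => atOne (altSum F (lam.1 + 1) (lam.2 + 1) (mu.1 + 1) (mu.2 + 1))) =
      fun mu => atOne (altSum (rootDiff (T 2) r s F) (lam.1 + 1) (lam.2 + 1)
        (mu.1 + 1) (mu.2 + 1)) := by
  funext mu
  rw [altSum_rootDiff, map_sub, map_mul, atOne_T, one_mul, wtDiff]
  simp only [Prod.fst_add, Prod.snd_add, add_right_comm]

/-- The weight multiplicity at `v = 1`. -/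
noncomputable def mult (lam mu : Weight) : ℤ := atOne (qMult lam mu)

theorem wtDiff_mult (lam mu : Weight) :
    wtDiff (2, 0) (wtDiff (0, 1) (wtDiff (-2, 2) (wtDiff (2, -1) (mult lam)))) mu =
      altSum (fun x y => if x = 0 ∧ y = 0 then 1 else 0) (lam.1 + 1) (lam.2 + 1)
        (mu.1 + 1) (mu.2 + 1) := by
  have h : mult lam =
      fun mu => atOne (altSum kpf (lam.1 + 1) (lam.2 + 1) (mu.1 + 1) (mu.2 + 1)) := rfl
  rw [h, wtDiff_atOne_altSum, wtDiff_atOne_altSum, wtDiff_atOne_altSum, wtDiff_atOne_altSum]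
  simp only [altSum, rootDiff_kpf, map_add, map_sub, apply_ite atOne, map_one, map_zero]

/-- `f` vanishes at all weights that are sufficiently positive. -/
def IsBdd (f : Weight → ℤ) : Prop := ∃ M : ℤ, ∀ mu : Weight, M < 3 * mu.1 + 4 * mu.2 → f mu = 0

theorem IsBdd.sub {f g : Weight → ℤ} (hf : IsBdd f) (hg : IsBdd g) : IsBdd (f - g) := by
  obtain ⟨M, hM⟩ := hf
  obtain ⟨N, hN⟩ := hg
  refine ⟨max M N, fun mu h => ?_⟩
  rw [Pi.sub_apply, hM mu (by omega), hN mu (by omega), sub_zero]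

theorem IsBdd.wtDiff {f : Weight → ℤ} (hf : IsBdd f) {al : Weight}
    (hal : 0 < 3 * al.1 + 4 * al.2) : IsBdd (wtDiff al f) := by
  obtain ⟨M, hM⟩ := hf
  refine ⟨M, fun mu h => ?_⟩
  rw [TypeC2.wtDiff, hM mu h, hM, sub_zero]
  simp only [Prod.fst_add, Prod.snd_add]
  omega

/-- The equation `f(μ) = f(μ + α)` can be iterated, and each step increases `3μ₁ + 4μ₂` until `f`
vanishes. This linear form is the pairing with the sum of the positive coroots, hence positive on
all positive roots. -/
theorem IsBdd.eq_zero_of_wtDiff {f : Weight → ℤ} (hf : IsBdd f) {al : Weight}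
    (hal : 0 < 3 * al.1 + 4 * al.2) (h : TypeC2.wtDiff al f = 0) : f = 0 := by
  obtain ⟨M, hM⟩ := hf
  have key (n : ℕ) : ∀ mu : Weight, M < 3 * mu.1 + 4 * mu.2 + n → f mu = 0 := by
    induction n with
    | zero => intro mu h; exact hM mu (by simpa using h)
    | succ n ih =>
      intro mu hmu
      have := congrFun h mu
      rw [TypeC2.wtDiff, Pi.zero_apply, sub_eq_zero] at this
      rw [this]
      apply ih
      simp only [Prod.fst_add, Prod.snd_add]
      push_cast at hmu
      omega
  funext mu
  exact key (M - 3 * mu.1 - 4 * mu.2 + 1).toNat mu (by omega)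

theorem wtDiff_sub (al : Weight) (f g : Weight → ℤ) :
    wtDiff al (f - g) = wtDiff al f - wtDiff al g := by
  funext mu
  simp only [wtDiff, Pi.sub_apply]
  ring

theorem IsBdd.eq_of_wtDiff {f g : Weight → ℤ} (hf : IsBdd f) (hg : IsBdd g) {al : Weight}
    (hal : 0 < 3 * al.1 + 4 * al.2) (h : TypeC2.wtDiff al f = TypeC2.wtDiff al g) : f = g := by
  rw [← sub_eq_zero]
  apply (hf.sub hg).eq_zero_of_wtDiff hal
  rw [wtDiff_sub, h, sub_self]

theorem isBdd_mult (lam : Weight) : IsBdd (mult lam) := by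
  refine ⟨8 * (lam.1 + 1).natAbs + 8 * (lam.2 + 1).natAbs, fun mu h => ?_⟩
  simp only [mult, qMult, altSum]
  rw [kpf_eq_zero (by omega), kpf_eq_zero (by omega), kpf_eq_zero (by omega),
    kpf_eq_zero (by omega), kpf_eq_zero (by omega), kpf_eq_zero (by omega), kpf_eq_zero (by omega),
    kpf_eq_zero (by omega)]
  simp

/-- A function with the same alternating differences as the weight multiplicities is equal to
them. -/
theorem eq_mult {lam : Weight} {f : Weight → ℤ} (hf : IsBdd f)
    (h : ∀ mu, wtDiff (2, 0) (wtDiff (0, 1) (wtDiff (-2, 2) (wtDiff (2, -1) f))) mu =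
      altSum (fun x y => if x = 0 ∧ y = 0 then 1 else 0) (lam.1 + 1) (lam.2 + 1)
        (mu.1 + 1) (mu.2 + 1)) : f = mult lam := by
  have hm := isBdd_mult lam
  have h1 := hf.wtDiff (al := (2, -1)) (by norm_num)
  have h2 := h1.wtDiff (al := (-2, 2)) (by norm_num)
  have h3 := h2.wtDiff (al := (0, 1)) (by norm_num)
  have m1 := hm.wtDiff (al := (2, -1)) (by norm_num)
  have m2 := m1.wtDiff (al := (-2, 2)) (by norm_num)
  have m3 := m2.wtDiff (al := (0, 1)) (by norm_num)
  refine hf.eq_of_wtDiff hm (al := (2, -1)) (by norm_num) ?_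
  refine h1.eq_of_wtDiff m1 (al := (-2, 2)) (by norm_num) ?_
  refine h2.eq_of_wtDiff m2 (al := (0, 1)) (by norm_num) ?_
  refine h3.eq_of_wtDiff m3 (al := (2, 0)) (by norm_num) ?_
  funext mu
  rw [h, wtDiff_mult]

/-! ### Specialization of the Kazhdan–Lusztig and pre-canonical elements at `v = 1` -/

theorem coeff_specialize (h : Sph) (mu : DomWeight) :
    (specialize h).coeff mu = atOne (h mu) := by
  classical
  rw [specialize, AddMonoidAlgebra.coeff_finsuppSum, Finsupp.sum_apply, Finsupp.sum]
  simp only [AddMonoidAlgebra.coeff_single, Finsupp.single_apply]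
  rw [Finset.sum_ite_eq' h.support mu]
  split_ifs with hmu
  · rfl
  · rw [Finsupp.notMem_support_iff.mp hmu, map_zero]

theorem specialize_sub_smul (b c : Sph) (n : ℤ) :
    specialize (b - (T n : ℤ[T;T⁻¹]) • c) = specialize b - specialize c := by
  ext mu
  rw [AddMonoidAlgebra.coeff_sub, Finsupp.sub_apply, coeff_specialize, coeff_specialize,
    coeff_specialize, Finsupp.sub_apply, Finsupp.smul_apply, smul_eq_mul, map_sub, map_mul, atOne_T,
    one_mul]

theorem coeff_specialize_kl (lam mu : DomWeight) :
    (specialize (kl lam.toWeight)).coeff mu = mult lam.toWeight mu.toWeight := by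
  rw [coeff_specialize, kl_toWeight, lusztigElt_apply, mult]

theorem precan_three (lam : Weight) :
    precan 3 lam = kl lam - (T 2 : ℤ[T;T⁻¹]) • kl (lam - (2, 0)) := by
  have h : (posRoots.filter fun m => 3 ≤ rootHeight m) = {(2, 1)} := by decide
  have h' : rootWeight (2, 1) = (2, 0) := by decide
  rw [precan, h, show ({(2, 1)} : Finset (ℕ × ℕ)) = insert (2, 1) ∅ from rfl,
    Finset.sum_powerset_insert (Finset.notMem_empty _)]
  simp [h', sub_eq_add_neg]

/-- The specialization of the modified third pre-canonical basis. -/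
theorem specialize_modPrecan3 (lam : DomWeight) :
    specialize (modPrecan3 lam) = if 2 ≤ lam.1 then
      specialize (kl lam.toWeight) - specialize (kl (DomWeight.toWeight (lam.1 - 2, lam.2)))
      else specialize (kl lam.toWeight) := by
  rw [modPrecan3, precan_three]
  split_ifs with h0 h2 h2
  · rw [specialize_sub_smul]
    congr 3
    simp only [DomWeight.toWeight]
    ext
    · simp; omega
    · simp
  -- For `λ₁ = 1` the weight `λ - 2ϖ₁ + ρ` lies on the wall of `s₁`, so the correction term is zero,
  -- in accordance with `P(λ) = B(λ)`.
  · have : lam.toWeight - (2, 0) = (-1, (lam.2 : ℤ)) := by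
      simp only [DomWeight.toWeight]
      ext
      · simp; omega
      · simp
    rw [this, kl_neg_one, smul_zero, sub_zero]
  · omega
  · rfl

/-! ### Building tableaux column by column -/

namespace Tableau

/-- Add a column of height two on the left. -/
def consCol (c : Letter × Letter) (t : Tableau) : Tableau := ⟨c.1 :: t.row1, c.2 :: t.row2⟩

/-- Add a letter on the left of the first row. -/
def consLetter (a : Letter) (t : Tableau) : Tableau := ⟨a :: t.row1, t.row2⟩

theorem split_consCol_of_eq (t : Tableau) :
    (t.consCol (l2, l2b)).split = (t.split.consCol (l2, l1b)).consCol (l1, l2b) := by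
  simp [split, consCol, List.mapIdx_cons]
  exact ⟨rfl, rfl⟩

theorem split_consCol_of_ne {c : Letter × Letter} (h : c ≠ (l2, l2b)) (t : Tableau) :
    (t.consCol c).split = (t.split.consCol c).consCol c := by
  have h' : ¬ (c.1 = l2 ∧ c.2 = l2b) := fun h' => h (Prod.ext h'.1 h'.2)
  simp [split, consCol, List.mapIdx_cons, h']
  exact ⟨rfl, rfl⟩

theorem split_of_row2_eq_nil (r : List Letter) :
    (Tableau.mk r []).split = ⟨(r.map fun a => [a, a]).flatten, []⟩ := by
  have h : (r.mapIdx fun _ a => [a, a]) = r.map fun a => [a, a] :=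
    List.ext_getElem (by simp) (by simp)
  simp [split, h]

theorem isSemistandard_consCol (c : Letter × Letter) (t : Tableau) :
    (t.consCol c).IsSemistandard ↔ c.1 < c.2 ∧ (∀ x ∈ t.row1, c.1 ≤ x) ∧ (∀ y ∈ t.row2, c.2 ≤ y) ∧
      t.IsSemistandard := by
  simp only [IsSemistandard, consCol, List.length_cons, List.pairwise_cons]
  constructor
  · rintro ⟨h1, ⟨h2, h3⟩, ⟨h4, h5⟩, h6⟩
    exact ⟨h6 0 _ _ rfl rfl, h2, h4, by omega, h3, h5, fun j a b ha hb => h6 (j + 1) a b ha hb⟩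
  · rintro ⟨h1, h2, h3, h4, h5, h6, h7⟩
    refine ⟨by omega, ⟨h2, h5⟩, ⟨h3, h6⟩, ?_⟩
    rintro (_ | j) a b ha hb
    · cases ha
      cases hb
      exact h1
    · exact h7 j a b ha hb

theorem isAdmissible_consCol (c : Letter × Letter) (t : Tableau) :
    (t.consCol c).IsAdmissible ↔ c ≠ (l1, l1b) ∧ t.IsAdmissible := by
  simp only [IsAdmissible, consCol]
  constructor
  · intro h
    refine ⟨fun hc => h 0 ?_, fun j hj => h (j + 1) hj⟩
    subst hc
    exact ⟨rfl, rfl⟩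
  · rintro ⟨h1, h2⟩ (_ | j) hj
    · exact h1 (Prod.ext (by simpa using hj.1) (by simpa using hj.2))
    · exact h2 j hj

theorem forall_mem_split_row2 (t : Tableau) (p : Letter) :
    (∀ y ∈ t.split.row2, p ≤ y) ↔ ∀ y ∈ t.row2, p ≤ y := by
  simp only [split, List.mem_flatten, List.mem_mapIdx]
  constructor
  · intro h y hy
    obtain ⟨j, hj, rfl⟩ := List.mem_iff_getElem.mp hy
    refine h _ ⟨_, ⟨j, hj, rfl⟩, ?_⟩
    split_ifs with hc
    · simp [hc.2]
    · simp
  · rintro h y ⟨_, ⟨j, hj, rfl⟩, hy⟩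
    have := h _ (List.getElem_mem hj)
    split_ifs at hy with hc
    · rw [hc.2] at this
      simp only [List.mem_cons, List.not_mem_nil, or_false] at hy
      rcases hy with rfl | rfl
      · exact this
      · exact this.trans (by decide)
    · simp only [List.mem_cons, List.not_mem_nil, or_false, or_self] at hy
      rw [hy]
      exact this

/-- The only letter that splitting makes smaller in the first row is the `2` of a column `2, 2̄`,
and without `2̄` in the second row there is no such column. -/
theorem forall_mem_split_row1 {t : Tableau} (ht : l2b ∉ t.row2) (p : Letter) :
    (∀ x ∈ t.split.row1, p ≤ x) ↔ ∀ x ∈ t.row1, p ≤ x := by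
  have h' (j : ℕ) : t.row2[j]? ≠ some l2b := fun h => ht (List.mem_of_getElem? h)
  simp only [split, List.mem_flatten, List.mem_mapIdx, h', and_false, if_false]
  constructor
  · intro h x hx
    obtain ⟨j, hj, rfl⟩ := List.mem_iff_getElem.mp hx
    exact h _ ⟨_, ⟨j, hj, rfl⟩, by simp⟩
  · rintro h x ⟨_, ⟨j, hj, rfl⟩, hx⟩
    simp only [List.mem_cons, List.not_mem_nil, or_false, or_self] at hx
    rw [hx]
    exact h _ (List.getElem_mem hj)

/-- The smallest letter allowed in the second row after the column `c`. -/
def nextLetter (c : Letter × Letter) : Letter := if c = (l2, l2b) then l1b else c.2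

/-- The Kashiwara–Nakashima condition only relates neighbouring columns. Beyond semistandardness and
admissibility, splitting demands just that a column `2, 2̄` be followed in the second row by letters
`1̄`, since its right half ends in `1̄`. -/
theorem isKN_consCol (c : Letter × Letter) (t : Tableau) :
    (t.consCol c).IsKN ↔ c.1 < c.2 ∧ c ≠ (l1, l1b) ∧ (∀ x ∈ t.row1, c.1 ≤ x) ∧
      (∀ y ∈ t.row2, nextLetter c ≤ y) ∧ t.IsKN := by
  simp only [IsKN, isSemistandard_consCol, isAdmissible_consCol]
  have hlt {p : Letter} (hp : l2b < p) (h : ∀ y ∈ t.row2, p ≤ y) : l2b ∉ t.row2 := fun hm =>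
    absurd (h _ hm) (not_le.mpr hp)
  by_cases hc : c = (l2, l2b)
  · subst hc
    rw [split_consCol_of_eq, isSemistandard_consCol, isSemistandard_consCol]
    simp only [nextLetter, if_true, forall_mem_split_row2]
    constructor
    · rintro ⟨⟨-, h2, -, h4⟩, ⟨h5, h6⟩, -, -, -, -, h7, h8, h9⟩
      exact ⟨by decide, h5, h2, h8, h4, h6, h9⟩
    · rintro ⟨-, h1, h2, h3, h4, h5, h6⟩
      refine ⟨⟨by decide, h2, fun y hy => le_trans (by decide) (h3 y hy), h4⟩, ⟨h1, h5⟩, by decide,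
        fun _ _ => Fin.zero_le _, ?_, by decide, ?_, h3, h6⟩
      · intro y hy
        simp only [consCol, List.mem_cons] at hy
        rcases hy with rfl | hy
        · decide
        · exact (forall_mem_split_row2 t l2b).mpr (fun y hy => le_trans (by decide) (h3 y hy)) y hy
      · exact (forall_mem_split_row1 (hlt (by decide) h3) _).mpr h2
  · rw [split_consCol_of_ne hc, isSemistandard_consCol, isSemistandard_consCol]
    simp only [nextLetter, hc, if_false, forall_mem_split_row2]
    constructor
    · rintro ⟨⟨h1, h2, h3, h4⟩, ⟨h5, h6⟩, -, -, -, -, h7, h8, h9⟩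
      exact ⟨h1, h5, h2, h3, h4, h6, h9⟩
    · rintro ⟨h0, h1, h2, h3, h4, h5, h6⟩
      have h7 : ∀ x ∈ t.split.row1, c.1 ≤ x := by
        by_cases h8 : l2b < c.2
        · exact (forall_mem_split_row1 (hlt h8 h3) _).mpr h2
        -- If the lower letter is at most `2̄` and the column is not `2, 2̄`, its upper letter is
        -- `1`, which is a bound for everything.
        · have : c.1 = 0 := by
            clear h2 h3
            obtain ⟨a, b⟩ := c
            revert a b
            decide
          rw [this]
          exact fun _ _ => Fin.zero_le _
      refine ⟨⟨h0, h2, h3, h4⟩, ⟨h1, h5⟩, h0, ?_, ?_, h0, h7, h3, h6⟩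
      · intro x hx
        rcases List.mem_cons.mp hx with rfl | hx
        · exact le_rfl
        · exact h7 x hx
      · intro y hy
        rcases List.mem_cons.mp hy with rfl | hy
        · exact le_rfl
        · exact (forall_mem_split_row2 t _).mpr h3 y hy

theorem isKN_of_row2_eq_nil (r : List Letter) : (Tableau.mk r []).IsKN ↔ r.Pairwise (· ≤ ·) := by
  have h (r : List Letter) : (Tableau.mk r []).IsSemistandard ↔ r.Pairwise (· ≤ ·) := by
    simp [IsSemistandard]
  rw [IsKN, split_of_row2_eq_nil, h, h]
  refine ⟨fun h => h.1, fun h => ⟨h, by simp [IsAdmissible], ?_⟩⟩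
  induction r with
  | nil => simp
  | cons a r ih =>
    rw [List.pairwise_cons] at h
    have h1 : ∀ x ∈ (r.map fun a => [a, a]).flatten, a ≤ x := by
      intro x hx
      simp only [List.mem_flatten, List.mem_map] at hx
      obtain ⟨_, ⟨y, hy, rfl⟩, hx⟩ := hx
      simp only [List.mem_cons, List.not_mem_nil, or_false, or_self] at hx
      rw [hx]
      exact h.1 y hy
    simp only [List.map_cons, List.flatten_cons, List.cons_append, List.nil_append,
      List.pairwise_cons]
    refine ⟨?_, h1, ih h.2⟩
    intro x hx
    rcases List.mem_cons.mp hx with rfl | hx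
    · exact le_rfl
    · exact h1 x hx

/-- The weight of a letter. -/
def letterWt (a : Letter) : Weight := ![(1, 0), (-1, 1), (1, -1), (-1, 0)] a

theorem wt_consLetter (a : Letter) (t : Tableau) : (t.consLetter a).wt = letterWt a + t.wt := by
  refine Prod.ext ?_ ?_ <;> fin_cases a <;>
    simp [wt, consLetter, letterWt, List.count_cons] <;> ring

theorem wt_consCol (c : Letter × Letter) (t : Tableau) :
    (t.consCol c).wt = letterWt c.1 + letterWt c.2 + t.wt := by
  have h : (Tableau.mk t.row1 (c.2 :: t.row2)).wt = letterWt c.2 + t.wt := by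
    obtain ⟨a, b⟩ := c
    refine Prod.ext ?_ ?_ <;> fin_cases b <;>
      simp [wt, letterWt, List.count_cons] <;> ring
  rw [add_assoc, ← h, ← wt_consLetter]
  rfl

end Tableau

/-! ### Characters of sets of tableaux -/

namespace Tableau

theorem consCol_injective (c : Letter × Letter) : Function.Injective (consCol c) := by
  intro t t' h
  simp only [consCol, Tableau.mk.injEq, List.cons.injEq, true_and] at h
  exact Tableau.ext h.1 h.2

theorem consLetter_injective (a : Letter) : Function.Injective (consLetter a) := by
  intro t t' h
  simp only [consLetter, Tableau.mk.injEq, List.cons.injEq, true_and] at h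
  exact Tableau.ext h.1 h.2

end Tableau

/-- The Kashiwara–Nakashima tableaux with `n` columns of height one and `m` columns of height two,
with entries at least `p` in the first row and at least `q` in the second row. -/
def tabs (p q : Letter) (n m : ℕ) : Set Tableau :=
  {t | t.row1.length = n + m ∧ t.row2.length = m ∧ (∀ x ∈ t.row1, p ≤ x) ∧ (∀ y ∈ t.row2, q ≤ y) ∧
    t.IsKN}

theorem crystal_eq_tabs (lam : DomWeight) : crystal lam = tabs 0 0 lam.1 lam.2 := by
  ext t
  simp [crystal, tabs]

/-- The admissible columns of height two with entries at least `p`, `q`. -/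
def colsFrom (p q : Letter) : Finset (Letter × Letter) :=
  Finset.univ.filter fun c => c.1 < c.2 ∧ c ≠ (l1, l1b) ∧ p ≤ c.1 ∧ q ≤ c.2

theorem le_nextLetter (c : Letter × Letter) : c.2 ≤ Tableau.nextLetter c := by
  obtain ⟨a, b⟩ := c
  revert a b
  decide

theorem tabs_zero_zero (p q : Letter) : tabs p q 0 0 = {⟨[], []⟩} := by
  ext t
  simp only [tabs, Set.mem_ofPred_eq, Set.mem_singleton_iff, add_zero, List.length_eq_zero_iff]
  constructor
  · rintro ⟨h1, h2, -⟩
    exact Tableau.ext h1 h2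
  · rintro rfl
    simp [Tableau.isKN_of_row2_eq_nil]

theorem tabs_succ_zero (p q : Letter) (n : ℕ) :
    tabs p q (n + 1) 0 = ⋃ a ∈ Finset.univ.filter (p ≤ ·), Tableau.consLetter a '' tabs a q n 0 := by
  ext t
  simp only [tabs, Set.mem_ofPred_eq, Set.mem_iUnion, Set.mem_image, Finset.mem_filter,
    Finset.mem_univ, true_and, exists_prop, add_zero, List.length_eq_zero_iff]
  constructor
  · obtain ⟨r1, r2⟩ := t
    rintro ⟨h1, rfl, h3, -, h5⟩
    rw [Tableau.isKN_of_row2_eq_nil] at h5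
    cases r1 with
    | nil => simp at h1
    | cons a r =>
      rw [List.pairwise_cons] at h5
      refine ⟨a, h3 a List.mem_cons_self, ⟨r, []⟩, ⟨by simpa using h1, rfl, h5.1, by simp, ?_⟩, rfl⟩
      exact (Tableau.isKN_of_row2_eq_nil r).mpr h5.2
  · rintro ⟨a, ha, ⟨r, r2⟩, ⟨h1, rfl, h3, -, h5⟩, rfl⟩
    rw [Tableau.isKN_of_row2_eq_nil] at h5
    refine ⟨by simpa [Tableau.consLetter] using h1, rfl, ?_, by simp [Tableau.consLetter], ?_⟩
    · intro x hx
      rcases List.mem_cons.mp hx with rfl | hx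
      · exact ha
      · exact ha.trans (h3 x hx)
    · exact (Tableau.isKN_of_row2_eq_nil _).mpr (List.pairwise_cons.mpr ⟨h3, h5⟩)

theorem tabs_succ (p q : Letter) (n m : ℕ) :
    tabs p q n (m + 1) =
      ⋃ c ∈ colsFrom p q, Tableau.consCol c '' tabs c.1 (Tableau.nextLetter c) n m := by
  ext t
  simp only [tabs, Set.mem_ofPred_eq, Set.mem_iUnion, Set.mem_image, colsFrom, Finset.mem_filter,
    Finset.mem_univ, true_and, exists_prop]
  constructor
  · obtain ⟨r1, r2⟩ := t
    rintro ⟨h1, h2, h3, h4, h5⟩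
    cases r1 with
    | nil => simp at h1
    | cons a r1 =>
      cases r2 with
      | nil => simp at h2
      | cons b r2 =>
        obtain ⟨k1, k2, k3, k4, k5⟩ := (Tableau.isKN_consCol (a, b) ⟨r1, r2⟩).mp h5
        refine ⟨(a, b), ⟨k1, k2, h3 a List.mem_cons_self, h4 b List.mem_cons_self⟩, ⟨r1, r2⟩,
          ⟨?_, by simpa using h2, k3, k4, k5⟩, rfl⟩
        simpa [← add_assoc] using h1
  · rintro ⟨c, ⟨k1, k2, k3, k4⟩, t, ⟨h1, h2, h3, h4, h5⟩, rfl⟩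
    refine ⟨by simp [Tableau.consCol, h1, add_assoc], by simp [Tableau.consCol, h2], ?_, ?_,
      (Tableau.isKN_consCol c t).mpr ⟨k1, k2, h3, h4, h5⟩⟩
    · intro x hx
      rcases List.mem_cons.mp hx with rfl | hx
      · exact k3
      · exact k3.trans (h3 x hx)
    · intro y hy
      rcases List.mem_cons.mp hy with rfl | hy
      · exact k4
      · exact (k4.trans (le_nextLetter c)).trans (h4 y hy)

theorem finite_tabs (p q : Letter) (n m : ℕ) : (tabs p q n m).Finite := by
  induction m generalizing p q with
  | succ m ih =>
    rw [tabs_succ]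
    exact Set.Finite.biUnion (Finset.finite_toSet _) fun c _ => (ih _ _).image _
  | zero =>
    induction n generalizing p with
    | zero =>
      rw [tabs_zero_zero]
      exact Set.finite_singleton _
    | succ n ih =>
      rw [tabs_succ_zero]
      exact Set.Finite.biUnion (Finset.finite_toSet _) fun c _ => (ih _).image _

/-- The character of a set of tableaux. -/
noncomputable def fullChar (C : Set Tableau) : AddMonoidAlgebra ℤ Weight :=
  ∑ᶠ t ∈ C, AddMonoidAlgebra.single t.wt 1

theorem fullChar_image {C : Set Tableau} (hC : C.Finite) {f : Tableau → Tableau}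
    (hf : Function.Injective f) {mu : Weight} (hmu : ∀ t, (f t).wt = mu + t.wt) :
    fullChar (f '' C) = AddMonoidAlgebra.single mu 1 * fullChar C := by
  rw [fullChar, fullChar, finsum_mem_image hf.injOn, finsum_mem_eq_finite_toFinset_sum _ hC,
    finsum_mem_eq_finite_toFinset_sum _ hC, Finset.mul_sum]
  refine Finset.sum_congr rfl fun t _ => ?_
  rw [hmu, AddMonoidAlgebra.single_mul_single, one_mul]

theorem fullChar_biUnion {ι : Type*} (s : Finset ι) (C : ι → Set Tableau)
    (hd : (s : Set ι).PairwiseDisjoint C) (hC : ∀ i ∈ s, (C i).Finite) :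
    fullChar (⋃ i ∈ s, C i) = ∑ i ∈ s, fullChar (C i) := by
  have := finsum_mem_biUnion (f := fun t : Tableau => AddMonoidAlgebra.single t.wt (1 : ℤ)) hd
    s.finite_toSet hC
  rw [finsum_mem_coe_finset] at this
  exact this

/-- The character of `tabs p q n m`. -/
noncomputable def tabsChar (p q : Letter) (n m : ℕ) : AddMonoidAlgebra ℤ Weight :=
  fullChar (tabs p q n m)

theorem tabsChar_zero_zero (p q : Letter) : tabsChar p q 0 0 = 1 := by
  rw [tabsChar, tabs_zero_zero, fullChar, finsum_mem_singleton]
  rfl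

theorem tabsChar_succ_zero (p q : Letter) (n : ℕ) :
    tabsChar p q (n + 1) 0 = ∑ a ∈ Finset.univ.filter (p ≤ ·),
      AddMonoidAlgebra.single (Tableau.letterWt a) 1 * tabsChar a q n 0 := by
  rw [tabsChar, tabs_succ_zero, fullChar_biUnion]
  · exact Finset.sum_congr rfl fun a _ => fullChar_image (finite_tabs _ _ _ _)
      (Tableau.consLetter_injective a) (Tableau.wt_consLetter a)
  · intro a _ b _ hab
    refine Set.disjoint_left.mpr ?_
    rintro _ ⟨t, -, rfl⟩ ⟨t', -, h⟩
    simp only [Tableau.consLetter, Tableau.mk.injEq, List.cons.injEq] at h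
    exact hab h.1.1.symm
  · exact fun a _ => (finite_tabs _ _ _ _).image _

theorem tabsChar_succ (p q : Letter) (n m : ℕ) :
    tabsChar p q n (m + 1) = ∑ c ∈ colsFrom p q,
      AddMonoidAlgebra.single (Tableau.letterWt c.1 + Tableau.letterWt c.2) 1 *
        tabsChar c.1 (Tableau.nextLetter c) n m := by
  rw [tabsChar, tabs_succ, fullChar_biUnion]
  · exact Finset.sum_congr rfl fun c _ => fullChar_image (finite_tabs _ _ _ _)
      (Tableau.consCol_injective c) (Tableau.wt_consCol c)
  · intro a _ b _ hab
    refine Set.disjoint_left.mpr ?_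
    rintro _ ⟨t, -, rfl⟩ ⟨t', -, h⟩
    simp only [Tableau.consCol, Tableau.mk.injEq, List.cons.injEq] at h
    exact hab (Prod.ext h.1.1.symm h.2.1.symm)
  · exact fun a _ => (finite_tabs _ _ _ _).image _

theorem coeff_fullChar {C : Set Tableau} (hC : C.Finite) (mu : Weight) :
    (fullChar C).coeff mu = {t ∈ C | t.wt = mu}.ncard := by
  classical
  rw [fullChar, finsum_mem_eq_finite_toFinset_sum _ hC, AddMonoidAlgebra.coeff_sum,
    Finsupp.finsetSum_apply]
  simp only [AddMonoidAlgebra.coeff_single, Finsupp.single_apply]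
  rw [← Finset.sum_filter, Finset.sum_const, nsmul_eq_mul, mul_one, ← Set.ncard_coe_finset]
  congr 2
  ext t
  simp

theorem coeff_domChar {C : Set Tableau} (hC : C.Finite) (mu : DomWeight) :
    (domChar C).coeff mu = (fullChar C).coeff mu.toWeight := by
  classical
  have hC' : {t ∈ C | 0 ≤ t.wt.1 ∧ 0 ≤ t.wt.2}.Finite := hC.subset (Set.sep_subset _ _)
  rw [coeff_fullChar hC, domChar, finsum_mem_eq_finite_toFinset_sum _ hC',
    AddMonoidAlgebra.coeff_sum, Finsupp.finsetSum_apply]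
  simp only [AddMonoidAlgebra.coeff_single, Finsupp.single_apply]
  rw [← Finset.sum_filter, Finset.sum_const, nsmul_eq_mul, mul_one, ← Set.ncard_coe_finset]
  congr 2
  ext t
  simp only [Finset.coe_filter, Set.Finite.mem_toFinset, Set.mem_ofPred_eq, DomWeight.toWeight,
    Prod.ext_iff]
  constructor
  · rintro ⟨⟨h1, h2, h3⟩, h4, h5⟩
    exact ⟨h1, by omega, by omega⟩
  · rintro ⟨h1, h2, h3⟩
    exact ⟨⟨h1, by omega, by omega⟩, by omega, by omega⟩

/-! ### The character of the crystal -/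

theorem map_single_letterWt_add {K : Type*} [Field K] (f : AddMonoidAlgebra ℤ Weight →+* K) {X Y : K}
    (h0 : f (AddMonoidAlgebra.single (Tableau.letterWt 0) 1) = X)
    (h1 : f (AddMonoidAlgebra.single (Tableau.letterWt 1) 1) = Y)
    (h2 : f (AddMonoidAlgebra.single (Tableau.letterWt 2) 1) = Y⁻¹)
    (h3 : f (AddMonoidAlgebra.single (Tableau.letterWt 3) 1) = X⁻¹) (a b : Letter) :
    f (AddMonoidAlgebra.single (Tableau.letterWt a + Tableau.letterWt b) 1) =
      ![X, Y, Y⁻¹, X⁻¹] a * ![X, Y, Y⁻¹, X⁻¹] b := by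
  have h (a : Letter) :
      f (AddMonoidAlgebra.single (Tableau.letterWt a) 1) = ![X, Y, Y⁻¹, X⁻¹] a := by
    fin_cases a
    · exact h0
    · exact h1
    · exact h2
    · exact h3
  rw [← h, ← h, ← map_mul, AddMonoidAlgebra.single_mul_single, one_mul]

section
variable {K : Type*} [Field K] (f : AddMonoidAlgebra ℤ Weight →+* K) {X Y : K}
  (h0 : f (AddMonoidAlgebra.single (Tableau.letterWt 0) 1) = X)
  (h1 : f (AddMonoidAlgebra.single (Tableau.letterWt 1) 1) = Y)
  (h2 : f (AddMonoidAlgebra.single (Tableau.letterWt 2) 1) = Y⁻¹)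
  (h3 : f (AddMonoidAlgebra.single (Tableau.letterWt 3) 1) = X⁻¹)
  (hX : X ≠ 0) (hY : Y ≠ 0) (hXY : X - Y ≠ 0) (hXY1 : X * Y - 1 ≠ 0) (hX2 : X ^ 2 - 1 ≠ 0)
  (hY2 : Y ^ 2 - 1 ≠ 0)
include h3

/-- The bounds that arise below are `(2,3)`, `(1,3)`, `(0,2)`, `(0,1)`, besides the one-row case.
Treated in this order, each character satisfies a first-order recursion whose inhomogeneous part is
already known, so it is a combination of geometric progressions. The denominators are the reason for
mapping to a field. -/
theorem map_tabsChar_three_zero (q : Letter) (n : ℕ) : f (tabsChar 3 q n 0) = X⁻¹ ^ n := by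
  induction n with
  | zero => rw [tabsChar_zero_zero, map_one, pow_zero]
  | succ n ih =>
    rw [tabsChar_succ_zero, show Finset.univ.filter ((3 : Letter) ≤ ·) = {3} by decide,
      Finset.sum_singleton, map_mul, h3, ih, pow_succ']

include h2 hX hY hXY

theorem map_tabsChar_two_zero (q : Letter) (n : ℕ) :
    f (tabsChar 2 q n 0) = (Y⁻¹ ^ n * X - X⁻¹ ^ n * Y) / (X - Y) := by
  induction n with
  | zero =>
    rw [tabsChar_zero_zero, map_one]
    field_simp
  | succ n ih =>
    rw [tabsChar_succ_zero, show Finset.univ.filter ((2 : Letter) ≤ ·) = {2, 3} by decide,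
      Finset.sum_pair (by decide), map_add, map_mul, map_mul, h2, h3, ih,
      map_tabsChar_three_zero f h3]
    simp only [pow_succ _ n]
    generalize X⁻¹ ^ n = d, Y⁻¹ ^ n = c
    field_simp
    ring

include h1 hXY1 hY2

theorem map_tabsChar_one_zero (q : Letter) (n : ℕ) :
    f (tabsChar 1 q n 0) = Y ^ n * (X * Y ^ 3) / ((Y ^ 2 - 1) * (X * Y - 1)) -
      Y⁻¹ ^ n * X / ((Y ^ 2 - 1) * (X - Y)) + X⁻¹ ^ n * Y / ((X * Y - 1) * (X - Y)) := by
  induction n with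
  | zero =>
    rw [tabsChar_zero_zero, map_one]
    field_simp
    ring
  | succ n ih =>
    rw [tabsChar_succ_zero, show Finset.univ.filter ((1 : Letter) ≤ ·) = {1, 2, 3} by decide,
      Finset.sum_insert (by decide), Finset.sum_pair (by decide), map_add, map_add, map_mul,
      map_mul, map_mul, h1, h2, h3, ih, map_tabsChar_three_zero f h3,
      map_tabsChar_two_zero f h2 h3 hX hY hXY]
    have hYX1 : Y * X - 1 ≠ 0 := by rwa [mul_comm]
    simp only [pow_succ _ n]
    generalize X⁻¹ ^ n = d, Y⁻¹ ^ n = c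
    field_simp
    ring

include h0 hX2

theorem map_tabsChar_zero_zero (q : Letter) (n : ℕ) :
    f (tabsChar 0 q n 0) = X ^ n * (X ^ 4 * Y) / ((X - Y) * (X * Y - 1) * (X ^ 2 - 1)) -
      Y ^ n * (X * Y ^ 4) / ((X - Y) * (Y ^ 2 - 1) * (X * Y - 1)) +
      Y⁻¹ ^ n * X / ((X * Y - 1) * (Y ^ 2 - 1) * (X - Y)) -
      X⁻¹ ^ n * Y / ((X ^ 2 - 1) * (X * Y - 1) * (X - Y)) := by
  induction n with
  | zero =>
    rw [tabsChar_zero_zero, map_one]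
    field_simp
    ring
  | succ n ih =>
    rw [tabsChar_succ_zero, show Finset.univ.filter ((0 : Letter) ≤ ·) = {0, 1, 2, 3} by decide,
      Finset.sum_insert (by decide), Finset.sum_insert (by decide), Finset.sum_pair (by decide),
      map_add, map_add, map_add, map_mul, map_mul, map_mul, map_mul, h0, h1, h2, h3, ih,
      map_tabsChar_three_zero f h3, map_tabsChar_two_zero f h2 h3 hX hY hXY,
      map_tabsChar_one_zero f h1 h2 h3 hX hY hXY hXY1 hY2]
    have hYX1 : Y * X - 1 ≠ 0 := by rwa [mul_comm]
    simp only [pow_succ _ n]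
    generalize X⁻¹ ^ n = d, Y⁻¹ ^ n = c
    field_simp
    ring

omit hXY1 hX2 hY2 in
theorem map_tabsChar_two_three (n m : ℕ) :
    f (tabsChar 2 3 n m) = (Y⁻¹ * X⁻¹) ^ m * ((Y⁻¹ ^ n * X - X⁻¹ ^ n * Y) / (X - Y)) := by
  induction m with
  | zero => rw [map_tabsChar_two_zero f h2 h3 hX hY hXY, pow_zero, one_mul]
  | succ m ih =>
    rw [tabsChar_succ, show colsFrom 2 3 = {(2, 3)} by decide, Finset.sum_singleton, map_mul,
      map_single_letterWt_add f h0 h1 h2 h3]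
    change _ * f (tabsChar 2 3 n m) = _
    rw [ih, pow_succ', mul_assoc (_ * _)]
    rfl

omit hX2 in
theorem map_tabsChar_one_three (n m : ℕ) :
    f (tabsChar 1 3 n m) =
      (Y * X⁻¹) ^ m * ((Y ^ n * (X * Y ^ 3) - X⁻¹ ^ n * Y ^ 2) / ((Y ^ 2 - 1) * (X * Y - 1))) -
      (Y⁻¹ * X⁻¹) ^ m * ((Y⁻¹ ^ n * X - X⁻¹ ^ n * Y) / ((X - Y) * (Y ^ 2 - 1))) := by
  induction m with
  | zero =>
    rw [map_tabsChar_one_zero f h1 h2 h3 hX hY hXY hXY1 hY2]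
    field_simp
    ring
  | succ m ih =>
    rw [tabsChar_succ, show colsFrom 1 3 = {(1, 3), (2, 3)} by decide,
      Finset.sum_pair (by decide), map_add, map_mul, map_mul,
      map_single_letterWt_add f h0 h1 h2 h3,
      map_single_letterWt_add f h0 h1 h2 h3]
    change Y * X⁻¹ * f (tabsChar 1 3 n m) + Y⁻¹ * X⁻¹ * f (tabsChar 2 3 n m) = _
    rw [ih, map_tabsChar_two_three f h0 h1 h2 h3 hX hY hXY]
    have hYX1 : Y * X - 1 ≠ 0 := by rwa [mul_comm]
    simp only [pow_succ _ m, mul_pow]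
    generalize X⁻¹ ^ n = d, Y⁻¹ ^ n = c, X⁻¹ ^ m = d', Y⁻¹ ^ m = c'
    field_simp
    ring

theorem map_tabsChar_zero_two (n m : ℕ) :
    f (tabsChar 0 2 n m) =
      (X * Y⁻¹) ^ m * ((X ^ n * (X ^ 4 * Y) - Y⁻¹ ^ n * X ^ 3) /
        ((X - Y) * (X * Y - 1) * (X ^ 2 - 1))) -
      (Y * X⁻¹) ^ m * ((Y ^ n * (X * Y ^ 4) - X⁻¹ ^ n * Y ^ 3) /
        ((X - Y) * (Y ^ 2 - 1) * (X * Y - 1))) +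
      (Y⁻¹ * X⁻¹) ^ m * ((Y⁻¹ ^ n * X - X⁻¹ ^ n * Y) * (X * Y + 1) /
        ((X - Y) * (Y ^ 2 - 1) * (X ^ 2 - 1))) := by
  induction m with
  | zero =>
    rw [map_tabsChar_zero_zero f h0 h1 h2 h3 hX hY hXY hXY1 hX2 hY2]
    field_simp
    ring
  | succ m ih =>
    rw [tabsChar_succ, show colsFrom 0 2 = {(0, 2), (1, 2), (1, 3), (2, 3)} by decide,
      Finset.sum_insert (by decide), Finset.sum_insert (by decide),
      Finset.sum_pair (by decide)]
    simp only [map_add, map_mul, map_single_letterWt_add f h0 h1 h2 h3]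
    -- The columns `2, 2̄` and `2, 1̄` leave the same bounds `(1, 3)` for the remaining columns.
    change X * Y⁻¹ * f (tabsChar 0 2 n m) + (Y * Y⁻¹ * f (tabsChar 1 3 n m) +
      (Y * X⁻¹ * f (tabsChar 1 3 n m) + Y⁻¹ * X⁻¹ * f (tabsChar 2 3 n m))) = _
    rw [ih, map_tabsChar_two_three f h0 h1 h2 h3 hX hY hXY,
      map_tabsChar_one_three f h0 h1 h2 h3 hX hY hXY hXY1 hY2]
    have hYX1 : Y * X - 1 ≠ 0 := by rwa [mul_comm]
    simp only [pow_succ _ m, mul_pow]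
    generalize X⁻¹ ^ n = d, Y⁻¹ ^ n = c, X⁻¹ ^ m = d', Y⁻¹ ^ m = c'
    field_simp
    ring

theorem map_tabsChar_zero_one (n m : ℕ) :
    f (tabsChar 0 1 n m) =
      ((X * Y) ^ m * (X ^ n * (X ^ 4 * Y ^ 3) - Y ^ n * (X ^ 3 * Y ^ 4)) -
      (X * Y⁻¹) ^ m * (X ^ n * (X ^ 4 * Y) - Y⁻¹ ^ n * X ^ 3) +
      (Y * X⁻¹) ^ m * (Y ^ n * (X * Y ^ 4) - X⁻¹ ^ n * Y ^ 3) -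
      (Y⁻¹ * X⁻¹) ^ m * (Y⁻¹ ^ n * X - X⁻¹ ^ n * Y)) /
        ((X - Y) * (X * Y - 1) * (X ^ 2 - 1) * (Y ^ 2 - 1)) := by
  induction m with
  | zero =>
    rw [map_tabsChar_zero_zero f h0 h1 h2 h3 hX hY hXY hXY1 hX2 hY2]
    field_simp
    ring
  | succ m ih =>
    have e : f (tabsChar 0 1 n (m + 1)) =
        X * Y * f (tabsChar 0 1 n m) + f (tabsChar 0 2 n (m + 1)) := by
      rw [tabsChar_succ, tabsChar_succ,
        show colsFrom 0 1 = insert (0, 1) (colsFrom 0 2) by decide,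
        Finset.sum_insert (by decide), map_add, map_mul,
        map_single_letterWt_add f h0 h1 h2 h3]
      rfl
    rw [e, ih, map_tabsChar_zero_two f h0 h1 h2 h3 hX hY hXY hXY1 hX2 hY2]
    have hYX1 : Y * X - 1 ≠ 0 := by rwa [mul_comm]
    simp only [pow_succ _ m, mul_pow]
    generalize X⁻¹ ^ n = d, Y⁻¹ ^ n = c, X⁻¹ ^ m = d', Y⁻¹ ^ m = c'
    field_simp
    ring

end

/-! ### The Weyl character formula and the weight multiplicities of the crystal -/

/-- The monomial `e^μ`. -/
noncomputable def expo (mu : Weight) : AddMonoidAlgebra ℤ Weight := AddMonoidAlgebra.single mu 1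

theorem expo_add (mu nu : Weight) : expo (mu + nu) = expo mu * expo nu := by
  rw [expo, expo, expo, AddMonoidAlgebra.single_mul_single, one_mul]

theorem expo_zero : expo 0 = 1 := rfl

theorem expo_injective : Function.Injective expo := by
  intro mu nu h
  have := congrArg (fun x => x.coeff mu) h
  simp only [expo, AddMonoidAlgebra.coeff_single, Finsupp.single_apply, if_true] at this
  by_contra hne
  rw [if_neg (Ne.symm hne)] at this
  exact one_ne_zero this

/-- The denominator of the Weyl character formula. -/
noncomputable def weylDenom : AddMonoidAlgebra ℤ Weight :=
  (1 - expo (-2, 0)) * ((1 - expo (0, -1)) * ((1 - expo (2, -2)) * (1 - expo (-2, 1))))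

/-- The numerator of the Weyl character formula, in terms of `λ + ρ`. -/
noncomputable def weylNum (a b : ℤ) : AddMonoidAlgebra ℤ Weight :=
  expo (a - 1, b - 1) - expo (-a - 1, a + b - 1) - expo (a + 2 * b - 1, -b - 1) +
    expo (-a - 2 * b - 1, a + b - 1) + expo (a + 2 * b - 1, -a - b - 1) -
    expo (-a - 2 * b - 1, b - 1) - expo (a - 1, -a - b - 1) + expo (-a - 1, -b - 1)

/-- `P, Q, U, V` stand for `X^n, Y^n, X^m, Y^m`. With the powers replaced by independent variables,
the Weyl denominator times the closed formula of `map_tabsChar_zero_one` equals the Weyl numerator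
as a rational function. -/
theorem weyl_character_identity {K : Type*} [Field K] {X Y P Q U V : K} (hX : X ≠ 0) (hY : Y ≠ 0)
    (hP : P ≠ 0) (hQ : Q ≠ 0) (hU : U ≠ 0) (hV : V ≠ 0) (hXY : X - Y ≠ 0) (hXY1 : X * Y - 1 ≠ 0)
    (hX2 : X ^ 2 - 1 ≠ 0) (hY2 : Y ^ 2 - 1 ≠ 0) :
    (1 - (X ^ 2)⁻¹) * ((1 - X⁻¹ * Y⁻¹) * ((1 - (Y ^ 2)⁻¹) * (1 - X⁻¹ * Y))) *
      ((U * V * (P * (X ^ 4 * Y ^ 3) - Q * (X ^ 3 * Y ^ 4)) -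
              U * V⁻¹ * (P * (X ^ 4 * Y) - Q⁻¹ * X ^ 3) +
            V * U⁻¹ * (Q * (X * Y ^ 4) - P⁻¹ * Y ^ 3) -
          V⁻¹ * U⁻¹ * (Q⁻¹ * X - P⁻¹ * Y)) /
        ((X - Y) * (X * Y - 1) * (X ^ 2 - 1) * (Y ^ 2 - 1))) =
    P * U * V - U / X ^ 1 * (Q * V * Y ^ 1) - P * U * (V⁻¹ / Y ^ 2) +
              U⁻¹ / X ^ 3 * (Q * V * Y ^ 1) +
            U / X ^ 1 * (Q⁻¹ / V / Y ^ 3) -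
          P⁻¹ / U / X ^ 4 * V -
        U⁻¹ / X ^ 3 * (Q⁻¹ / V / Y ^ 3) +
      P⁻¹ / U / X ^ 4 * (V⁻¹ / Y ^ 2) := by
  rw [mul_div_assoc', div_eq_iff (mul_ne_zero (mul_ne_zero (mul_ne_zero hXY hXY1) hX2) hY2)]
  field_simp
  ring

theorem tabsChar_zero_eq (n m : ℕ) : tabsChar 0 0 n m = tabsChar 0 1 n m := by
  cases m with
  | succ m => rw [tabsChar_succ, tabsChar_succ, show colsFrom 0 0 = colsFrom 0 1 by decide]
  | zero =>
    induction n with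
    | zero => rw [tabsChar_zero_zero, tabsChar_zero_zero]
    | succ n ih =>
      have : tabs 0 0 (n + 1) 0 = tabs 0 1 (n + 1) 0 := by
        ext t
        simp only [tabs, Set.mem_ofPred_eq, List.length_eq_zero_iff]
        constructor <;> rintro ⟨h1, h2, h3, -, h5⟩ <;> exact ⟨h1, h2, h3, by simp [h2], h5⟩
      rw [tabsChar, this, tabsChar]

theorem map_weylDenom_mul_tabsChar {K : Type*} [Field K] (f : AddMonoidAlgebra ℤ Weight →+* K)
    (hf : Function.Injective f) (n m : ℕ) :
    f (weylDenom * tabsChar 0 0 n m) = f (weylNum (n + 1) (m + 1)) := by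
  have hinv (mu : Weight) : f (expo (-mu)) = (f (expo mu))⁻¹ := by
    apply eq_inv_of_mul_eq_one_left
    rw [← map_mul, ← expo_add, neg_add_cancel, expo_zero, map_one]
  have hne {mu nu : Weight} (h : mu ≠ nu) : f (expo mu) - f (expo nu) ≠ 0 :=
    sub_ne_zero.mpr (hf.ne (expo_injective.ne h))
  have hpow (mu : Weight) (k : ℤ) : f (expo (k • mu)) = f (expo mu) ^ k := by
    have hnat (k : ℕ) : f (expo ((k : ℤ) • mu)) = f (expo mu) ^ k := by
      induction k with
      | zero => simp [expo_zero]
      | succ k ih =>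
        rw [Nat.cast_add, Nat.cast_one, add_smul, one_smul, expo_add, map_mul, ih, pow_succ]
    obtain ⟨k, rfl | rfl⟩ := k.eq_nat_or_neg
    · rw [hnat, zpow_natCast]
    · rw [neg_smul, hinv, hnat, zpow_neg, zpow_natCast]
  -- `X` and `Y` are the images of the exponentials of the weights of the letters `1` and `2`; every
  -- monomial `e^{(a, b)}` goes to `X^{a+b} Y^b`.
  obtain ⟨X, hXdef⟩ : ∃ X, f (expo (1, 0)) = X := ⟨_, rfl⟩
  obtain ⟨Y, hYdef⟩ : ∃ Y, f (expo (-1, 1)) = Y := ⟨_, rfl⟩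
  have hX : X ≠ 0 := by
    intro h
    have := hinv (1, 0)
    rw [hXdef, h, inv_zero, ← map_zero f] at this
    have h' := congrArg (fun x => x.coeff (-(1, 0))) (hf this)
    simp [expo] at h'
  have hY : Y ≠ 0 := by
    intro h
    have := hinv (-1, 1)
    rw [hYdef, h, inv_zero, ← map_zero f] at this
    have h' := congrArg (fun x => x.coeff (-(-1, 1))) (hf this)
    simp [expo] at h'
  have hmon (a b : ℤ) : f (expo (a, b)) = X ^ (a + b) * Y ^ b := by
    rw [← hXdef, ← hYdef, ← hpow, ← hpow, ← map_mul, ← expo_add]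
    congr 2
    ext <;> simp
  have hXY : X - Y ≠ 0 := by
    rw [← hXdef, ← hYdef]
    exact hne (by decide)
  have hXY1 : X * Y - 1 ≠ 0 := by
    have := hne (mu := (0, 1)) (nu := 0) (by decide)
    rwa [hmon, expo_zero, map_one, zero_add, zpow_one, zpow_one] at this
  have hX2 : X ^ 2 - 1 ≠ 0 := by
    have := hne (mu := (2, 0)) (nu := 0) (by decide)
    rwa [hmon, expo_zero, map_one, add_zero, zpow_zero, mul_one, zpow_ofNat] at this
  have hY2 : Y ^ 2 - 1 ≠ 0 := by
    have := hne (mu := (-2, 2)) (nu := 0) (by decide)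
    rwa [hmon, expo_zero, map_one, neg_add_cancel, zpow_zero, one_mul, zpow_ofNat] at this
  have hc2 : f (AddMonoidAlgebra.single (Tableau.letterWt 2) 1) = Y⁻¹ := by
    rw [← hYdef, ← hinv]
    rfl
  have hc3 : f (AddMonoidAlgebra.single (Tableau.letterWt 3) 1) = X⁻¹ := by
    rw [← hXdef, ← hinv]
    rfl
  rw [map_mul, tabsChar_zero_eq, map_tabsChar_zero_one f hXdef hYdef hc2 hc3 hX hY hXY hXY1 hX2 hY2]
  simp only [weylDenom, weylNum, map_add, map_sub, map_mul, map_one, hmon]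
  have k1 : (-((n : ℤ) + 1) - 1 + ((n : ℤ) + 1 + (m + 1) - 1)) = m - 1 := by ring
  have k2 : ((n : ℤ) + 1 + 2 * (m + 1) - 1 + (-(m + 1) - 1)) = n + m := by ring
  have k3 : (-((n : ℤ) + 1) - 2 * (m + 1) - 1 + (n + 1 + (m + 1) - 1)) = -m - 3 := by ring
  have k4 : ((n : ℤ) + 1 + 2 * (m + 1) - 1 + (-(n + 1) - (m + 1) - 1)) = m - 1 := by ring
  have k5 : (-((n : ℤ) + 1) - 2 * (m + 1) - 1 + ((m + 1) - 1)) = -n - m - 4 := by ring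
  have k6 : ((n : ℤ) + 1 - 1 + (-(n + 1) - (m + 1) - 1)) = -m - 3 := by ring
  have k7 : (-((n : ℤ) + 1) - 1 + (-(m + 1) - 1)) = -n - m - 4 := by ring
  have k8 : ((n : ℤ) + 1 + (m + 1) - 1) = n + m + 1 := by ring
  have k9 : (-((n : ℤ) + 1) - (m + 1) - 1) = -n - m - 3 := by ring
  have k10 : (-((m : ℤ) + 1) - 1) = -m - 2 := by ring
  have k11 : ((n : ℤ) + 1 - 1 + ((m : ℤ) + 1 - 1)) = n + m := by ring
  rw [k1, k2, k3, k4, k5, k6, k7, k8, k9, k10, k11, add_sub_cancel_right]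
  norm_num
  simp only [zpow_add₀ hX, zpow_sub₀ hX, zpow_add₀ hY, zpow_sub₀ hY, zpow_neg, zpow_natCast,
    zpow_ofNat, mul_pow, inv_pow]
  exact weyl_character_identity hX hY (pow_ne_zero _ hX) (pow_ne_zero _ hY) (pow_ne_zero _ hX)
    (pow_ne_zero _ hY) hXY hXY1 hX2 hY2

/-- The Weyl character formula for the crystal. -/
theorem weylDenom_mul_tabsChar (n m : ℕ) :
    weylDenom * tabsChar 0 0 n m = weylNum (n + 1) (m + 1) := by
  have hf : Function.Injective (algebraMap (AddMonoidAlgebra ℤ Weight)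
      (FractionRing (AddMonoidAlgebra ℤ Weight))) := IsFractionRing.injective _ _
  exact hf (map_weylDenom_mul_tabsChar _ hf n m)

theorem coeff_one_sub_expo_mul (al : Weight) (h : AddMonoidAlgebra ℤ Weight) (mu : Weight) :
    ((1 - expo (-al)) * h).coeff mu = wtDiff al h.coeff mu := by
  rw [sub_mul, one_mul, AddMonoidAlgebra.coeff_sub, Finsupp.sub_apply, expo,
    AddMonoidAlgebra.coeff_single_mul_apply, one_mul, wtDiff, neg_neg, add_comm]

theorem coeff_expo (mu nu : Weight) : (expo mu).coeff nu = if mu = nu then 1 else 0 := by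
  rw [expo, AddMonoidAlgebra.coeff_single, Finsupp.single_apply]

theorem isBdd_coeff (h : AddMonoidAlgebra ℤ Weight) : IsBdd h.coeff := by
  obtain ⟨M, hM⟩ := (h.coeff.support.image fun mu : Weight => 3 * mu.1 + 4 * mu.2).bddAbove
  refine ⟨M, fun mu hmu => ?_⟩
  by_contra hne
  exact absurd (hM (Finset.mem_coe.mpr
    (Finset.mem_image_of_mem _ (Finsupp.mem_support_iff.mpr hne)))) (not_le.mpr hmu)

theorem coeff_weylNum (a b : ℤ) (mu : Weight) :
    (weylNum a b).coeff mu =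
      altSum (fun x y => if x = 0 ∧ y = 0 then 1 else 0) a b (mu.1 + 1) (mu.2 + 1) := by
  obtain ⟨c, e⟩ := mu
  simp only [weylNum, altSum, AddMonoidAlgebra.coeff_sub, AddMonoidAlgebra.coeff_add,
    Finsupp.sub_apply, Finsupp.add_apply, coeff_expo, Prod.mk.injEq]
  have h (p q : ℤ) : (p - 1 = c ∧ q - 1 = e) ↔ (p - (c + 1) = 0 ∧ q - (e + 1) = 0) := by omega
  simp only [h]

/-- The weight multiplicities of the crystal. -/
theorem coeff_tabsChar (lam : DomWeight) :
    ⇑(tabsChar 0 0 lam.1 lam.2).coeff = mult lam.toWeight := by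
  apply eq_mult (isBdd_coeff _)
  intro mu
  have h (al : Weight) (h : AddMonoidAlgebra ℤ Weight) :
      wtDiff al h.coeff = ((1 - expo (-al)) * h).coeff :=
    funext fun mu => (coeff_one_sub_expo_mul al h mu).symm
  simp only [DomWeight.toWeight]
  rw [h, h, h, h, ← coeff_weylNum, ← weylDenom_mul_tabsChar, weylDenom]
  simp only [mul_assoc]
  rfl

theorem finite_crystal (lam : DomWeight) : (crystal lam).Finite := by
  rw [crystal_eq_tabs]
  exact finite_tabs _ _ _ _

/-- The character of the crystal is the specialization of the Kazhdan–Lusztig element. -/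
theorem domChar_crystal (lam : DomWeight) :
    domChar (crystal lam) = specialize (kl lam.toWeight) := by
  ext mu
  rw [coeff_domChar (finite_crystal lam), coeff_specialize_kl, crystal_eq_tabs,
    ← coeff_tabsChar]
  rfl

/-! ### The embedding of crystals -/

namespace Tableau

/-- Add the letter `a` at the left end and `1̄` at the right end of the first row. -/
def extendWith (a : Letter) (t : Tableau) : Tableau := ⟨a :: (t.row1 ++ [l1b]), t.row2⟩

/-- Replace the column `1, 1̄` by the column `2, 2̄`. -/
def fixCol (c : Letter × Letter) : Letter × Letter := if c = (l1, l1b) then (l2, l2b) else c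

theorem Phi_eq (t : Tableau) : t.Phi = (t.extendWith l1).repair := rfl

/-- Extending moves the first row one place to the right: the new letter joins the lower entry of
the first column, and the upper entry of that column becomes the new letter for the rest. This is
why the letter `1` in `Φ` is generalized to any `a`; it permits induction on the columns. -/
theorem extendWith_consCol (a : Letter) (c : Letter × Letter) (t : Tableau) :
    (t.consCol c).extendWith a = (t.extendWith c.1).consCol (a, c.2) := rfl

theorem repair_consCol (c : Letter × Letter) (t : Tableau) :
    (t.consCol c).repair = t.repair.consCol (fixCol c) := by
  by_cases h : c = (l1, l1b)
  · subst h
    simp [repair, consCol, fixCol, List.mapIdx_cons]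
    exact ⟨rfl, rfl⟩
  · have h' : ¬ (c.1 = l1 ∧ c.2 = l1b) := fun h' => h (Prod.ext h'.1 h'.2)
    simp [repair, consCol, fixCol, List.mapIdx_cons, h, h']
    exact ⟨rfl, rfl⟩

theorem repair_of_row2_eq_nil (r : List Letter) : (Tableau.mk r []).repair = ⟨r, []⟩ := by
  have h : (r.mapIdx fun _ a => a) = r := List.ext_getElem (by simp) (by simp)
  simp [repair, h]

theorem repair_of_notMem {t : Tableau} (h : l1 ∉ t.row1) : t.repair = t := by
  have h1 (j : ℕ) : t.row1[j]? ≠ some l1 := fun h' => h (List.mem_of_getElem? h')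
  apply Tableau.ext
  · apply List.ext_getElem (by simp [repair])
    intro j hj hj'
    have : t.row1[j] ≠ l1 := fun h' => h (h' ▸ List.getElem_mem hj')
    simp [repair, this]
  · apply List.ext_getElem (by simp [repair])
    intro j hj hj'
    simp [repair, h1]

theorem forall_mem_repair_row1 {t : Tableau} {p : Letter} (h : ∀ x ∈ t.row1, p ≤ x) :
    ∀ x ∈ t.repair.row1, p ≤ x := by
  intro x hx
  simp only [repair, List.mem_mapIdx] at hx
  obtain ⟨j, hj, rfl⟩ := hx
  have := h _ (List.getElem_mem hj)
  split_ifs with hc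
  · rw [hc.1] at this
    exact this.trans (by decide)
  · exact this

theorem forall_mem_repair_row2 {t : Tableau} {p : Letter} (hp : p ≤ l2b)
    (h : ∀ y ∈ t.row2, p ≤ y) : ∀ y ∈ t.repair.row2, p ≤ y := by
  intro y hy
  simp only [repair, List.mem_mapIdx] at hy
  obtain ⟨j, hj, rfl⟩ := hy
  split_ifs with hc
  · exact hp
  · exact h _ (List.getElem_mem hj)

theorem forall_mem_extendWith_row1 {a : Letter} {t : Tableau} (h : ∀ x ∈ t.row1, a ≤ x) :
    ∀ x ∈ (t.extendWith a).row1, a ≤ x := by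
  intro x hx
  simp only [extendWith, List.mem_cons, List.mem_append, List.not_mem_nil, or_false] at hx
  rcases hx with rfl | hx | rfl
  · exact le_rfl
  · exact h x hx
  · exact Fin.le_last a

theorem repair_extendWith_of_ne {a : Letter} (ha : a ≠ l1) {t : Tableau}
    (h : ∀ x ∈ t.row1, a ≤ x) : (t.extendWith a).repair = t.extendWith a :=
  repair_of_notMem fun hm =>
    ha (le_antisymm (forall_mem_extendWith_row1 h _ hm) (Fin.zero_le a))

theorem exists_eq_consCol {b : Letter} {r1 r2 : List Letter}
    (h : (Tableau.mk r1 (b :: r2)).IsKN) :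
    ∃ a r, r1 = a :: r ∧ (Tableau.mk r1 (b :: r2)) = (Tableau.mk r r2).consCol (a, b) := by
  cases r1 with
  | nil => simpa using h.1.1
  | cons a r => exact ⟨a, r, rfl, rfl⟩

/-- As long as the upper letters are `1`, a column keeps its form, being admissible already. A
column `1, 1̄` can arise only where the first row passes from `1` to a larger letter; after that no
letter `1` is left. -/
theorem isKN_repair_extendWith {t : Tableau} (ht : t.IsKN) {a : Letter}
    (ha : ∀ x ∈ t.row1, a ≤ x) : (t.extendWith a).repair.IsKN := by
  obtain ⟨r1, r2⟩ := t
  induction r2 generalizing r1 a with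
  | nil =>
    rw [isKN_of_row2_eq_nil] at ht
    rw [extendWith, repair_of_row2_eq_nil, isKN_of_row2_eq_nil, List.pairwise_cons,
      List.pairwise_append]
    refine ⟨fun x hx => ?_, ht, List.pairwise_singleton _ _, ?_⟩
    · exact forall_mem_extendWith_row1 ha x (List.mem_cons_of_mem _ hx)
    · intro x _ y hy
      rw [List.mem_singleton.mp hy]
      exact Fin.le_last x
  | cons b r2 ih =>
    obtain ⟨c, r, rfl, e⟩ := exists_eq_consCol ht
    rw [e] at ht ⊢
    obtain ⟨k1, k2, k3, k4, k5⟩ := (isKN_consCol _ _).mp ht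
    have hac : a ≤ c := ha c List.mem_cons_self
    dsimp only at k1 k3
    have hcb : b ≤ nextLetter (c, b) := le_nextLetter (c, b)
    rw [extendWith_consCol, repair_consCol, isKN_consCol]
    have hrow : ∀ x ∈ ((Tableau.mk r r2).extendWith c).repair.row1, c ≤ x :=
      forall_mem_repair_row1 (forall_mem_extendWith_row1 k3)
    dsimp only
    by_cases hc : c = l1
    · subst hc
      have ha0 : a = l1 := le_antisymm hac (Fin.zero_le a)
      subst ha0
      have hb : b ≤ l2b := by
        have : b ≠ l1b := fun h => k2 (by rw [h])
        revert this
        clear * -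
        revert b
        decide
      have hfix : fixCol (l1, b) = (l1, b) := if_neg k2
      have hnext : nextLetter (l1, b) = b := by simp [nextLetter]
      rw [hfix, hnext]
      rw [hnext] at k4
      exact ⟨k1, k2, hrow, forall_mem_repair_row2 hb k4, ih r k5 k3⟩
    -- With `c ≠ 1` the repair changes at most the present column, and the conditions between
    -- neighbours become a finite check.
    · have hrep := repair_extendWith_of_ne (t := ⟨r, r2⟩) hc k3
      have hrow2 : ((Tableau.mk r r2).extendWith c).repair.row2 = r2 := by rw [hrep]; rfl
      rw [hrow2]
      have key : (fixCol (a, b)).1 < (fixCol (a, b)).2 ∧ fixCol (a, b) ≠ (l1, l1b) ∧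
          (fixCol (a, b)).1 ≤ c ∧ nextLetter (fixCol (a, b)) ≤ nextLetter (c, b) := by
        revert hac k1 hc
        clear * -
        revert a b c
        decide
      exact ⟨key.1, key.2.1, fun x hx => key.2.2.1.trans (hrow x hx),
        fun y hy => key.2.2.2.trans (k4 y hy), ih r k5 k3⟩

/-- The repair is ambiguous only for a column `2, 2̄`, which may come from `1, 1̄` or have been
there before. The hypothesis on `a = 2` excludes the latter. It passes on to the remaining columns,
since after an upper letter `2` the bound `nextLetter` is always `1̄`; for `Φ` itself, where `a =
1`, it is vacuous. -/
theorem repair_extendWith_inj {t t' : Tableau} (ht : t.IsKN) (ht' : t'.IsKN) {a a' : Letter}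
    (ha : a = l2 → ∀ y ∈ t.row2, l1b ≤ y) (ha' : a' = l2 → ∀ y ∈ t'.row2, l1b ≤ y)
    (h : (t.extendWith a).repair = (t'.extendWith a').repair) : a = a' ∧ t = t' := by
  obtain ⟨r1, r2⟩ := t
  obtain ⟨r1', r2'⟩ := t'
  induction r2 generalizing r1 a r1' r2' a' with
  | nil =>
    have h2 := congrArg (fun t => t.row2.length) h
    simp only [repair, extendWith, List.length_mapIdx, List.length_nil] at h2
    obtain rfl := List.length_eq_zero_iff.mp h2.symm
    rw [extendWith, extendWith, repair_of_row2_eq_nil, repair_of_row2_eq_nil] at h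
    simpa using h
  | cons b r2 ih =>
    cases r2' with
    | nil =>
      have h2 := congrArg (fun t => t.row2.length) h
      simp [repair, extendWith] at h2
    | cons b' r2' =>
      obtain ⟨c, r, rfl, e⟩ := exists_eq_consCol ht
      obtain ⟨c', r', rfl, e'⟩ := exists_eq_consCol ht'
      rw [e, e', extendWith_consCol, extendWith_consCol, repair_consCol, repair_consCol] at h
      rw [e, isKN_consCol] at ht
      rw [e', isKN_consCol] at ht'
      have hh := congrArg Tableau.row1 h
      have hh' := congrArg Tableau.row2 h
      simp only [consCol, List.cons.injEq] at hh hh'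
      have hn {c b : Letter} {r2 : List Letter} (hcb : c < b)
          (hr2 : ∀ y ∈ r2, nextLetter (c, b) ≤ y) : c = l2 → ∀ y ∈ r2, l1b ≤ y := by
        intro hc y hy
        refine le_trans ?_ (hr2 y hy)
        revert hc hcb
        clear * -
        revert c b
        decide
      obtain ⟨rfl, h2⟩ := ih _ ht.2.2.2.2 (hn ht.1 ht.2.2.2.1) _ _ ht'.2.2.2.2
        (hn ht'.1 ht'.2.2.2.1) (Tableau.ext hh.2 hh'.2)
      simp only [Tableau.mk.injEq] at h2
      obtain ⟨rfl, rfl⟩ := h2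
      have hb : a = l2 → l1b ≤ b := fun h => ha h b List.mem_cons_self
      have hb' : a' = l2 → l1b ≤ b' := fun h => ha' h b' List.mem_cons_self
      have : a = a' ∧ b = b' := by
        have := And.intro hh.1 hh'.1
        revert this hb hb'
        clear * -
        revert a a' b b'
        decide
      exact ⟨this.1, by rw [this.2]⟩

theorem wt_repair_extendWith {t : Tableau} (ht : t.row2.length ≤ t.row1.length) (a : Letter) :
    (t.extendWith a).repair.wt = letterWt a + letterWt l1b + t.wt := by
  obtain ⟨r1, r2⟩ := t
  induction r2 generalizing r1 a with
  | nil =>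
    rw [extendWith, repair_of_row2_eq_nil]
    have h1 := wt_consLetter a ⟨r1 ++ [l1b], []⟩
    have h2 := wt_consLetter l1b ⟨r1, []⟩
    have h3 : (Tableau.mk (r1 ++ [l1b]) []).wt = (Tableau.mk (l1b :: r1) []).wt := by
      simp [wt, List.count_append, List.count_cons]
    rw [consLetter] at h1 h2
    rw [h1, h3, h2, add_assoc]
  | cons b r2 ih =>
    cases r1 with
    | nil => simp at ht
    | cons c r =>
      have e : (Tableau.mk (c :: r) (b :: r2)) = (Tableau.mk r r2).consCol (c, b) := rfl
      have hfix : letterWt (fixCol (a, b)).1 + letterWt (fixCol (a, b)).2 =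
          letterWt a + letterWt b := by
        clear * -
        revert a b
        decide
      rw [e, extendWith_consCol, repair_consCol, wt_consCol, wt_consCol,
        ih c r (by simpa using ht), hfix]
      dsimp only
      abel

end Tableau

/-! ### The map `Φ` on crystals and the character of the principal preatom -/

theorem Phi_mem_crystal {n m : ℕ} {t : Tableau} (ht : t ∈ crystal (n, m)) :
    t.Phi ∈ crystal (n + 2, m) := by
  obtain ⟨h1, h2, h3⟩ := ht
  refine ⟨?_, ?_, ?_⟩
  · simp [Tableau.Phi, Tableau.extend, Tableau.repair, h1]
    omega
  · simp [Tableau.Phi, Tableau.extend, Tableau.repair, h2]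
  · exact Tableau.isKN_repair_extendWith h3 fun x _ => Fin.zero_le x

theorem Phi_injOn (lam : DomWeight) : Set.InjOn Tableau.Phi (crystal lam) := fun _ ht _ ht' h =>
  (Tableau.repair_extendWith_inj ht.2.2 ht'.2.2 (fun h => absurd h (by decide))
    (fun h => absurd h (by decide)) h).2

theorem wt_Phi {lam : DomWeight} {t : Tableau} (ht : t ∈ crystal lam) : t.Phi.wt = t.wt := by
  rw [Tableau.Phi_eq, Tableau.wt_repair_extendWith ht.2.2.1.1,
    show Tableau.letterWt l1 + Tableau.letterWt l1b = 0 by decide, zero_add]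

theorem fullChar_image_Phi (lam : DomWeight) :
    fullChar (Tableau.Phi '' crystal lam) = fullChar (crystal lam) := by
  rw [fullChar, finsum_mem_image (Phi_injOn lam)]
  exact finsum_mem_congr rfl fun t ht => by rw [wt_Phi ht]

/-- The character of the principal preatom. -/
theorem domChar_principalPreatom (lam : DomWeight) :
    domChar (principalPreatom lam) = if 2 ≤ lam.1 then
      domChar (crystal lam) - domChar (crystal (lam.1 - 2, lam.2)) else domChar (crystal lam) := by
  rw [principalPreatom]
  split_ifs with h
  · have hsub : Tableau.Phi '' crystal (lam.1 - 2, lam.2) ⊆ crystal lam := by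
      rintro _ ⟨t, ht, rfl⟩
      have := Phi_mem_crystal ht
      rwa [Nat.sub_add_cancel h] at this
    have hadd : fullChar (crystal lam \ (Tableau.Phi '' crystal (lam.1 - 2, lam.2))) =
        fullChar (crystal lam) - fullChar (crystal (lam.1 - 2, lam.2)) := by
      rw [eq_sub_iff_add_eq, ← fullChar_image_Phi, add_comm]
      exact finsum_mem_add_sdiff hsub (finite_crystal lam)
    ext mu
    rw [AddMonoidAlgebra.coeff_sub, Finsupp.sub_apply, coeff_domChar (finite_crystal _),
      coeff_domChar (finite_crystal _), coeff_domChar ((finite_crystal _).subset Set.sdiff_subset),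
      hadd, AddMonoidAlgebra.coeff_sub, Finsupp.sub_apply]
  · rfl

end TypeC2

theorem mainTheorem6 (lam : TypeC2.DomWeight) :
    TypeC2.domChar (TypeC2.crystal lam) = TypeC2.specialize (TypeC2.kl lam.toWeight) ∧
      TypeC2.domChar (TypeC2.principalPreatom lam) =
        TypeC2.specialize (TypeC2.modPrecan3 lam) := by
  refine ⟨TypeC2.domChar_crystal lam, ?_⟩
  rw [TypeC2.domChar_principalPreatom, TypeC2.specialize_modPrecan3, TypeC2.domChar_crystal,
    TypeC2.domChar_crystal]
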